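/- **Model.** For each $t\in\mathbb N$ consider $m$ clusters of sizes $n_1,\dots,n_m$ (both depending on $t$), with $1\le n_i\le n_{\max}$ for a fixed $n_{\max}$ and $N=\sum_i n_i\to\infty$. Let $Z=\text{block diag}(j_{n_1},\dots,j_{n_m})$ with $j_n=(1,\dots,1)^\top\in\mathbb R^n$, $G=ZZ^\top=\text{block diag}(J_{n_1},\dots,J_{n_m})$ with $J_n=j_nj_n^\top$, and $$y=X\beta+Zv+\varepsilon,$$ where $X$ is a known $N\times p$ matrix, $\beta\in\mathbb R^p$ ($p$ and $\beta$ fixed), and all the $v_i$ and $\varepsilon_{ij}$ are independent, centred, with variances $\psi_1$ and $\psi_2$ respectively, $E[(v_i/\sqrt{\psi_1})^4]=K_v+3$, $E[(\varepsilon_{ij}/\sqrt{\psi_2})^4]=K_e+3$, and with uniformly bounded eighth moments; normality and $K_e=K_v=0$ are not assumed. Thus $\mathrm{Cov}(y)=\Sigma=\Sigma(\psi)$, where $\Sigma(\theta)=\theta_1G+\theta_2I_N$, $\Sigma_{(1)}=G$ and $\Sigma_{(2)}=I_N$. **Estimating equations.** For $\theta\in(0,\infty)^2$ let $L=L(\theta)$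 be a $p\times N$ matrix with $LX=I_p$, let $W_1=W_1(\theta)$, $W_2=W_2(\theta)$ be symmetric $N\times N$ matrices, all three times continuously differentiable in $\theta$, and let $Q=I_N-XL$. The estimating equations are $$y^\top Q^\top W_aQy-\mathrm{tr}(Q^\top W_aQ\Sigma(\theta))=0,\qquad a=1,2.\qquad(*)$$ Let $\Theta\subset(0,\infty)^2$ be compact and convex with the true $\psi=(\psi_1,\psi_2)$ in its interior. Let $A=A(\theta)$ be the $2\times2$ matrix with $A_{ab}=\mathrm{tr}(W_a\Sigma_{(b)})$, i.e. $$A=\begin{pmatrix}\mathrm{tr}(W_1G)&\mathrm{tr}(W_1)\\ \mathrm{tr}(W_2G)&\mathrm{tr}(W_2)\end{pmatrix}.$$ Assume, uniformly in $\theta\in\Theta$ and in $t$: the entries of $XL$ and of its partial derivatives in $\theta$ up to order three are $O(N^{-1})$; the spectral norms of $W_a$ and of its partial derivatives up to order three are $O(1)$; and, for all sufficiently large $t$, $A$ is invertible with $A^{-1}=O(N^{-1})$. **Estimator.** Let $\hat\psi$ be a random vector in $\mathbb R^2$ such that, almost surely, whenever $(*)$ has a solution in $\Theta$, $\hat\psi$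 is such a solution, and such that $E\hat\psi_a^8$ is bounded in $t$ (both hold for instance if $\hat\psi$ is a measurable $\Theta$-valued choice of a solution whenever there is one). **Claim.** Put, with everything evaluated at $\psi$ and $W_{a(b)}=\partial W_a/\partial\psi_b$, $$B_{ab}=\mathrm{tr}(W_a\Sigma W_b\Sigma),\qquad \kappa(C,D)=\psi_2^2K_e\sum_{i=1}^N C_{ii}D_{ii}+\psi_1^2K_v\sum_{i=1}^m(Z^\top CZ)_{ii}(Z^\top DZ)_{ii},\qquad \tilde B_{ab}=\kappa(W_a,W_b),$$ $$(K_a)_{bc}=\mathrm{tr}(W_{a(b)}\Sigma W_c\Sigma),\qquad (H_a)_{bc}=\mathrm{tr}(W_{a(b)}\Sigma_{(c)}),\qquad(\tilde K_a)_{bc}=\kappa(W_{a(b)},W_c)\qquad(a,b,c\in\{1,2\}),$$ and write $A^{-\top}=(A^{-1})^\top$. Then, as $t\to\infty$, $$\mathrm{Cov}(\hat\psi)=2A^{-1}BA^{-\top}+A^{-1}\tilde BA^{-\top}+O(N^{-3/2}),$$ $$E(\hat\psi-\psi)=2A^{-1}\begin{pmatrix}\mathrm{tr}(K_1A^{-\top})-\mathrm{tr}(H_1A^{-1}BA^{-\top})\\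 \mathrm{tr}(K_2A^{-\top})-\mathrm{tr}(H_2A^{-1}BA^{-\top})\end{pmatrix}+A^{-1}\begin{pmatrix}\mathrm{tr}(\tilde K_1A^{-\top})-\mathrm{tr}(H_1A^{-1}\tilde BA^{-\top})\\ \mathrm{tr}(\tilde K_2A^{-\top})-\mathrm{tr}(H_2A^{-1}\tilde BA^{-\top})\end{pmatrix}+O(N^{-3/2}).$$ If $A$ is symmetric (as for $W_a=\Sigma^{-1}\Sigma_{(a)}\Sigma^{-1}$, $(\Sigma^{-1}\Sigma_{(a)}+\Sigma_{(a)}\Sigma^{-1})/2$ and $\Sigma_{(a)}$), then $A^{-\top}=A^{-1}$. -/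

import Mathlib

open MeasureTheory ProbabilityTheory Filter Asymptotics
open scoped Matrix

noncomputable section

namespace NER

/-- The observation labels `(i, j)`, `1 ≤ j ≤ n i`, of `m` clusters with sample sizes `n i`. -/
abbrev Obs {m : ℕ} (n : Fin m → ℕ) : Type := Σ i : Fin m, Fin (n i)

/-- The total sample size `N = ∑ n i`. -/
def total {m : ℕ} (n : Fin m → ℕ) : ℕ := ∑ i, n i

/-- `Z = block diag (j_{n_1}, …, j_{n_m})`. -/
def Z {m : ℕ} (n : Fin m → ℕ) : Matrix (Obs n) (Fin m) ℝ :=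
  Matrix.of fun k i => if k.1 = i then 1 else 0

/-- `G = block diag (J_{n_1}, …, J_{n_m})`, the blocks being all-ones matrices. -/
def G {m : ℕ} (n : Fin m → ℕ) : Matrix (Obs n) (Obs n) ℝ :=
  Matrix.blockDiagonal' fun i : Fin m => (Matrix.of fun _ _ => 1 : Matrix (Fin (n i)) (Fin (n i)) ℝ)

/-- The covariance matrix `Σ(θ) = θ₁ G + θ₂ I_N` (the indices `0, 1 : Fin 2` stand for `1, 2`). -/
def Sig {m : ℕ} (n : Fin m → ℕ) (θ : Fin 2 → ℝ) : Matrix (Obs n) (Obs n) ℝ :=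
  θ 0 • G n + θ 1 • 1

/-- The pairs of positive variance components. -/
def paramSpace : Set (Fin 2 → ℝ) := {θ | ∀ a, 0 < θ a}

/-- `∂ f / ∂ θ_b`. -/
def partialDeriv (b : Fin 2) (f : (Fin 2 → ℝ) → ℝ) (θ : Fin 2 → ℝ) : ℝ :=
  fderiv ℝ f θ (Pi.single b 1)

/-- The entrywise partial derivative `∂_b F` of a matrix-valued function of `θ`. -/
def matPartial {ι κ : Type} (b : Fin 2) (F : (Fin 2 → ℝ) → Matrix ι κ ℝ)
    (θ : Fin 2 → ℝ) : Matrix ι κ ℝ :=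
  Matrix.of fun i j => partialDeriv b (fun η => F η i j) θ

/-- The iterated partial derivative of a matrix-valued function along a list of indices. -/
def matPartials {ι κ : Type} :
    List (Fin 2) → ((Fin 2 → ℝ) → Matrix ι κ ℝ) → (Fin 2 → ℝ) → Matrix ι κ ℝ
  | [], F => F
  | b :: l, F => matPartial b (matPartials l F)

/-- The derivatives `Σ_(1) = G` and `Σ_(2) = I_N` of the covariance matrix. -/
def dSig {m : ℕ} (n : Fin m → ℕ) : Fin 2 → Matrix (Obs n) (Obs n) ℝ := ![G n, 1]

/-- The left-hand side of the `a`-th estimating equation at `θ`,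
`yᵀ Qᵀ W_a Q y - tr (Qᵀ W_a Q Σ)`, with `Q = I - X L` and everything evaluated at `θ`. -/
def estEq {m p : ℕ} {n : Fin m → ℕ} (X : Matrix (Obs n) (Fin p) ℝ)
    (L : (Fin 2 → ℝ) → Matrix (Fin p) (Obs n) ℝ)
    (W : Fin 2 → (Fin 2 → ℝ) → Matrix (Obs n) (Obs n) ℝ)
    (y : Obs n → ℝ) (θ : Fin 2 → ℝ) (a : Fin 2) : ℝ :=
  let Q : Matrix (Obs n) (Obs n) ℝ := 1 - X * L θ
  y ⬝ᵥ ((Qᵀ * W a θ * Q) *ᵥ y) - (Qᵀ * W a θ * Q * Sig n θ).trace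

/-- `θ` solves the estimating equations. -/
def Solves {m p : ℕ} {n : Fin m → ℕ} (X : Matrix (Obs n) (Fin p) ℝ)
    (L : (Fin 2 → ℝ) → Matrix (Fin p) (Obs n) ℝ)
    (W : Fin 2 → (Fin 2 → ℝ) → Matrix (Obs n) (Obs n) ℝ)
    (y : Obs n → ℝ) (θ : Fin 2 → ℝ) : Prop :=
  ∀ a, estEq X L W y θ a = 0

/-- The response vector `y = X β + Z v + ε`. -/
def response {m p : ℕ} {n : Fin m → ℕ} (X : Matrix (Obs n) (Fin p) ℝ) (β : Fin p → ℝ)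
    (v : Fin m → ℝ) (ε : Obs n → ℝ) : Obs n → ℝ :=
  X *ᵥ β + Z n *ᵥ v + ε

/-- The random effects `v_i` and the errors `ε_ij` are independent and centred, with variances
`ψ₁`, `ψ₂`, and their standardized fourth moments are `K_v + 3` and `K_e + 3`. -/
structure IsNER {Ω : Type*} [MeasurableSpace Ω] (P : Measure Ω) {m : ℕ} (n : Fin m → ℕ)
    (ψ : Fin 2 → ℝ) (Ke Kv : ℝ) (v : Fin m → Ω → ℝ) (ε : Obs n → Ω → ℝ) : Prop where
  meas_v : ∀ i, Measurable (v i)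
  meas_e : ∀ k, Measurable (ε k)
  indep : iIndepFun (Sum.elim v ε : Fin m ⊕ Obs n → Ω → ℝ) P
  mean_v : ∀ i, ∫ ω, v i ω ∂P = 0
  mean_e : ∀ k, ∫ ω, ε k ω ∂P = 0
  var_v : ∀ i, ∫ ω, v i ω ^ 2 ∂P = ψ 0
  var_e : ∀ k, ∫ ω, ε k ω ^ 2 ∂P = ψ 1
  fourth_v : ∀ i, ∫ ω, (v i ω / √(ψ 0)) ^ 4 ∂P = Kv + 3
  fourth_e : ∀ k, ∫ ω, (ε k ω / √(ψ 1)) ^ 4 ∂P = Ke + 3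

section formulas

variable {m : ℕ} {n : Fin m → ℕ} (W : Fin 2 → (Fin 2 → ℝ) → Matrix (Obs n) (Obs n) ℝ)
  (Ke Kv : ℝ) (θ : Fin 2 → ℝ)

/-- The matrix `A`. -/
def A : Matrix (Fin 2) (Fin 2) ℝ :=
  !![(W 0 θ * G n).trace, (W 0 θ).trace;
     (W 1 θ * G n).trace, (W 1 θ).trace]

/-- The matrix `B`. -/
def B : Matrix (Fin 2) (Fin 2) ℝ :=
  !![(W 0 θ * Sig n θ * W 0 θ * Sig n θ).trace, (W 0 θ * Sig n θ * W 1 θ * Sig n θ).trace;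
     (W 0 θ * Sig n θ * W 1 θ * Sig n θ).trace, (W 1 θ * Sig n θ * W 1 θ * Sig n θ).trace]

/-- `θ₂² K_e ∑ C_ii D_ii + θ₁² K_v ∑ (Zᵀ C Z)_ii (Zᵀ D Z)_ii`. -/
def kurt (C D : Matrix (Obs n) (Obs n) ℝ) : ℝ :=
  θ 1 ^ 2 * Ke * ∑ k, C k k * D k k
    + θ 0 ^ 2 * Kv * ∑ i, ((Z n)ᵀ * C * Z n) i i * ((Z n)ᵀ * D * Z n) i i

/-- The matrix `B̃`. -/
def Btilde : Matrix (Fin 2) (Fin 2) ℝ :=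
  Matrix.of fun a b => kurt Ke Kv θ (W a θ) (W b θ)

/-- `(K_a)_bc = tr (W_a(b) Σ W_c Σ)`. -/
def K (a : Fin 2) : Matrix (Fin 2) (Fin 2) ℝ :=
  Matrix.of fun b c => (matPartial b (W a) θ * Sig n θ * W c θ * Sig n θ).trace

/-- `(H_a)_bc = tr (W_a(b) Σ_(c))`. -/
def H (a : Fin 2) : Matrix (Fin 2) (Fin 2) ℝ :=
  Matrix.of fun b c => (matPartial b (W a) θ * dSig n c).trace

/-- The matrix `K̃_a`. -/
def Ktilde (a : Fin 2) : Matrix (Fin 2) (Fin 2) ℝ :=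
  Matrix.of fun b c => kurt Ke Kv θ (matPartial b (W a) θ) (W c θ)

/-- The asymptotic covariance matrix `2 A⁻¹ B A⁻ᵀ + A⁻¹ B̃ A⁻ᵀ`. -/
def asympCov : Matrix (Fin 2) (Fin 2) ℝ :=
  2 • ((A W θ)⁻¹ * B W θ * ((A W θ)⁻¹)ᵀ)
    + (A W θ)⁻¹ * Btilde W Ke Kv θ * ((A W θ)⁻¹)ᵀ

/-- The second-order bias
`2 A⁻¹ col_a (tr (K_a A⁻ᵀ) - tr (H_a A⁻¹ B A⁻ᵀ)) + A⁻¹ col_a (tr (K̃_a A⁻ᵀ) - tr (H_a A⁻¹ B̃ A⁻ᵀ))`. -/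
def secondOrderBias : Fin 2 → ℝ :=
  2 • ((A W θ)⁻¹ *ᵥ fun a =>
      (K W θ a * ((A W θ)⁻¹)ᵀ).trace
        - (H W θ a * (A W θ)⁻¹ * B W θ * ((A W θ)⁻¹)ᵀ).trace)
    + (A W θ)⁻¹ *ᵥ fun a =>
      (Ktilde W Ke Kv θ a * ((A W θ)⁻¹)ᵀ).trace
        - (H W θ a * (A W θ)⁻¹ * Btilde W Ke Kv θ * ((A W θ)⁻¹)ᵀ).trace

end formulas

end NER

end

/-! Write `M_i = Qᵀ W_i Q`, `u = Z v + ε`, and let `N` be the total sample size. Since `L X = I`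
removes `X β` and `Σ(θ)` is linear in `θ`, the estimating equations become `a(θ)(θ - ψ) = ξ(θ)`,
with deterministic coefficients `a_ib = tr(M_i Σ_(b)) / N` and fluctuations `ξ_i = (uᵀ M_i u -
tr(M_i Σ(ψ))) / N` (`RegularDesign.solves_iff`). At each fixed `θ`, `ξ` and its derivatives are
centred quadratic forms of size `N^{-1/2}` in `L⁴`, while `a` is smooth and uniformly invertible for
large `N`.

The probabilistic input concerns quadratic forms in independent variables. When the variables are
added one at a time, the increments of a form are martingale differences. This gives the fourth
moment bound `CentredFamily.integral_quadForm_pow_four_le` in terms of the Frobenius norm, and the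
exact covariance `CentredFamily.integral_quadForm_mul_quadForm`, in which fourth moments produce the
kurtosis terms and third moments cancel.

The analytic input is deterministic. Let `S` bound `ξ` and its derivatives of order at most two on a
finite net of `Θ`. If `S` is small, a root exists (`RegularSystem.exists_isRoot`), every root in `Θ`
is within `O(S)` of `ψ` (`RegularSystem.norm_sub_le`), and it has an expansion into a linear term, a
quadratic term and a remainder `O(S³)` (`RegularSystem.expansion`). If `S` is not small, constants
are themselves `O(S³)`. Hence `exists_expansionBound` gives an error `K S³ (1 + ‖θ - ψ‖²)` on every
outcome, with no exceptional event to estimate. As `E S⁴ = O(N⁻²)` and the estimator has bounded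
eighth moments, the error has expectation `O(N^{-3/2})`.

The linear term has mean zero and yields the covariance; the quadratic term yields the bias. Both
are `1/N` times polynomials in bounded quantities. Finally `M_i` is replaced by `W_i`: the
difference has Frobenius norm `O(1)`, against the `O(√N)` allowed for `W_i`, so the bounded
quantities change by `O(N^{-1/2})` and the moments by `O(N^{-3/2})`. -/

set_option linter.unusedSectionVars false

namespace NER

/-! ### Fourth moments of sums with orthogonal increments. -/

section FourthMoments

variable {Ω : Type*} [MeasurableSpace Ω] {P : Measure Ω}

lemma memLp_four_iff {f : Ω → ℝ} (hf : AEStronglyMeasurable f P) :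
    MemLp f 4 P ↔ Integrable (fun ω => f ω ^ 4) P := by
  have h := integrable_norm_rpow_iff (p := 4) hf (by norm_num) (by norm_num)
  rw [← h]
  refine integrable_congr (ae_of_all _ fun ω => ?_)
  have h4 : (4 : ENNReal).toReal = ((4 : ℕ) : ℝ) := by norm_num
  simp only [h4, Real.rpow_natCast, Real.norm_eq_abs]
  exact Even.pow_abs (by decide) _

lemma _root_.MeasureTheory.MemLp.integrable_pow_four {f : Ω → ℝ} (hf : MemLp f 4 P) :
    Integrable (fun ω => f ω ^ 4) P :=
  (memLp_four_iff hf.1).1 hf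

lemma abs_pow_mul_pow_le (x y : ℝ) {i j : ℕ} (hij : i + j = 4) :
    |x ^ i * y ^ j| ≤ x ^ 4 + y ^ 4 := by
  have key : ∀ a b : ℝ, 0 ≤ a → 0 ≤ b → a ^ i * b ^ j ≤ a ^ 4 + b ^ 4 := by
    intro a b ha hb
    rcases le_total a b with h | h
    · calc a ^ i * b ^ j ≤ b ^ i * b ^ j := by gcongr
        _ = b ^ 4 := by rw [← pow_add, hij]
        _ ≤ _ := by have := pow_nonneg ha 4; linarith
    · calc a ^ i * b ^ j ≤ a ^ i * a ^ j := by gcongr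
        _ = a ^ 4 := by rw [← pow_add, hij]
        _ ≤ _ := by have := pow_nonneg hb 4; linarith
  have := key |x| |y| (abs_nonneg _) (abs_nonneg _)
  have e4 : Even 4 := by decide
  rwa [e4.pow_abs, e4.pow_abs, ← abs_pow, ← abs_pow, ← abs_mul] at this

lemma integrable_pow_mul_pow {f g : Ω → ℝ} (hf : MemLp f 4 P) (hg : MemLp g 4 P) {i j : ℕ}
    (hij : i + j = 4) : Integrable (fun ω => f ω ^ i * g ω ^ j) P := by
  refine (hf.integrable_pow_four.add hg.integrable_pow_four).mono'
    ((hf.1.pow i).mul (hg.1.pow j)) (ae_of_all _ fun ω => ?_)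
  exact abs_pow_mul_pow_le _ _ hij

/-- Cauchy–Schwarz, by integrating a weighted arithmetic-geometric mean inequality. Fourth moments
are bounded by squares because the bases of these squares are what adds up along the martingale
arguments. -/
lemma integral_sq_mul_sq_le {f g : Ω → ℝ} (hf : MemLp f 4 P) (hg : MemLp g 4 P) {x y : ℝ}
    (hx : 0 ≤ x) (hy : 0 ≤ y) (hfx : ∫ ω, f ω ^ 4 ∂P ≤ x ^ 2) (hgy : ∫ ω, g ω ^ 4 ∂P ≤ y ^ 2) :
    ∫ ω, f ω ^ 2 * g ω ^ 2 ∂P ≤ x * y := by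
  have hif := hf.integrable_pow_four
  have hig := hg.integrable_pow_four
  have hfg := integrable_pow_mul_pow hf hg (i := 2) (j := 2) rfl
  -- The shift by `e` keeps the weights finite when `x` or `y` vanishes; it is removed by letting
  -- `e` tend to zero.
  have key : ∀ e : ℝ, 0 < e → ∫ ω, f ω ^ 2 * g ω ^ 2 ∂P ≤ (x + e) * (y + e) := by
    intro e he
    have hX : 0 < x + e := by linarith
    have hY : 0 < y + e := by linarith
    have h1 : ∫ ω, f ω ^ 2 * g ω ^ 2 ∂P ≤
        ∫ ω, ((y + e) / (2 * (x + e)) * f ω ^ 4 + (x + e) / (2 * (y + e)) * g ω ^ 4) ∂P := by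
      refine integral_mono hfg ((hif.const_mul _).add (hig.const_mul _)) fun ω => ?_
      have : (y + e) / (2 * (x + e)) * f ω ^ 4 + (x + e) / (2 * (y + e)) * g ω ^ 4
          - f ω ^ 2 * g ω ^ 2
          = ((y + e) * f ω ^ 2 - (x + e) * g ω ^ 2) ^ 2 / (2 * (x + e) * (y + e)) := by
        field_simp
        ring
      have h2 : 0 ≤ ((y + e) * f ω ^ 2 - (x + e) * g ω ^ 2) ^ 2 / (2 * (x + e) * (y + e)) := by
        positivity
      simp only
      linarith
    rw [integral_add (hif.const_mul _) (hig.const_mul _), integral_const_mul,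
      integral_const_mul] at h1
    have h3 : (y + e) / (2 * (x + e)) * ∫ ω, f ω ^ 4 ∂P
        ≤ (y + e) / (2 * (x + e)) * (x + e) ^ 2 := by
      gcongr
      nlinarith
    have h4 : (x + e) / (2 * (y + e)) * ∫ ω, g ω ^ 4 ∂P
        ≤ (x + e) / (2 * (y + e)) * (y + e) ^ 2 := by
      gcongr
      nlinarith
    have h5 : (y + e) / (2 * (x + e)) * (x + e) ^ 2 + (x + e) / (2 * (y + e)) * (y + e) ^ 2
        = (x + e) * (y + e) := by
      field_simp
      ring
    linarith
  have hlim : Tendsto (fun e : ℝ => (x + e) * (y + e)) (nhdsWithin 0 (Set.Ioi 0))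
      (nhds (x * y)) := by
    have : ContinuousAt (fun e : ℝ => (x + e) * (y + e)) 0 := by fun_prop
    simpa using this.tendsto.mono_left nhdsWithin_le_nhds
  exact ge_of_tendsto hlim (eventually_nhdsWithin_of_forall fun e he => key e he)

lemma integral_add_four {f₁ f₂ f₃ f₄ : Ω → ℝ} (h₁ : Integrable f₁ P) (h₂ : Integrable f₂ P)
    (h₃ : Integrable f₃ P) (h₄ : Integrable f₄ P) :
    ∫ ω, (f₁ ω + (f₂ ω + (f₃ ω + f₄ ω))) ∂P
      = ∫ ω, f₁ ω ∂P + (∫ ω, f₂ ω ∂P + (∫ ω, f₃ ω ∂P + ∫ ω, f₄ ω ∂P)) := by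
  have h34 : Integrable (fun ω => f₃ ω + f₄ ω) P := h₃.add h₄
  have h234 : Integrable (fun ω => f₂ ω + (f₃ ω + f₄ ω)) P := h₂.add h34
  rw [integral_add h₁ h234, integral_add h₂ h34, integral_add h₃ h₄]

/-- The increment of the fourth moment when an orthogonal difference is added. -/
lemma integral_add_pow_four_le {S D : Ω → ℝ} (hS : MemLp S 4 P) (hD : MemLp D 4 P)
    (horth : ∫ ω, S ω ^ 3 * D ω ∂P = 0) {x d : ℝ} (hx : 0 ≤ x) (hd : 0 ≤ d)
    (hSx : ∫ ω, S ω ^ 4 ∂P ≤ x ^ 2) (hDd : ∫ ω, D ω ^ 4 ∂P ≤ d ^ 2) :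
    ∫ ω, (S ω + D ω) ^ 4 ∂P ≤ (x + 4 * d) ^ 2 := by
  have i31 : Integrable (fun ω => S ω ^ 3 * D ω) P := by
    simpa using integrable_pow_mul_pow hS hD (i := 3) (j := 1) rfl
  have i22 := integrable_pow_mul_pow hS hD (i := 2) (j := 2) rfl
  -- By `4SD³ ≤ 2S²D² + 2D⁴`, the only odd term left is `S³D`, which has integral zero. What remains
  -- is at most `x² + 8xd + 3d² ≤ (x + 4d)²`.
  have h1 : ∫ ω, (S ω + D ω) ^ 4 ∂P ≤
      ∫ ω, (S ω ^ 4 + (4 * (S ω ^ 3 * D ω) + (8 * (S ω ^ 2 * D ω ^ 2) + 3 * D ω ^ 4))) ∂P := by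
    refine integral_mono (hS.add hD).integrable_pow_four
      (hS.integrable_pow_four.add ((i31.const_mul 4).add
        ((i22.const_mul 8).add (hD.integrable_pow_four.const_mul 3)))) fun ω => ?_
    have := mul_nonneg (sq_nonneg (D ω)) (sq_nonneg (S ω - D ω))
    simp only
    nlinarith
  rw [integral_add_four hS.integrable_pow_four (i31.const_mul 4) (i22.const_mul 8)
    (hD.integrable_pow_four.const_mul 3), integral_const_mul, integral_const_mul,
    integral_const_mul, horth] at h1
  have h2 := integral_sq_mul_sq_le hS hD hx hd hSx hDd
  nlinarith [sq_nonneg d]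

end FourthMoments

/-! ### Fourth moments and covariances of quadratic forms in independent variables. -/

section QuadraticForms

variable {Ω : Type*} [MeasurableSpace Ω] {ι : Type*} [DecidableEq ι]

/-- A family of independent centred random variables with variances `σ i`, fourth moments `τ i`
and eighth moments controlled by `c`. -/
structure CentredFamily (P : Measure Ω) (w : ι → Ω → ℝ) (σ τ : ι → ℝ) (c : ℝ) : Prop where
  meas : ∀ i, Measurable (w i)
  indep : iIndepFun w P
  mean : ∀ i, ∫ ω, w i ω ∂P = 0
  var : ∀ i, ∫ ω, w i ω ^ 2 ∂P = σ i
  fourth : ∀ i, ∫ ω, w i ω ^ 4 ∂P = τ i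
  int_eighth : ∀ i, Integrable (fun ω => w i ω ^ 8) P
  nonneg : 0 ≤ c
  fourth_le : ∀ i, τ i ≤ c ^ 2
  sq_fourth_le : ∀ i, ∫ ω, (w i ω ^ 2 - σ i) ^ 4 ∂P ≤ c ^ 2

/-- The linear form `∑_{j ∈ s} d_j w_j`. -/
def linForm (w : ι → Ω → ℝ) (s : Finset ι) (d : ι → ℝ) (ω : Ω) : ℝ := ∑ j ∈ s, d j * w j ω

/-- The centred quadratic form `∑_{i, j ∈ s} C_ij w_i w_j - ∑_{i ∈ s} C_ii σ_i`. -/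
def quadForm (w : ι → Ω → ℝ) (σ : ι → ℝ) (s : Finset ι) (C : Matrix ι ι ℝ) (ω : Ω) : ℝ :=
  ∑ i ∈ s, ∑ j ∈ s, C i j * w i ω * w j ω - ∑ i ∈ s, C i i * σ i

/-- The increment of `quadForm` when the index `k` is added to `s`. -/
def quadIncr (w : ι → Ω → ℝ) (σ : ι → ℝ) (s : Finset ι) (C : Matrix ι ι ℝ) (k : ι) (ω : Ω) : ℝ :=
  C k k * (w k ω ^ 2 - σ k) + 2 * w k ω * linForm w s (C k) ω

lemma quadForm_insert {w : ι → Ω → ℝ} {σ : ι → ℝ} {s : Finset ι} {C : Matrix ι ι ℝ}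
    (hC : C.IsSymm) {k : ι} (hk : k ∉ s) (ω : Ω) :
    quadForm w σ (insert k s) C ω = quadForm w σ s C ω + quadIncr w σ s C k ω := by
  simp only [quadForm, quadIncr, linForm, Finset.sum_insert hk, Finset.sum_add_distrib,
    Finset.mul_sum]
  have h : ∀ x ∈ s, C x k * w x ω * w k ω = C k x * w k ω * w x ω := by
    intro x _
    rw [hC.apply k x]
    ring
  have h2 : ∀ x ∈ s, 2 * w k ω * (C k x * w x ω) = 2 * (C k x * w k ω * w x ω) := by
    intro x _
    ring
  rw [Finset.sum_congr rfl h, Finset.sum_congr rfl h2, ← Finset.mul_sum]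
  ring

namespace CentredFamily

variable {P : Measure Ω} [IsProbabilityMeasure P] {w : ι → Ω → ℝ} {σ τ : ι → ℝ} {c : ℝ}
  (h : CentredFamily P w σ τ c)
include h

lemma memLp_sq (i : ι) : MemLp (fun ω => w i ω ^ 2) 4 P := by
  rw [memLp_four_iff ((h.meas i).pow_const 2).aestronglyMeasurable]
  simpa only [← pow_mul] using h.int_eighth i

lemma memLp_four (i : ι) : MemLp (w i) 4 P := by
  rw [memLp_four_iff (h.meas i).aestronglyMeasurable]
  refine ((integrable_const (1 : ℝ)).add (h.int_eighth i)).mono'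
    ((h.meas i).pow_const 4).aestronglyMeasurable (ae_of_all _ fun ω => ?_)
  have : 0 ≤ w i ω ^ 4 := by positivity
  rw [Real.norm_of_nonneg this]
  simp only [Pi.add_apply]
  nlinarith [sq_nonneg (w i ω ^ 4 - 1), sq_nonneg (w i ω ^ 4)]

lemma memLp_linForm (s : Finset ι) (d : ι → ℝ) : MemLp (linForm w s d) 4 P :=
  memLp_finsetSum s fun j _ => (h.memLp_four j).const_mul (d j)

lemma integrable (i : ι) : Integrable (w i) P := (h.memLp_four i).integrable (by norm_num)

lemma integrable_sq (i : ι) : Integrable (fun ω => w i ω ^ 2) P :=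
  (h.memLp_sq i).integrable (by norm_num)

/-- Independence of a new variable from the whole block of earlier ones takes the place of
conditional expectations: expectations of products factorize. -/
lemma indepFun_restrict {s : Finset ι} {k : ι} (hk : k ∉ s) :
    IndepFun (fun ω (j : s) => w j ω) (w k) P := by
  have := h.indep.indepFun_finset s {k} (by simpa using hk) h.meas
  exact this.comp measurable_id (measurable_pi_apply (⟨k, by simp⟩ : ({k} : Finset ι)))

lemma measurable_linForm (s : Finset ι) (d : ι → ℝ) : Measurable (linForm w s d) :=
  Finset.measurable_fun_sum _ fun j _ => (h.meas j).const_mul (d j)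

omit [IsProbabilityMeasure P] h [DecidableEq ι] in
lemma quadForm_eq_comp (s : Finset ι) (C : Matrix ι ι ℝ) :
    quadForm w σ s C = (fun x : s → ℝ => ∑ i : s, ∑ j : s, C i j * x i * x j - ∑ i ∈ s, C i i * σ i)
      ∘ fun ω (j : s) => w j ω := by
  funext ω
  simp only [quadForm, Function.comp]
  congr 1
  rw [← Finset.sum_coe_sort s]
  refine Finset.sum_congr rfl fun i _ => ?_
  rw [← Finset.sum_coe_sort s]

omit [IsProbabilityMeasure P] h [DecidableEq ι] in
lemma linForm_eq_comp (s : Finset ι) (d : ι → ℝ) :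
    linForm w s d = (fun x : s → ℝ => ∑ j : s, d j * x j) ∘ fun ω (j : s) => w j ω := by
  funext ω
  simp only [linForm, Function.comp]
  rw [← Finset.sum_coe_sort s]

lemma integral_mul_of_notMem {s : Finset ι} {k : ι} (hk : k ∉ s) {f : (s → ℝ) → ℝ}
    (hf : Measurable f) {g : ℝ → ℝ} (hg : Measurable g) :
    ∫ ω, f (fun j => w j ω) * g (w k ω) ∂P
      = (∫ ω, f (fun j => w j ω) ∂P) * ∫ ω, g (w k ω) ∂P := by
  have hF : Measurable (fun ω (j : s) => w j ω) := by
    have := h.meas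
    fun_prop
  exact ((h.indepFun_restrict hk).comp hf hg).integral_mul_eq_mul_integral
    (hf.comp hF).aestronglyMeasurable (hg.comp (h.meas k)).aestronglyMeasurable

lemma integrable_mul_of_notMem {s : Finset ι} {k : ι} (hk : k ∉ s) {f : (s → ℝ) → ℝ}
    (hf : Measurable f) {g : ℝ → ℝ} (hg : Measurable g)
    (hif : Integrable (fun ω => f (fun j => w j ω)) P) (hig : Integrable (fun ω => g (w k ω)) P) :
    Integrable (fun ω => f (fun j => w j ω) * g (w k ω)) P :=
  ((h.indepFun_restrict hk).comp hf hg).integrable_mul hif hig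

lemma integral_linForm (s : Finset ι) (d : ι → ℝ) : ∫ ω, linForm w s d ω ∂P = 0 := by
  simp only [linForm]
  rw [integral_finsetSum _ fun j _ => (h.integrable j).const_mul _]
  simp [integral_const_mul, h.mean]

/-- A new summand is centred and independent of the earlier sum, hence orthogonal to its cube. The
bounds then add up, with the factor 4 of `integral_add_pow_four_le`. -/
lemma integral_linForm_pow_four_le (s : Finset ι) (d : ι → ℝ) :
    ∫ ω, linForm w s d ω ^ 4 ∂P ≤ (4 * c * ∑ j ∈ s, d j ^ 2) ^ 2 := by
  have hc := h.nonneg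
  induction s using Finset.induction_on with
  | empty => simp [linForm]
  | insert k s hk ih =>
    have heq : linForm w (insert k s) d = fun ω => linForm w s d ω + d k * w k ω := by
      funext ω
      simp [linForm, Finset.sum_insert hk, add_comm]
    have hsum : 0 ≤ ∑ j ∈ s, d j ^ 2 := Finset.sum_nonneg fun j _ => sq_nonneg _
    have horth : ∫ ω, linForm w s d ω ^ 3 * (d k * w k ω) ∂P = 0 := by
      have := h.integral_mul_of_notMem hk (f := fun x => (∑ j : s, d j * x j) ^ 3)
        (by fun_prop) (g := fun y => d k * y) (by fun_prop)
      rw [linForm_eq_comp]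
      refine this.trans ?_
      rw [integral_const_mul, h.mean, mul_zero, mul_zero]
    have hD : ∫ ω, (d k * w k ω) ^ 4 ∂P ≤ (c * d k ^ 2) ^ 2 := by
      simp only [mul_pow]
      rw [integral_const_mul, h.fourth]
      have := h.fourth_le k
      have h4 : 0 ≤ d k ^ 4 := by positivity
      nlinarith
    have := integral_add_pow_four_le (h.memLp_linForm s d) ((h.memLp_four k).const_mul (d k)) horth
      (by positivity) (by positivity) ih hD
    rw [heq]
    refine this.trans (le_of_eq ?_)
    rw [Finset.sum_insert hk]
    ring

/-- The factors are independent, so fourth moments of each suffice for a fourth moment of the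
product. -/
lemma memLp_linForm_mul {s : Finset ι} {k : ι} (hk : k ∉ s) (d : ι → ℝ) :
    MemLp (fun ω => w k ω * linForm w s d ω) 4 P := by
  have hm : Measurable fun ω => w k ω * linForm w s d ω := (h.meas k).mul (h.measurable_linForm s d)
  rw [memLp_four_iff hm.aestronglyMeasurable]
  have h1 := (h.memLp_linForm s d).integrable_pow_four
  rw [linForm_eq_comp] at h1 ⊢
  have := h.integrable_mul_of_notMem hk (f := fun x => (∑ j : s, d j * x j) ^ 4) (by fun_prop)
    (g := fun y => y ^ 4) (by fun_prop) h1 (h.memLp_four k).integrable_pow_four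
  refine this.congr (ae_of_all _ fun ω => ?_)
  simp only [Function.comp]
  ring

lemma integral_linForm_mul_pow_four {s : Finset ι} {k : ι} (hk : k ∉ s) (d : ι → ℝ) :
    ∫ ω, (w k ω * linForm w s d ω) ^ 4 ∂P = (∫ ω, linForm w s d ω ^ 4 ∂P) * τ k := by
  rw [linForm_eq_comp]
  have := h.integral_mul_of_notMem hk (f := fun x => (∑ j : s, d j * x j) ^ 4) (by fun_prop)
    (g := fun y => y ^ 4) (by fun_prop)
  rw [h.fourth] at this
  refine Eq.trans (integral_congr_ae (ae_of_all _ fun ω => ?_)) this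
  simp only [Function.comp]
  ring

lemma memLp_quadIncr {s : Finset ι} {k : ι} (hk : k ∉ s) (C : Matrix ι ι ℝ) :
    MemLp (quadIncr w σ s C k) 4 P := by
  have h1 := (((h.memLp_sq k).sub (memLp_const (σ k))).const_mul (C k k)).add
    ((h.memLp_linForm_mul hk (C k)).const_mul 2)
  refine h1.congr_norm (h1.1.congr (ae_of_all _ fun ω => ?_)) (ae_of_all _ fun ω => ?_)
  · simp [quadIncr, mul_assoc]
  · simp [quadIncr, mul_assoc]

lemma memLp_quadForm (s : Finset ι) {C : Matrix ι ι ℝ} (hC : C.IsSymm) :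
    MemLp (quadForm w σ s C) 4 P := by
  induction s using Finset.induction_on with
  | empty =>
    have : quadForm w σ ∅ C = fun _ => 0 := by
      funext ω
      simp [quadForm]
    rw [this]
    exact memLp_const 0
  | insert k s hk ih =>
    have : quadForm w σ (insert k s) C = quadForm w σ s C + quadIncr w σ s C k :=
      funext fun ω => quadForm_insert hC hk ω
    rw [this]
    exact ih.add (h.memLp_quadIncr hk C)

lemma integral_quadIncr_pow_four_le {s : Finset ι} {k : ι} (hk : k ∉ s) (C : Matrix ι ι ℝ) :
    ∫ ω, quadIncr w σ s C k ω ^ 4 ∂P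
      ≤ ((3 * c + 64 * c ^ 2) * ∑ j ∈ insert k s, C k j ^ 2) ^ 2 := by
  have hc := h.nonneg
  have i1 : Integrable (fun ω => (w k ω ^ 2 - σ k) ^ 4) P :=
    ((h.memLp_sq k).sub (memLp_const (σ k))).integrable_pow_four
  have i2 : Integrable (fun ω => (w k ω * linForm w s (C k) ω) ^ 4) P :=
    (h.memLp_linForm_mul hk (C k)).integrable_pow_four
  have h1 : ∫ ω, quadIncr w σ s C k ω ^ 4 ∂P ≤
      ∫ ω, (8 * C k k ^ 4 * (w k ω ^ 2 - σ k) ^ 4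
        + 128 * (w k ω * linForm w s (C k) ω) ^ 4) ∂P := by
    refine integral_mono (h.memLp_quadIncr hk C).integrable_pow_four
      ((i1.const_mul _).add (i2.const_mul _)) fun ω => ?_
    simp only [quadIncr]
    have hxy : ∀ x y : ℝ, (x + y) ^ 4 ≤ 8 * (x ^ 4 + y ^ 4) := by
      intro x y
      nlinarith [sq_nonneg (x - y), sq_nonneg (x + y), sq_nonneg (x ^ 2 - y ^ 2),
        mul_nonneg (sq_nonneg (x - y)) (sq_nonneg (x + y)), sq_nonneg (x * y),
        mul_nonneg (sq_nonneg (x - y)) (sq_nonneg x), mul_nonneg (sq_nonneg (x - y)) (sq_nonneg y)]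
    refine (hxy _ _).trans (le_of_eq ?_)
    ring
  rw [integral_add (i1.const_mul _) (i2.const_mul _), integral_const_mul, integral_const_mul,
    h.integral_linForm_mul_pow_four hk] at h1
  have h2 := h.integral_linForm_pow_four_le s (C k)
  have h3 := h.fourth_le k
  have h4 := h.sq_fourth_le k
  have hb : 0 ≤ ∑ j ∈ s, C k j ^ 2 := Finset.sum_nonneg fun j _ => sq_nonneg _
  rw [Finset.sum_insert hk]
  set b := ∑ j ∈ s, C k j ^ 2
  have hτ : 0 ≤ τ k := by
    rw [← h.fourth]
    exact integral_nonneg fun ω => by positivity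
  have h5 : (∫ ω, linForm w s (C k) ω ^ 4 ∂P) * τ k ≤ (4 * c * b) ^ 2 * c ^ 2 :=
    mul_le_mul h2 h3 hτ (by positivity)
  have h6 : 8 * C k k ^ 4 * ∫ ω, (w k ω ^ 2 - σ k) ^ 4 ∂P ≤ 8 * C k k ^ 4 * c ^ 2 := by
    gcongr
  refine h1.trans ((add_le_add h6 (mul_le_mul_of_nonneg_left h5 (by norm_num))).trans ?_)
  -- The constants suffice because `3² ≥ 8` covers the diagonal part and `64² ≥ 2048 = 128 · 4²`
  -- covers the product part.
  have e : ((3 * c + 64 * c ^ 2) * (C k k ^ 2 + b)) ^ 2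
      - (8 * C k k ^ 4 * c ^ 2 + 128 * ((4 * c * b) ^ 2 * c ^ 2))
      = C k k ^ 4 * c ^ 2 + 2048 * (c ^ 2 * b) ^ 2 + 9 * c ^ 2 * b ^ 2 + 18 * c ^ 2 * C k k ^ 2 * b
        + (384 * c ^ 3 + 4096 * c ^ 4) * (C k k ^ 4 + 2 * C k k ^ 2 * b)
        + 384 * c ^ 3 * b ^ 2 := by ring
  have : 0 ≤ C k k ^ 4 * c ^ 2 + 2048 * (c ^ 2 * b) ^ 2 + 9 * c ^ 2 * b ^ 2
        + 18 * c ^ 2 * C k k ^ 2 * b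
        + (384 * c ^ 3 + 4096 * c ^ 4) * (C k k ^ 4 + 2 * C k k ^ 2 * b)
        + 384 * c ^ 3 * b ^ 2 := by positivity
  linarith

/-- An integral of `f (w_j, j ∈ s)` against an increment of a quadratic form vanishes. -/
lemma integral_mul_quadIncr {s : Finset ι} {k : ι} (hk : k ∉ s) (C : Matrix ι ι ℝ)
    {f : (s → ℝ) → ℝ} (hf : Measurable f) (hif : Integrable (fun ω => f (fun j => w j ω)) P)
    (hif' : Integrable (fun ω => f (fun j => w j ω) * linForm w s (C k) ω) P) :
    ∫ ω, f (fun j => w j ω) * quadIncr w σ s C k ω ∂P = 0 := by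
  have g1 : Measurable fun y : ℝ => C k k * (y ^ 2 - σ k) := by fun_prop
  have g2 : Measurable fun y : ℝ => 2 * y := by fun_prop
  have f2 : Measurable fun x : s → ℝ => f x * ∑ j : s, C k j * x j := by fun_prop
  have e : ∀ ω, f (fun j => w j ω) * quadIncr w σ s C k ω
      = f (fun j => w j ω) * (C k k * (w k ω ^ 2 - σ k))
        + (f (fun j => w j ω) * ∑ j : s, C k j * w j ω) * (2 * w k ω) := by
    intro ω
    simp only [quadIncr, linForm_eq_comp, Function.comp]
    ring
  rw [linForm_eq_comp] at hif'
  simp only [e]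
  rw [integral_add
    (h.integrable_mul_of_notMem hk hf g1 hif
      (((h.integrable_sq k).sub (integrable_const _)).const_mul _))
    (h.integrable_mul_of_notMem hk f2 g2 hif' ((h.integrable k).const_mul 2)),
    h.integral_mul_of_notMem hk hf g1, h.integral_mul_of_notMem hk f2 g2, integral_const_mul,
    integral_sub (h.integrable_sq k) (integrable_const _), h.var, integral_const_mul, h.mean]
  simp

lemma integral_quadForm (s : Finset ι) {C : Matrix ι ι ℝ} (hC : C.IsSymm) :
    ∫ ω, quadForm w σ s C ω ∂P = 0 := by
  induction s using Finset.induction_on with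
  | empty => simp [quadForm]
  | insert k s hk ih =>
    simp only [quadForm_insert hC hk]
    rw [integral_add ((h.memLp_quadForm s hC).integrable (by norm_num))
      ((h.memLp_quadIncr hk C).integrable (by norm_num)), ih, zero_add]
    have := h.integral_mul_quadIncr hk C (f := fun _ => 1) measurable_const (integrable_const _)
      (by simpa using (h.memLp_linForm s (C k)).integrable (by norm_num))
    simpa using this

/-- The fourth moment of a centred quadratic form is bounded by the fourth power of the Frobenius
norm of its matrix. -/
lemma integral_quadForm_pow_four_le (s : Finset ι) {C : Matrix ι ι ℝ} (hC : C.IsSymm) :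
    ∫ ω, quadForm w σ s C ω ^ 4 ∂P
      ≤ (4 * (3 * c + 64 * c ^ 2) * ∑ i ∈ s, ∑ j ∈ s, C i j ^ 2) ^ 2 := by
  have hc := h.nonneg
  induction s using Finset.induction_on with
  | empty => simp [quadForm]
  | insert k s hk ih =>
    simp only [quadForm_insert hC hk]
    have hmq := h.memLp_quadForm s hC
    have horth : ∫ ω, quadForm w σ s C ω ^ 3 * quadIncr w σ s C k ω ∂P = 0 := by
      have hf : Measurable fun x : s → ℝ =>
          (∑ i : s, ∑ j : s, C i j * x i * x j - ∑ i ∈ s, C i i * σ i) ^ 3 := by fun_prop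
      have hi : Integrable (fun ω => quadForm w σ s C ω ^ 3) P := by
        simpa using integrable_pow_mul_pow hmq (memLp_const (1 : ℝ)) (i := 3) (j := 1) rfl
      have hi' : Integrable (fun ω => quadForm w σ s C ω ^ 3 * linForm w s (C k) ω) P := by
        simpa using integrable_pow_mul_pow hmq (h.memLp_linForm s (C k)) (i := 3) (j := 1) rfl
      have := h.integral_mul_quadIncr hk C hf
      rw [quadForm_eq_comp] at hi hi' ⊢
      exact this hi hi'
    have := integral_add_pow_four_le hmq (h.memLp_quadIncr hk C) horth
      (mul_nonneg (by positivity) (Finset.sum_nonneg fun i _ => Finset.sum_nonneg fun j _ =>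
        sq_nonneg _)) (mul_nonneg (by positivity) (Finset.sum_nonneg fun i _ => sq_nonneg _)) ih
      (h.integral_quadIncr_pow_four_le hk C)
    refine this.trans (pow_le_pow_left₀ ?_ ?_ 2)
    · refine add_nonneg (mul_nonneg (by positivity) (Finset.sum_nonneg fun i _ =>
        Finset.sum_nonneg fun j _ => sq_nonneg _)) (mul_nonneg (by norm_num)
        (mul_nonneg (by positivity) (Finset.sum_nonneg fun i _ => sq_nonneg _)))
    -- The new increment is charged only to the row of `k`; the column of `k` in the larger sum is
    -- not needed and is discarded.
    · have e1 : ∑ i ∈ s, ∑ j ∈ s, C i j ^ 2 ≤ ∑ i ∈ s, ∑ j ∈ insert k s, C i j ^ 2 :=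
        Finset.sum_le_sum fun i _ => Finset.sum_le_sum_of_subset_of_nonneg
          (Finset.subset_insert _ _) fun _ _ _ => sq_nonneg _
      rw [Finset.sum_insert (s := s) (f := fun i => ∑ j ∈ insert k s, C i j ^ 2) hk]
      have : 0 ≤ 4 * (3 * c + 64 * c ^ 2) := by positivity
      nlinarith

lemma integral_linForm_mul_linForm (s : Finset ι) (d e : ι → ℝ) :
    ∫ ω, linForm w s d ω * linForm w s e ω ∂P = ∑ j ∈ s, d j * e j * σ j := by
  have i2 : ∀ f g : Ω → ℝ, MemLp f 4 P → MemLp g 4 P → Integrable (fun ω => f ω * g ω) P :=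
    fun f g hf hg => (hf.mono_exponent (p := 2) (by norm_num)).integrable_mul
      (hg.mono_exponent (p := 2) (by norm_num))
  induction s using Finset.induction_on with
  | empty => simp [linForm]
  | insert k s hk ih =>
    have hcross : ∀ d : ι → ℝ, ∫ ω, linForm w s d ω * w k ω ∂P = 0 := by
      intro d
      rw [linForm_eq_comp]
      refine (h.integral_mul_of_notMem hk (f := fun x => ∑ j : s, d j * x j) (by fun_prop)
        (g := fun y => y) measurable_id).trans ?_
      rw [h.mean, mul_zero]
    have e0 : ∀ ω, linForm w (insert k s) d ω * linForm w (insert k s) e ω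
        = linForm w s d ω * linForm w s e ω + (e k * (linForm w s d ω * w k ω)
          + (d k * (linForm w s e ω * w k ω) + d k * e k * w k ω ^ 2)) := by
      intro ω
      simp only [linForm, Finset.sum_insert hk]
      ring
    have hd := h.memLp_linForm s d
    have he := h.memLp_linForm s e
    have hw := h.memLp_four k
    simp only [e0]
    rw [integral_add_four (i2 _ _ hd he) ((i2 _ _ hd hw).const_mul _) ((i2 _ _ he hw).const_mul _)
      ((h.integrable_sq k).const_mul _), ih,
      integral_const_mul, integral_const_mul, integral_const_mul, hcross, hcross, h.var,
      Finset.sum_insert hk]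
    ring

/-- Third moments of `w k` occur only multiplied by a linear form in the other variables, which has
mean zero. Skewness therefore drops out. -/
lemma integral_quadIncr_mul_quadIncr {s : Finset ι} {k : ι} (hk : k ∉ s) (C D : Matrix ι ι ℝ) :
    ∫ ω, quadIncr w σ s C k ω * quadIncr w σ s D k ω ∂P
      = C k k * D k k * (τ k - σ k ^ 2) + 4 * σ k * ∑ j ∈ s, C k j * D k j * σ j := by
  have i2 : ∀ f g : Ω → ℝ, MemLp f 4 P → MemLp g 4 P → Integrable (fun ω => f ω * g ω) P :=
    fun f g hf hg => (hf.mono_exponent (p := 2) (by norm_num)).integrable_mul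
      (hg.mono_exponent (p := 2) (by norm_num))
  have hv : MemLp (fun ω => w k ω ^ 2 - σ k) 4 P := (h.memLp_sq k).sub (memLp_const (σ k))
  have hw := h.memLp_four k
  have iv : ∀ d, Integrable (fun ω => linForm w s d ω * ((w k ω ^ 2 - σ k) * w k ω)) P := by
    intro d
    have h1 := (h.memLp_linForm s d).integrable (by norm_num)
    rw [linForm_eq_comp] at h1 ⊢
    exact h.integrable_mul_of_notMem hk (f := fun x => ∑ j : s, d j * x j) (by fun_prop)
      (g := fun y => (y ^ 2 - σ k) * y) (by fun_prop) h1 (i2 _ _ hv hw)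
  have zv : ∀ d, ∫ ω, linForm w s d ω * ((w k ω ^ 2 - σ k) * w k ω) ∂P = 0 := by
    intro d
    have h0 := h.integral_linForm s d
    rw [linForm_eq_comp] at h0 ⊢
    refine (h.integral_mul_of_notMem hk (f := fun x => ∑ j : s, d j * x j) (by fun_prop)
      (g := fun y => (y ^ 2 - σ k) * y) (by fun_prop)).trans ?_
    exact mul_eq_zero_of_left h0 _
  have ill := i2 _ _ (h.memLp_linForm s (C k)) (h.memLp_linForm s (D k))
  have il : Integrable (fun ω => (linForm w s (C k) ω * linForm w s (D k) ω) * w k ω ^ 2) P := by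
    rw [linForm_eq_comp, linForm_eq_comp] at ill ⊢
    exact h.integrable_mul_of_notMem hk
      (f := fun x => (∑ j : s, C k j * x j) * ∑ j : s, D k j * x j) (by fun_prop)
      (g := fun y => y ^ 2) (by fun_prop) ill (h.integrable_sq k)
  have zl : ∫ ω, (linForm w s (C k) ω * linForm w s (D k) ω) * w k ω ^ 2 ∂P
      = (∑ j ∈ s, C k j * D k j * σ j) * σ k := by
    rw [← h.integral_linForm_mul_linForm, ← h.var k, linForm_eq_comp, linForm_eq_comp]
    exact h.integral_mul_of_notMem hk
      (f := fun x => (∑ j : s, C k j * x j) * ∑ j : s, D k j * x j) (by fun_prop)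
      (g := fun y => y ^ 2) (by fun_prop)
  have ivv : Integrable (fun ω => (w k ω ^ 2 - σ k) * (w k ω ^ 2 - σ k)) P := i2 _ _ hv hv
  have zvv : ∫ ω, (w k ω ^ 2 - σ k) * (w k ω ^ 2 - σ k) ∂P = τ k - σ k ^ 2 := by
    have e : ∀ ω, (w k ω ^ 2 - σ k) * (w k ω ^ 2 - σ k)
        = w k ω ^ 4 + (-2 * σ k * w k ω ^ 2 + (σ k ^ 2 + 0)) := fun ω => by ring
    simp only [e]
    rw [integral_add_four hw.integrable_pow_four ((h.integrable_sq k).const_mul _)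
      (integrable_const _) (integrable_const _), integral_const_mul, h.var, h.fourth]
    simp
    ring
  have e : ∀ ω, quadIncr w σ s C k ω * quadIncr w σ s D k ω
      = C k k * D k k * ((w k ω ^ 2 - σ k) * (w k ω ^ 2 - σ k))
        + (2 * C k k * (linForm w s (D k) ω * ((w k ω ^ 2 - σ k) * w k ω))
        + (2 * D k k * (linForm w s (C k) ω * ((w k ω ^ 2 - σ k) * w k ω))
        + 4 * ((linForm w s (C k) ω * linForm w s (D k) ω) * w k ω ^ 2))) := by
    intro ω
    simp only [quadIncr]
    ring
  simp only [e]
  rw [integral_add_four (ivv.const_mul _) ((iv _).const_mul _) ((iv _).const_mul _)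
      (il.const_mul _),
    integral_const_mul, integral_const_mul, integral_const_mul, integral_const_mul, zv, zv, zl,
    zvv]
  ring

/-- The covariance of two quadratic forms. -/
lemma integral_quadForm_mul_quadForm (s : Finset ι) {C D : Matrix ι ι ℝ} (hC : C.IsSymm)
    (hD : D.IsSymm) :
    ∫ ω, quadForm w σ s C ω * quadForm w σ s D ω ∂P
      = 2 * ∑ i ∈ s, ∑ j ∈ s, C i j * D i j * σ i * σ j
        + ∑ i ∈ s, C i i * D i i * (τ i - 3 * σ i ^ 2) := by
  have i2 : ∀ f g : Ω → ℝ, MemLp f 4 P → MemLp g 4 P → Integrable (fun ω => f ω * g ω) P :=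
    fun f g hf hg => (hf.mono_exponent (p := 2) (by norm_num)).integrable_mul
      (hg.mono_exponent (p := 2) (by norm_num))
  induction s using Finset.induction_on with
  | empty => simp [quadForm]
  | insert k s hk ih =>
    -- An increment is orthogonal to every form in the earlier variables, so the covariance is the
    -- sum over `k` of the covariances of simultaneous increments.
    have hcross : ∀ {C : Matrix ι ι ℝ}, C.IsSymm → ∀ D : Matrix ι ι ℝ,
        ∫ ω, quadForm w σ s C ω * quadIncr w σ s D k ω ∂P = 0 := by
      intro C hC D
      have hq := h.memLp_quadForm s hC
      have hf : Measurable fun x : s → ℝ =>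
          ∑ i : s, ∑ j : s, C i j * x i * x j - ∑ i ∈ s, C i i * σ i := by fun_prop
      have hi' := i2 _ _ hq (h.memLp_linForm s (D k))
      have hi := hq.integrable (by norm_num)
      have := h.integral_mul_quadIncr hk D hf
      rw [quadForm_eq_comp] at hi hi' ⊢
      exact this hi hi'
    have e : ∀ ω, quadForm w σ (insert k s) C ω * quadForm w σ (insert k s) D ω
        = quadForm w σ s C ω * quadForm w σ s D ω
          + (quadForm w σ s C ω * quadIncr w σ s D k ω
          + (quadForm w σ s D ω * quadIncr w σ s C k ω
          + quadIncr w σ s C k ω * quadIncr w σ s D k ω)) := by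
      intro ω
      rw [quadForm_insert hC hk, quadForm_insert hD hk]
      ring
    have qC := h.memLp_quadForm s hC
    have qD := h.memLp_quadForm s hD
    have rC := h.memLp_quadIncr hk C
    have rD := h.memLp_quadIncr hk D
    simp only [e]
    rw [integral_add_four (i2 _ _ qC qD) (i2 _ _ qC rD) (i2 _ _ qD rC) (i2 _ _ rC rD), ih,
      hcross hC, hcross hD,
      h.integral_quadIncr_mul_quadIncr hk]
    simp only [Finset.sum_insert hk, Finset.sum_add_distrib]
    have hs : ∑ x ∈ s, C x k * D x k * σ x * σ k = ∑ x ∈ s, C k x * D k x * σ k * σ x :=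
      Finset.sum_congr rfl fun x _ => by rw [hC.apply k x, hD.apply k x]; ring
    have hs2 : ∑ x ∈ s, C k x * D k x * σ x = ∑ x ∈ s, C k x * D k x * σ x := rfl
    have hs3 : ∑ x ∈ s, C k x * D k x * σ k * σ x = σ k * ∑ x ∈ s, C k x * D k x * σ x := by
      rw [Finset.mul_sum]
      exact Finset.sum_congr rfl fun x _ => by ring
    rw [hs, hs3]
    ring

end CentredFamily

end QuadraticForms

end NER

namespace NER

open scoped Matrix.Norms.L2Operator

/-! ### Frobenius and spectral norms. -/

section Frobenius

variable {ι κ μ : Type*} [Fintype ι] [Fintype κ] [Fintype μ] [DecidableEq ι] [DecidableEq κ]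
  [DecidableEq μ]

/-- The Frobenius norm. -/
noncomputable def frob (A : Matrix ι κ ℝ) : ℝ := √(∑ i, ∑ j, A i j ^ 2)

lemma frob_nonneg (A : Matrix ι κ ℝ) : 0 ≤ frob A := Real.sqrt_nonneg _

lemma sum_sq_nonneg (A : Matrix ι κ ℝ) : 0 ≤ ∑ i, ∑ j, A i j ^ 2 :=
  Finset.sum_nonneg fun _ _ => Finset.sum_nonneg fun _ _ => sq_nonneg _

lemma frob_sq (A : Matrix ι κ ℝ) : frob A ^ 2 = ∑ i, ∑ j, A i j ^ 2 :=
  Real.sq_sqrt (sum_sq_nonneg A)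

lemma frob_eq_norm (A : Matrix ι κ ℝ) :
    frob A = ‖(WithLp.toLp 2 fun p : ι × κ => A p.1 p.2 : EuclideanSpace ℝ (ι × κ))‖ := by
  rw [EuclideanSpace.norm_eq, frob, Fintype.sum_prod_type]
  simp

lemma frob_add_le (A B : Matrix ι κ ℝ) : frob (A + B) ≤ frob A + frob B := by
  rw [frob_eq_norm, frob_eq_norm, frob_eq_norm]
  exact norm_add_le (WithLp.toLp 2 fun p : ι × κ => A p.1 p.2 : EuclideanSpace ℝ (ι × κ))
    (WithLp.toLp 2 fun p : ι × κ => B p.1 p.2 : EuclideanSpace ℝ (ι × κ))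

lemma frob_neg (A : Matrix ι κ ℝ) : frob (-A) = frob A := by
  simp [frob]

lemma frob_transpose (A : Matrix ι κ ℝ) : frob Aᵀ = frob A := by
  rw [frob, frob, Finset.sum_comm]
  rfl

lemma frob_le_of_sq_le {A : Matrix ι κ ℝ} {c : ℝ} (hc : 0 ≤ c)
    (h : ∑ i, ∑ j, A i j ^ 2 ≤ c ^ 2) : frob A ≤ c := by
  rw [frob]
  exact Real.sqrt_le_iff.2 ⟨hc, h⟩

lemma sum_mul_le_frob (A B : Matrix ι κ ℝ) : |∑ i, ∑ j, A i j * B i j| ≤ frob A * frob B := by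
  have h := abs_real_inner_le_norm
    (WithLp.toLp 2 fun p : ι × κ => A p.1 p.2 : EuclideanSpace ℝ (ι × κ))
    (WithLp.toLp 2 fun p : ι × κ => B p.1 p.2 : EuclideanSpace ℝ (ι × κ))
  rw [← frob_eq_norm, ← frob_eq_norm] at h
  refine le_trans (le_of_eq ?_) h
  simp only [PiLp.inner_apply, Fintype.sum_prod_type]
  simp [mul_comm]

lemma abs_trace_mul_le (A : Matrix ι κ ℝ) (B : Matrix κ ι ℝ) :
    |(A * B).trace| ≤ frob A * frob B := by
  rw [← frob_transpose B]
  refine le_trans (le_of_eq ?_) (sum_mul_le_frob A Bᵀ)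
  simp [Matrix.trace, Matrix.mul_apply]

lemma sum_diag_mul_diag_le (A B : Matrix ι ι ℝ) : |∑ i, A i i * B i i| ≤ frob A * frob B := by
  have hd : ∀ A : Matrix ι ι ℝ, frob (Matrix.diagonal fun i => A i i) ≤ frob A := by
    intro A
    refine Real.sqrt_le_sqrt (Finset.sum_le_sum fun i _ => ?_)
    rw [Finset.sum_eq_single i (fun j _ hj => by simp [Matrix.diagonal_apply_ne' _ hj]) (by simp)]
    simp only [Matrix.diagonal_apply_eq]
    exact Finset.single_le_sum (f := fun j => A i j ^ 2) (fun _ _ => sq_nonneg _)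
      (Finset.mem_univ i)
  have h := sum_mul_le_frob (Matrix.diagonal fun i => A i i) (Matrix.diagonal fun i => B i i)
  have e : ∑ i, ∑ j, (Matrix.diagonal fun i => A i i) i j * (Matrix.diagonal fun i => B i i) i j
      = ∑ i, A i i * B i i := by
    refine Finset.sum_congr rfl fun i _ => ?_
    rw [Finset.sum_eq_single i (fun j _ hj => by simp [Matrix.diagonal_apply_ne' _ hj]) (by simp)]
    simp
  rw [e] at h
  exact h.trans (mul_le_mul (hd A) (hd B) (frob_nonneg _) (frob_nonneg _))

lemma sum_mulVec_sq_le (A : Matrix ι κ ℝ) (x : κ → ℝ) :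
    ∑ i, (A *ᵥ x) i ^ 2 ≤ ‖A‖ ^ 2 * ∑ j, x j ^ 2 := by
  have h := Matrix.l2_opNorm_mulVec A (WithLp.toLp 2 x)
  have h2 := pow_le_pow_left₀ (norm_nonneg _) h 2
  rw [mul_pow, EuclideanSpace.norm_sq_eq, EuclideanSpace.norm_sq_eq] at h2
  simpa using h2

lemma l2_opNorm_le {A : Matrix ι κ ℝ} {c : ℝ} (hc : 0 ≤ c)
    (h : ∀ x : κ → ℝ, ∑ i, (A *ᵥ x) i ^ 2 ≤ c ^ 2 * ∑ j, x j ^ 2) : ‖A‖ ≤ c := by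
  rw [Matrix.l2_opNorm_def]
  refine ContinuousLinearMap.opNorm_le_bound _ hc fun x => ?_
  refine abs_le_of_sq_le_sq' ?_ (by positivity) |>.2
  rw [mul_pow, EuclideanSpace.norm_sq_eq, EuclideanSpace.norm_sq_eq]
  simpa using h x

lemma norm_transpose (A : Matrix ι κ ℝ) : ‖Aᵀ‖ = ‖A‖ := by
  have := Matrix.l2_opNorm_conjTranspose A
  rwa [Matrix.conjTranspose_eq_transpose_of_trivial] at this

lemma norm_le_frob (A : Matrix ι κ ℝ) : ‖A‖ ≤ frob A := by
  refine l2_opNorm_le (frob_nonneg A) fun x => ?_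
  rw [frob_sq, Finset.sum_mul]
  refine Finset.sum_le_sum fun i _ => ?_
  exact Finset.sum_mul_sq_le_sq_mul_sq _ _ _

/-- The spectral norm bound is applied to each column of `B` separately. -/
lemma frob_mul_le (A : Matrix ι κ ℝ) (B : Matrix κ μ ℝ) : frob (A * B) ≤ ‖A‖ * frob B := by
  refine frob_le_of_sq_le (mul_nonneg (norm_nonneg _) (frob_nonneg _)) ?_
  rw [mul_pow, frob_sq, Finset.sum_comm, Finset.sum_comm (f := fun i j => B i j ^ 2),
    Finset.mul_sum]
  exact Finset.sum_le_sum fun j _ => sum_mulVec_sq_le A fun k => B k j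

lemma frob_mul_le' (A : Matrix ι κ ℝ) (B : Matrix κ μ ℝ) : frob (A * B) ≤ frob A * ‖B‖ := by
  rw [← frob_transpose, Matrix.transpose_mul, mul_comm, ← norm_transpose B, ← frob_transpose A]
  exact frob_mul_le _ _

lemma frob_one : frob (1 : Matrix ι ι ℝ) = √(Fintype.card ι) := by
  rw [frob]
  congr 1
  simp [Matrix.one_apply]

/-- The scale behind the rates: bounded spectral norm allows a Frobenius norm of order `√N`, whereas
the corrections due to `Q` stay bounded in Frobenius norm. -/
lemma frob_le_sqrt_card_mul (A : Matrix ι ι ℝ) : frob A ≤ √(Fintype.card ι) * ‖A‖ := by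
  have := frob_mul_le A (1 : Matrix ι ι ℝ)
  rwa [Matrix.mul_one, frob_one, mul_comm] at this

lemma dotProduct_mulVec_le (A : Matrix ι ι ℝ) (x : ι → ℝ) :
    |x ⬝ᵥ A *ᵥ x| ≤ ‖A‖ * (x ⬝ᵥ x) := by
  have h1 : (x ⬝ᵥ A *ᵥ x) ^ 2 ≤ (∑ i, x i ^ 2) * ∑ i, (A *ᵥ x) i ^ 2 :=
    Finset.sum_mul_sq_le_sq_mul_sq _ _ _
  have e : x ⬝ᵥ x = ∑ i, x i ^ 2 := Finset.sum_congr rfl fun i _ => (sq (x i)).symm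
  have h0 : 0 ≤ ∑ i, x i ^ 2 := Finset.sum_nonneg fun _ _ => sq_nonneg _
  rw [e]
  refine abs_le_of_sq_le_sq ?_ (mul_nonneg (norm_nonneg _) h0)
  have h2 := mul_le_mul_of_nonneg_left (sum_mulVec_sq_le A x) h0
  nlinarith

/-- The spectral norm of a symmetric matrix is controlled by its quadratic form. -/
lemma l2_opNorm_le_of_isSymm {A : Matrix ι ι ℝ} (hA : A.IsSymm) {c : ℝ} (hc : 0 ≤ c)
    (h : ∀ x : ι → ℝ, |x ⬝ᵥ A *ᵥ x| ≤ c * (x ⬝ᵥ x)) : ‖A‖ ≤ c := by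
  have hsymm : ∀ x y : ι → ℝ, x ⬝ᵥ A *ᵥ y = y ⬝ᵥ A *ᵥ x := by
    intro x y
    rw [Matrix.dotProduct_mulVec, ← Matrix.mulVec_transpose, hA.eq, dotProduct_comm]
  have hsq : ∀ x : ι → ℝ, x ⬝ᵥ x = ∑ i, x i ^ 2 := fun x =>
    Finset.sum_congr rfl fun i _ => (sq (x i)).symm
  -- Polarization and the parallelogram law: the upper bound at `x + y` is combined with the lower
  -- bound at `x - y`.
  have hbil : ∀ x y : ι → ℝ, 2 * (x ⬝ᵥ A *ᵥ y) ≤ c * (x ⬝ᵥ x + y ⬝ᵥ y) := by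
    intro x y
    have h1 := (abs_le.1 (h (x + y))).2
    have h2 := (abs_le.1 (h (x - y))).1
    simp only [Matrix.mulVec_add, Matrix.mulVec_sub, dotProduct_add, dotProduct_sub,
      add_dotProduct, sub_dotProduct, hsymm y x, dotProduct_comm y x] at h1 h2
    linarith
  refine l2_opNorm_le hc fun x => ?_
  set y := A *ᵥ x with hy
  rw [← hsq, ← hsq]
  have h0 : 0 ≤ x ⬝ᵥ x := by rw [hsq]; exact Finset.sum_nonneg fun _ _ => sq_nonneg _
  have h0' : 0 ≤ y ⬝ᵥ y := by rw [hsq]; exact Finset.sum_nonneg fun _ _ => sq_nonneg _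
  -- The bilinear bound is tested on `s • A x` against `x`. For `c > 0` the choice `s = c⁻¹` gives
  -- the sharp constant; `c = 0` is treated separately.
  have key : ∀ s : ℝ, 2 * s * (y ⬝ᵥ y) ≤ c * (s ^ 2 * (y ⬝ᵥ y) + x ⬝ᵥ x) := by
    intro s
    have := hbil (s • y) x
    rw [← hy] at this
    simp only [smul_dotProduct, dotProduct_smul, smul_eq_mul] at this
    nlinarith
  rcases hc.eq_or_lt with rfl | hc'
  · have := key 1
    nlinarith
  · have := key c⁻¹
    have e : c * (c⁻¹ ^ 2 * (y ⬝ᵥ y) + x ⬝ᵥ x) = c⁻¹ * (y ⬝ᵥ y) + c * (x ⬝ᵥ x) := by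
      field_simp
    rw [e] at this
    have h3 : c⁻¹ * (y ⬝ᵥ y) ≤ c * (x ⬝ᵥ x) := by linarith
    calc y ⬝ᵥ y = c * (c⁻¹ * (y ⬝ᵥ y)) := by field_simp
      _ ≤ c * (c * (x ⬝ᵥ x)) := by gcongr
      _ = c ^ 2 * (x ⬝ᵥ x) := by ring

end Frobenius

end NER

namespace NER

open scoped Matrix.Norms.L2Operator

/-! ### The nested error model as a linear image of independent effects. -/

section Model

variable {m : ℕ} {n : Fin m → ℕ}

lemma Z_transpose_mulVec (x : Obs n → ℝ) (i : Fin m) : ((Z n)ᵀ *ᵥ x) i = ∑ j, x ⟨i, j⟩ := by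
  simp only [Matrix.mulVec, dotProduct, Matrix.transpose_apply, Z, Matrix.of_apply]
  rw [Fintype.sum_sigma, Finset.sum_eq_single i]
  · simp
  · intro b _ hb
    simp [hb]
  · simp

/-- Cauchy–Schwarz within each cluster. This is how bounded cluster sizes give a bound on `Z` that
does not depend on the number of clusters. -/
lemma sum_Z_transpose_mulVec_sq_le {nmax : ℕ} (hn : ∀ i, n i ≤ nmax) (x : Obs n → ℝ) :
    ∑ i, ((Z n)ᵀ *ᵥ x) i ^ 2 ≤ nmax * ∑ k, x k ^ 2 := by
  rw [Fintype.sum_sigma, Finset.mul_sum]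
  refine Finset.sum_le_sum fun i _ => ?_
  rw [Z_transpose_mulVec]
  have h1 := sq_sum_le_card_mul_sum_sq (s := Finset.univ) (f := fun j => x ⟨i, j⟩)
  rw [Finset.card_univ, Fintype.card_fin] at h1
  have h2 : 0 ≤ ∑ j, x ⟨i, j⟩ ^ 2 := Finset.sum_nonneg fun _ _ => sq_nonneg _
  have h3 : (n i : ℝ) ≤ nmax := by exact_mod_cast hn i
  exact h1.trans (mul_le_mul_of_nonneg_right h3 h2)

lemma norm_Z_le {nmax : ℕ} (hn : ∀ i, n i ≤ nmax) : ‖Z n‖ ≤ √nmax := by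
  rw [← norm_transpose]
  refine l2_opNorm_le (Real.sqrt_nonneg _) fun x => ?_
  rw [Real.sq_sqrt (Nat.cast_nonneg _)]
  exact sum_Z_transpose_mulVec_sq_le hn x

lemma G_eq : G n = Z n * (Z n)ᵀ := by
  ext ⟨i, j⟩ ⟨i', j'⟩
  simp only [G, Matrix.mul_apply, Z, Matrix.of_apply, Matrix.transpose_apply]
  by_cases h : i = i'
  · subst h
    simp [Matrix.blockDiagonal'_apply_eq]
  · rw [Matrix.blockDiagonal'_apply_ne _ _ _ h]
    simp [h]

lemma norm_one_le {ι : Type*} [Fintype ι] [DecidableEq ι] : ‖(1 : Matrix ι ι ℝ)‖ ≤ 1 := by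
  refine l2_opNorm_le zero_le_one fun x => ?_
  simp

lemma norm_G_le {nmax : ℕ} (hn : ∀ i, n i ≤ nmax) : ‖G n‖ ≤ nmax := by
  have h := norm_Z_le hn
  have h2 := Matrix.l2_opNorm_mul (Z n) (Z n)ᵀ
  rw [← G_eq, norm_transpose] at h2
  refine h2.trans ?_
  have h3 : ‖Z n‖ * ‖Z n‖ ≤ √nmax * √nmax := by gcongr
  rwa [Real.mul_self_sqrt (Nat.cast_nonneg _)] at h3

lemma norm_dSig_le {nmax : ℕ} (hn : ∀ i, n i ≤ nmax) (b : Fin 2) : ‖dSig n b‖ ≤ nmax + 1 := by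
  fin_cases b
  · exact (norm_G_le hn).trans (by simp)
  · exact norm_one_le.trans (by simp)

lemma Sig_eq_sum (θ : Fin 2 → ℝ) : Sig n θ = ∑ b, θ b • dSig n b := by
  simp [Sig, dSig, Fin.sum_univ_two]

lemma norm_Sig_le {nmax : ℕ} (hn : ∀ i, n i ≤ nmax) (θ : Fin 2 → ℝ) :
    ‖Sig n θ‖ ≤ |θ 0| * nmax + |θ 1| := by
  refine (norm_add_le _ _).trans (add_le_add ?_ ?_)
  · rw [norm_smul]
    exact mul_le_mul_of_nonneg_left (norm_G_le hn) (abs_nonneg _)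
  · rw [norm_smul]
    exact mul_le_of_le_one_right (abs_nonneg _) norm_one_le

lemma card_Obs : Fintype.card (Obs n) = total n := by
  simp [total]

/-- The matrix `[Z I]` with `Z v + ε = [Z I] (v, ε)`. -/
noncomputable def designZ (n : Fin m → ℕ) : Matrix (Obs n) (Fin m ⊕ Obs n) ℝ :=
  Matrix.fromCols (Z n) 1

lemma designZ_mulVec (v : Fin m → ℝ) (e : Obs n → ℝ) :
    designZ n *ᵥ Sum.elim v e = Z n *ᵥ v + e := by
  simp [designZ]

lemma norm_designZ_le {nmax : ℕ} (hn : ∀ i, n i ≤ nmax) : ‖designZ n‖ ^ 2 ≤ nmax + 1 := by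
  have h : ‖designZ n‖ ≤ √(nmax + 1) := by
    rw [← norm_transpose]
    refine l2_opNorm_le (Real.sqrt_nonneg _) fun x => ?_
    rw [Real.sq_sqrt (by positivity), designZ, Matrix.transpose_fromCols,
      Matrix.fromRows_mulVec, Fintype.sum_sum_type]
    have := sum_Z_transpose_mulVec_sq_le hn x
    simp only [Sum.elim_inl, Sum.elim_inr, Matrix.transpose_one, Matrix.one_mulVec]
    linarith
  calc ‖designZ n‖ ^ 2 ≤ √((nmax : ℝ) + 1) ^ 2 := by gcongr
    _ = _ := Real.sq_sqrt (by positivity)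

/-- The covariances of `(v, ε)`. -/
noncomputable def effVar (n : Fin m → ℕ) (ψ : Fin 2 → ℝ) : Fin m ⊕ Obs n → ℝ :=
  Sum.elim (fun _ => ψ 0) (fun _ => ψ 1)

/-- The fourth moments of `(v, ε)`. -/
noncomputable def effFourth (n : Fin m → ℕ) (ψ : Fin 2 → ℝ) (Ke Kv : ℝ) : Fin m ⊕ Obs n → ℝ :=
  Sum.elim (fun _ => ψ 0 ^ 2 * (Kv + 3)) (fun _ => ψ 1 ^ 2 * (Ke + 3))

lemma Sig_eq_designZ (ψ : Fin 2 → ℝ) :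
    Sig n ψ = designZ n * Matrix.diagonal (effVar n ψ) * (designZ n)ᵀ := by
  have : Matrix.diagonal (effVar n ψ)
      = Matrix.fromBlocks (ψ 0 • (1 : Matrix (Fin m) (Fin m) ℝ)) 0 0
        (ψ 1 • (1 : Matrix (Obs n) (Obs n) ℝ)) := by
    ext i j
    rcases i with i | i <;> rcases j with j | j <;>
      simp [effVar, Matrix.diagonal_apply, Matrix.one_apply]
  rw [this, designZ, Matrix.transpose_fromCols, Matrix.fromCols_mul_fromBlocks,
    Matrix.fromCols_mul_fromRows, Sig, G_eq]
  simp

/-- The quadratic form `xᵀ C x`, centred by its expectation `tr (C Σ(ψ))`. -/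
noncomputable def centredQuad (ψ : Fin 2 → ℝ) (C : Matrix (Obs n) (Obs n) ℝ) (x : Obs n → ℝ) : ℝ :=
  x ⬝ᵥ C *ᵥ x - (C * Sig n ψ).trace

/-- With `R = [Z I]` the noise is `R` applied to the independent vector `(v, ε)`, so the form pulls
back to `Rᵀ C R`. The centring agrees because `Σ(ψ) = R V Rᵀ` with `V` diagonal and the trace is
cyclic. -/
lemma centredQuad_eq_quadForm {Ω : Type*} (ψ : Fin 2 → ℝ) (C : Matrix (Obs n) (Obs n) ℝ)
    (v : Fin m → Ω → ℝ) (ε : Obs n → Ω → ℝ) (ω : Ω) :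
    centredQuad ψ C (Z n *ᵥ (fun i => v i ω) + fun k => ε k ω)
      = quadForm (Sum.elim v ε) (effVar n ψ) Finset.univ ((designZ n)ᵀ * C * designZ n) ω := by
  have hw : (fun p => Sum.elim v ε p ω) = Sum.elim (fun i => v i ω) (fun k => ε k ω) := by
    funext p
    rcases p with p | p <;> rfl
  rw [centredQuad, quadForm, ← designZ_mulVec, ← hw]
  congr 1
  · set w := fun p => Sum.elim v ε p ω with hwd
    rw [Matrix.dotProduct_mulVec, Matrix.vecMul_mulVec, Matrix.dotProduct_mulVec,
      Matrix.vecMul_vecMul] 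
    simp only [dotProduct, Matrix.vecMul, Finset.sum_mul]
    rw [Finset.sum_comm]
    refine Finset.sum_congr rfl fun i _ => Finset.sum_congr rfl fun j _ => ?_
    simp only [hwd]
    ring
  · rw [Sig_eq_designZ, ← Matrix.mul_assoc, Matrix.trace_mul_comm, ← Matrix.mul_assoc,
      ← Matrix.mul_assoc, Matrix.trace]
    refine Finset.sum_congr rfl fun i _ => ?_
    simp [Matrix.mul_diagonal]

lemma isSymm_conj {ι κ : Type*} [Fintype ι] {C : Matrix ι ι ℝ} (hC : C.IsSymm)
    (R : Matrix ι κ ℝ) : (Rᵀ * C * R).IsSymm := by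
  simp [Matrix.IsSymm, Matrix.transpose_mul, hC.eq, Matrix.mul_assoc]

lemma frob_designZ_conj_le {nmax : ℕ} (hn : ∀ i, n i ≤ nmax) (C : Matrix (Obs n) (Obs n) ℝ) :
    frob ((designZ n)ᵀ * C * designZ n) ≤ (nmax + 1) * frob C := by
  have h1 := frob_mul_le' ((designZ n)ᵀ * C) (designZ n)
  have h2 := frob_mul_le (designZ n)ᵀ C
  rw [norm_transpose] at h2
  have h3 := norm_designZ_le hn
  have h4 := norm_nonneg (designZ n)
  have h5 := frob_nonneg C
  calc _ ≤ frob ((designZ n)ᵀ * C) * ‖designZ n‖ := h1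
    _ ≤ (‖designZ n‖ * frob C) * ‖designZ n‖ := by gcongr
    _ = ‖designZ n‖ ^ 2 * frob C := by ring
    _ ≤ _ := by gcongr

lemma trace_mul_Sig_mul_Sig (ψ : Fin 2 → ℝ) (C : Matrix (Obs n) (Obs n) ℝ)
    {D : Matrix (Obs n) (Obs n) ℝ} (hD : D.IsSymm) :
    (C * Sig n ψ * D * Sig n ψ).trace = ∑ i, ∑ j, ((designZ n)ᵀ * C * designZ n) i j
      * ((designZ n)ᵀ * D * designZ n) i j * effVar n ψ i * effVar n ψ j := by
  set R := designZ n
  set V := Matrix.diagonal (effVar n ψ)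
  have h1 : (C * Sig n ψ * D * Sig n ψ).trace
      = ((Rᵀ * C * R * V) * (Rᵀ * D * R * V)).trace := by
    rw [Sig_eq_designZ]
    rw [show C * (R * V * Rᵀ) * D * (R * V * Rᵀ) = (C * R * V * Rᵀ * D * R * V) * Rᵀ by
      simp only [Matrix.mul_assoc], Matrix.trace_mul_comm]
    simp only [Matrix.mul_assoc]
  rw [h1, Matrix.trace]
  refine Finset.sum_congr rfl fun i _ => ?_
  rw [Matrix.diag_apply, Matrix.mul_apply]
  refine Finset.sum_congr rfl fun j _ => ?_
  rw [Matrix.mul_diagonal, Matrix.mul_diagonal, (isSymm_conj hD R).apply i j]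
  ring

/-- The excess of the fourth moment over three times the squared variance is `ψ 0 ^ 2 * Kv` for a
random effect and `ψ 1 ^ 2 * Ke` for an error. The diagonal blocks of `Rᵀ C R` are `Zᵀ C Z` and `C`.
-/
lemma kurt_eq_sum (ψ : Fin 2 → ℝ) (Ke Kv : ℝ) (C D : Matrix (Obs n) (Obs n) ℝ) :
    kurt Ke Kv ψ C D = ∑ i, ((designZ n)ᵀ * C * designZ n) i i
      * ((designZ n)ᵀ * D * designZ n) i i * (effFourth n ψ Ke Kv i - 3 * effVar n ψ i ^ 2) := by
  have hl : ∀ (C : Matrix (Obs n) (Obs n) ℝ) (i : Fin m),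
      ((designZ n)ᵀ * C * designZ n) (Sum.inl i) (Sum.inl i) = ((Z n)ᵀ * C * Z n) i i := by
    intro C i
    rw [designZ, Matrix.transpose_fromCols, Matrix.fromRows_mul, Matrix.fromRows_mul_fromCols]
    rfl
  have hr : ∀ (C : Matrix (Obs n) (Obs n) ℝ) (k : Obs n),
      ((designZ n)ᵀ * C * designZ n) (Sum.inr k) (Sum.inr k) = C k k := by
    intro C k
    rw [designZ, Matrix.transpose_fromCols, Matrix.fromRows_mul, Matrix.fromRows_mul_fromCols]
    simp
  rw [Fintype.sum_sum_type]
  simp only [hl, hr, kurt, effFourth, effVar, Sum.elim_inl, Sum.elim_inr]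
  rw [Finset.mul_sum, Finset.mul_sum, add_comm]
  congr 1 <;> refine Finset.sum_congr rfl fun i _ => ?_ <;> ring

variable {Ω : Type*} [MeasurableSpace Ω] {P : Measure Ω} [IsProbabilityMeasure P]
  {ψ : Fin 2 → ℝ} {Ke Kv : ℝ} {v : Fin m → Ω → ℝ} {ε : Obs n → Ω → ℝ}

/-- A bound for the moments of the effects that only depends on the parameters. -/
noncomputable def momentBound (ψ : Fin 2 → ℝ) (M : ℝ) : ℝ := 1 + 8 * |M| + 8 * ψ 0 ^ 4 + 8 * ψ 1 ^ 4

lemma IsNER.centredFamily (h : IsNER P n ψ Ke Kv v ε) (hψ : ψ ∈ paramSpace) {M : ℝ}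
    (hv8 : ∀ i, Integrable (fun ω => v i ω ^ 8) P ∧ ∫ ω, v i ω ^ 8 ∂P ≤ M)
    (he8 : ∀ k, Integrable (fun ω => ε k ω ^ 8) P ∧ ∫ ω, ε k ω ^ 8 ∂P ≤ M) :
    CentredFamily P (Sum.elim v ε : Fin m ⊕ Obs n → Ω → ℝ) (effVar n ψ) (effFourth n ψ Ke Kv)
      (momentBound ψ M) := by
  have hc : 1 ≤ momentBound ψ M := by
    have : 0 ≤ 8 * |M| + 8 * ψ 0 ^ 4 + 8 * ψ 1 ^ 4 := by positivity
    unfold momentBound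
    linarith
  -- Moment bounds linear in the constant fit the squared form required by `CentredFamily`, because
  -- the constant is at least 1.
  have hcc : momentBound ψ M ≤ momentBound ψ M ^ 2 := by nlinarith
  have h8 : ∀ p : Fin m ⊕ Obs n, Integrable (fun ω => (Sum.elim v ε : Fin m ⊕ Obs n → Ω → ℝ) p ω ^ 8) P
      ∧ ∫ ω, (Sum.elim v ε : Fin m ⊕ Obs n → Ω → ℝ) p ω ^ 8 ∂P ≤ M := by
    rintro (i | k)
    · exact hv8 i
    · exact he8 k
  have hmeas : ∀ p : Fin m ⊕ Obs n, Measurable ((Sum.elim v ε : Fin m ⊕ Obs n → Ω → ℝ) p) := by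
    rintro (i | k)
    · exact h.meas_v i
    · exact h.meas_e k
  have hfour : ∀ p : Fin m ⊕ Obs n,
      ∫ ω, (Sum.elim v ε : Fin m ⊕ Obs n → Ω → ℝ) p ω ^ 4 ∂P = effFourth n ψ Ke Kv p := by
    have key : ∀ (s x : ℝ) (f : Ω → ℝ), 0 < s → ∫ ω, (f ω / √s) ^ 4 ∂P = x →
        ∫ ω, f ω ^ 4 ∂P = s ^ 2 * x := by
      intro s x f hs hx
      have e : ∀ ω, (f ω / √s) ^ 4 = (s ^ 2)⁻¹ * f ω ^ 4 := by
        intro ω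
        have : √s ^ 4 = s ^ 2 := by
          rw [show 4 = 2 * 2 from rfl, pow_mul, Real.sq_sqrt hs.le]
        rw [div_pow, this]
        ring
      simp only [e] at hx
      rw [integral_const_mul] at hx
      rw [← hx]
      field_simp
    rintro (i | k)
    · exact key _ _ _ (hψ 0) (h.fourth_v i)
    · exact key _ _ _ (hψ 1) (h.fourth_e k)
  have hvar : ∀ p : Fin m ⊕ Obs n,
      ∫ ω, (Sum.elim v ε : Fin m ⊕ Obs n → Ω → ℝ) p ω ^ 2 ∂P = effVar n ψ p := by
    rintro (i | k)
    · exact h.var_v i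
    · exact h.var_e k
  refine ⟨hmeas, h.indep, ?_, hvar, hfour, fun p => (h8 p).1, by linarith, fun p => ?_,
    fun p => ?_⟩
  · rintro (i | k)
    · exact h.mean_v i
    · exact h.mean_e k
  · rw [← hfour p]
    set f := (Sum.elim v ε : Fin m ⊕ Obs n → Ω → ℝ) p
    have h1 : ∫ ω, f ω ^ 4 ∂P ≤ ∫ ω, (1 + f ω ^ 8) ∂P := by
      refine integral_mono_of_nonneg (ae_of_all _ fun ω => by positivity)
        ((integrable_const _).add (h8 p).1) (ae_of_all _ fun ω => ?_)
      simp only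
      nlinarith [sq_nonneg (f ω ^ 4 - 1), sq_nonneg (f ω ^ 4)]
    rw [integral_add (integrable_const _) (h8 p).1] at h1
    simp only [integral_const, probReal_univ, smul_eq_mul, mul_one] at h1
    have h2 := (h8 p).2
    have h3 := le_abs_self M
    have h4 : 0 ≤ |M| := abs_nonneg M
    have : 0 ≤ 8 * ψ 0 ^ 4 + 8 * ψ 1 ^ 4 := by positivity
    unfold momentBound at hcc ⊢
    linarith
  · set f := (Sum.elim v ε : Fin m ⊕ Obs n → Ω → ℝ) p
    set s := effVar n ψ p with hs
    have h1 : ∫ ω, (f ω ^ 2 - s) ^ 4 ∂P ≤ ∫ ω, (8 * f ω ^ 8 + 8 * s ^ 4) ∂P := by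
      refine integral_mono_of_nonneg (ae_of_all _ fun ω => by positivity)
        (((h8 p).1.const_mul 8).add (integrable_const _)) (ae_of_all _ fun ω => ?_)
      simp only
      have hxy : ∀ x y : ℝ, (x - y) ^ 4 ≤ 8 * x ^ 4 + 8 * y ^ 4 := by
        intro x y
        nlinarith [sq_nonneg (x + y), sq_nonneg (x - y), sq_nonneg (x ^ 2 - y ^ 2),
          mul_nonneg (sq_nonneg (x + y)) (sq_nonneg (x - y)), sq_nonneg (x * y),
          mul_nonneg (sq_nonneg (x + y)) (sq_nonneg x),
          mul_nonneg (sq_nonneg (x + y)) (sq_nonneg y)]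
      have := hxy (f ω ^ 2) s
      rwa [← pow_mul] at this
    rw [integral_add ((h8 p).1.const_mul 8) (integrable_const _), integral_const_mul] at h1
    simp only [integral_const, probReal_univ, smul_eq_mul, one_mul] at h1
    have h2 := (h8 p).2
    have h3 := le_abs_self M
    have h5 : s ^ 4 ≤ ψ 0 ^ 4 + ψ 1 ^ 4 := by
      have h00 : 0 ≤ ψ 0 ^ 4 := by positivity
      have h11 : 0 ≤ ψ 1 ^ 4 := by positivity
      rcases p with p | p
      · simp only [hs, effVar, Sum.elim_inl]; linarith
      · simp only [hs, effVar, Sum.elim_inr]; linarith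
    unfold momentBound at hcc ⊢
    linarith

lemma IsNER.memLp_centredQuad (h : IsNER P n ψ Ke Kv v ε) (hψ : ψ ∈ paramSpace) {M : ℝ}
    (hv8 : ∀ i, Integrable (fun ω => v i ω ^ 8) P ∧ ∫ ω, v i ω ^ 8 ∂P ≤ M)
    (he8 : ∀ k, Integrable (fun ω => ε k ω ^ 8) P ∧ ∫ ω, ε k ω ^ 8 ∂P ≤ M)
    {C : Matrix (Obs n) (Obs n) ℝ} (hC : C.IsSymm) :
    MemLp (fun ω => centredQuad ψ C (Z n *ᵥ (fun i => v i ω) + fun k => ε k ω)) 4 P := by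
  simp only [centredQuad_eq_quadForm]
  exact (h.centredFamily hψ hv8 he8).memLp_quadForm _ (isSymm_conj hC _)

lemma IsNER.integral_centredQuad (h : IsNER P n ψ Ke Kv v ε) (hψ : ψ ∈ paramSpace) {M : ℝ}
    (hv8 : ∀ i, Integrable (fun ω => v i ω ^ 8) P ∧ ∫ ω, v i ω ^ 8 ∂P ≤ M)
    (he8 : ∀ k, Integrable (fun ω => ε k ω ^ 8) P ∧ ∫ ω, ε k ω ^ 8 ∂P ≤ M)
    {C : Matrix (Obs n) (Obs n) ℝ} (hC : C.IsSymm) :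
    ∫ ω, centredQuad ψ C (Z n *ᵥ (fun i => v i ω) + fun k => ε k ω) ∂P = 0 := by
  simp only [centredQuad_eq_quadForm]
  exact (h.centredFamily hψ hv8 he8).integral_quadForm _ (isSymm_conj hC _)

lemma IsNER.integral_centredQuad_mul (h : IsNER P n ψ Ke Kv v ε) (hψ : ψ ∈ paramSpace) {M : ℝ}
    (hv8 : ∀ i, Integrable (fun ω => v i ω ^ 8) P ∧ ∫ ω, v i ω ^ 8 ∂P ≤ M)
    (he8 : ∀ k, Integrable (fun ω => ε k ω ^ 8) P ∧ ∫ ω, ε k ω ^ 8 ∂P ≤ M)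
    {C D : Matrix (Obs n) (Obs n) ℝ} (hC : C.IsSymm) (hD : D.IsSymm) :
    ∫ ω, centredQuad ψ C (Z n *ᵥ (fun i => v i ω) + fun k => ε k ω)
        * centredQuad ψ D (Z n *ᵥ (fun i => v i ω) + fun k => ε k ω) ∂P
      = 2 * (C * Sig n ψ * D * Sig n ψ).trace + kurt Ke Kv ψ C D := by
  simp only [centredQuad_eq_quadForm]
  rw [(h.centredFamily hψ hv8 he8).integral_quadForm_mul_quadForm _ (isSymm_conj hC _)
    (isSymm_conj hD _), trace_mul_Sig_mul_Sig ψ C hD, kurt_eq_sum]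

/-- The constant in the fourth moment bound for centred quadratic forms. -/
noncomputable def quadMomentConst (ψ : Fin 2 → ℝ) (M : ℝ) (nmax : ℕ) : ℝ :=
  4 * (3 * momentBound ψ M + 64 * momentBound ψ M ^ 2) * (nmax + 1) ^ 2

lemma IsNER.integral_centredQuad_pow_four_le (h : IsNER P n ψ Ke Kv v ε) (hψ : ψ ∈ paramSpace)
    {M : ℝ} (hv8 : ∀ i, Integrable (fun ω => v i ω ^ 8) P ∧ ∫ ω, v i ω ^ 8 ∂P ≤ M)
    (he8 : ∀ k, Integrable (fun ω => ε k ω ^ 8) P ∧ ∫ ω, ε k ω ^ 8 ∂P ≤ M) {nmax : ℕ}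
    (hn : ∀ i, n i ≤ nmax) {C : Matrix (Obs n) (Obs n) ℝ} (hC : C.IsSymm) :
    ∫ ω, centredQuad ψ C (Z n *ᵥ (fun i => v i ω) + fun k => ε k ω) ^ 4 ∂P
      ≤ (quadMomentConst ψ M nmax * frob C ^ 2) ^ 2 := by
  simp only [centredQuad_eq_quadForm]
  have hF := h.centredFamily hψ hv8 he8
  have hc := hF.nonneg
  refine (hF.integral_quadForm_pow_four_le _ (isSymm_conj hC _)).trans ?_
  rw [← frob_sq]
  have h1 := frob_designZ_conj_le hn C
  have h2 := frob_nonneg ((designZ n)ᵀ * C * designZ n)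
  refine pow_le_pow_left₀ (by positivity) ?_ 2
  have : frob ((designZ n)ᵀ * C * designZ n) ^ 2 ≤ ((nmax + 1) * frob C) ^ 2 := by gcongr
  calc _ ≤ 4 * (3 * momentBound ψ M + 64 * momentBound ψ M ^ 2) * ((nmax + 1) * frob C) ^ 2 := by
        gcongr
    _ = _ := by rw [quadMomentConst]; ring

end Model

end NER

namespace NER

open scoped Matrix.Norms.L2Operator

/-! ### Iterated partial derivatives of matrix functions and bounds of Leibniz type. -/

section Partials

lemma isOpen_paramSpace : IsOpen paramSpace := by
  have : paramSpace = ⋂ a : Fin 2, {θ : Fin 2 → ℝ | 0 < θ a} := by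
    ext θ
    simp [paramSpace]
  rw [this]
  exact isOpen_iInter_of_finite fun a => isOpen_lt continuous_const (continuous_apply a)

/-- The iterated partial derivative of a scalar function along a list of indices. -/
noncomputable def partials : List (Fin 2) → ((Fin 2 → ℝ) → ℝ) → (Fin 2 → ℝ) → ℝ
  | [], f => f
  | b :: l, f => partialDeriv b (partials l f)

lemma contDiffOn_partialDeriv {k : ℕ} {f : (Fin 2 → ℝ) → ℝ}
    (hf : ContDiffOn ℝ (k + 1 : ℕ) f paramSpace) (b : Fin 2) :
    ContDiffOn ℝ k (partialDeriv b f) paramSpace := by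
  have h := hf.fderiv_of_isOpen isOpen_paramSpace (m := k) (by norm_cast)
  exact h.clm_apply contDiffOn_const

lemma contDiffOn_partials {k : ℕ} (l : List (Fin 2)) {f : (Fin 2 → ℝ) → ℝ}
    (hf : ContDiffOn ℝ (k + l.length : ℕ) f paramSpace) :
    ContDiffOn ℝ k (partials l f) paramSpace := by
  induction l generalizing k with
  | nil => exact hf
  | cons b l ih =>
    refine contDiffOn_partialDeriv (ih ?_) b
    convert hf using 2
    simp only [List.length_cons]
    ring

lemma partialDeriv_congr {f g : (Fin 2 → ℝ) → ℝ} (h : Set.EqOn f g paramSpace) (b : Fin 2) :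
    Set.EqOn (partialDeriv b f) (partialDeriv b g) paramSpace := by
  intro θ hθ
  have : f =ᶠ[nhds θ] g := Filter.eventuallyEq_of_mem (isOpen_paramSpace.mem_nhds hθ) h
  rw [partialDeriv, partialDeriv, this.fderiv_eq]

lemma partials_congr {f g : (Fin 2 → ℝ) → ℝ} (h : Set.EqOn f g paramSpace) (l : List (Fin 2)) :
    Set.EqOn (partials l f) (partials l g) paramSpace := by
  induction l with
  | nil => exact h
  | cons b l ih => exact partialDeriv_congr ih b

lemma differentiableAt_of_contDiffOn {k : ℕ} (hk : k ≠ 0) {f : (Fin 2 → ℝ) → ℝ}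
    (hf : ContDiffOn ℝ k f paramSpace) {θ : Fin 2 → ℝ} (hθ : θ ∈ paramSpace) :
    DifferentiableAt ℝ f θ :=
  (hf.differentiableOn (by exact_mod_cast hk)).differentiableAt (isOpen_paramSpace.mem_nhds hθ)

lemma partials_sum {ι : Type*} (s : Finset ι) (c : ι → ℝ) (f : ι → (Fin 2 → ℝ) → ℝ)
    (l : List (Fin 2)) (hf : ∀ i ∈ s, ContDiffOn ℝ l.length (f i) paramSpace) :
    Set.EqOn (partials l fun θ => ∑ i ∈ s, c i * f i θ)
      (fun θ => ∑ i ∈ s, c i * partials l (f i) θ) paramSpace := by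
  induction l with
  | nil => exact fun θ _ => rfl
  | cons b l ih =>
    intro θ hθ
    have ih' := ih fun i hi => (hf i hi).of_le (by simp)
    have hd : ∀ i ∈ s, DifferentiableAt ℝ (partials l (f i)) θ := fun i hi =>
      differentiableAt_of_contDiffOn one_ne_zero
        (contDiffOn_partials (k := 1) l (by simpa [add_comm] using hf i hi)) hθ
    rw [partials, partialDeriv_congr ih' b hθ, partialDeriv,
      fderiv_fun_sum fun i hi => (hd i hi).const_mul (c i)]
    simp only [FunLike.coe_sum, Finset.sum_apply]
    refine Finset.sum_congr rfl fun i hi => ?_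
    rw [fderiv_const_mul (hd i hi)]
    rfl

variable {ι κ μ : Type} [Fintype ι] [Fintype κ] [Fintype μ] [DecidableEq ι] [DecidableEq κ]
  [DecidableEq μ]

lemma matPartials_apply (l : List (Fin 2)) (F : (Fin 2 → ℝ) → Matrix ι κ ℝ) (θ : Fin 2 → ℝ)
    (i : ι) (j : κ) : matPartials l F θ i j = partials l (fun η => F η i j) θ := by
  induction l generalizing θ with
  | nil => rfl
  | cons b l ih =>
    simp only [matPartials, matPartial, Matrix.of_apply, partials]
    congr 1
    funext η
    exact ih η

/-- The head of a list is the outermost derivative. Splitting off the innermost one instead allows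
an induction on the order in which `F` is replaced by its partial derivative. -/
lemma matPartials_append_singleton (l : List (Fin 2)) (b : Fin 2)
    (F : (Fin 2 → ℝ) → Matrix ι κ ℝ) :
    matPartials (l ++ [b]) F = matPartials l (matPartial b F) := by
  induction l with
  | nil => rfl
  | cons a l ih => simp only [List.cons_append, matPartials, ih]

lemma matPartials_congr {F F' : (Fin 2 → ℝ) → Matrix ι κ ℝ} (h : Set.EqOn F F' paramSpace)
    (l : List (Fin 2)) : Set.EqOn (matPartials l F) (matPartials l F') paramSpace := by
  intro θ hθ
  ext i j
  rw [matPartials_apply, matPartials_apply]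
  exact partials_congr (fun η hη => by simp only [h hη]) l hθ

/-- Entrywise `k` times continuously differentiable matrix-valued functions. -/
def SmoothMat (k : ℕ) (F : (Fin 2 → ℝ) → Matrix ι κ ℝ) : Prop :=
  ∀ i j, ContDiffOn ℝ k (fun θ => F θ i j) paramSpace

lemma SmoothMat.of_le {k k' : ℕ} {F : (Fin 2 → ℝ) → Matrix ι κ ℝ} (h : SmoothMat k F)
    (hk : k' ≤ k) : SmoothMat k' F := fun i j => (h i j).of_le (by exact_mod_cast hk)

lemma SmoothMat.matPartial {k : ℕ} {F : (Fin 2 → ℝ) → Matrix ι κ ℝ} (h : SmoothMat (k + 1) F)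
    (b : Fin 2) : SmoothMat k (matPartial b F) := fun i j => contDiffOn_partialDeriv (h i j) b

lemma SmoothMat.add {k : ℕ} {F F' : (Fin 2 → ℝ) → Matrix ι κ ℝ} (h : SmoothMat k F)
    (h' : SmoothMat k F') : SmoothMat k (fun θ => F θ + F' θ) := fun i j => (h i j).add (h' i j)

lemma SmoothMat.neg {k : ℕ} {F : (Fin 2 → ℝ) → Matrix ι κ ℝ} (h : SmoothMat k F) :
    SmoothMat k (fun θ => -F θ) := fun i j => (h i j).neg

lemma SmoothMat.transpose {k : ℕ} {F : (Fin 2 → ℝ) → Matrix ι κ ℝ} (h : SmoothMat k F) :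
    SmoothMat k (fun θ => (F θ)ᵀ) := fun i j => h j i

lemma SmoothMat.mul {k : ℕ} {F : (Fin 2 → ℝ) → Matrix ι κ ℝ} {F' : (Fin 2 → ℝ) → Matrix κ μ ℝ}
    (h : SmoothMat k F) (h' : SmoothMat k F') : SmoothMat k (fun θ => F θ * F' θ) := by
  intro i j
  simp only [Matrix.mul_apply]
  exact ContDiffOn.sum fun x _ => (h i x).mul (h' x j)

/-- A linear functional is a fixed combination of the entries, hence commutes with differentiation.
Bounds on matrix derivatives thus pass to the scalar coefficients of the equations. -/
lemma matPartials_linearMap (φ : Matrix ι κ ℝ →ₗ[ℝ] ℝ) (l : List (Fin 2))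
    {F : (Fin 2 → ℝ) → Matrix ι κ ℝ} (hF : SmoothMat l.length F) :
    Set.EqOn (partials l fun θ => φ (F θ)) (fun θ => φ (matPartials l F θ)) paramSpace := by
  have hφ : ∀ C : Matrix ι κ ℝ, φ C = ∑ p : ι × κ, φ (Matrix.single p.1 p.2 1) * C p.1 p.2 := by
    intro C
    conv_lhs => rw [Matrix.matrix_eq_sum_single C]
    rw [map_sum, Fintype.sum_prod_type]
    refine Finset.sum_congr rfl fun i _ => ?_
    rw [map_sum]
    refine Finset.sum_congr rfl fun j _ => ?_
    have : Matrix.single i j (C i j) = C i j • Matrix.single i j (1 : ℝ) := by simp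
    rw [this, map_smul, smul_eq_mul, mul_comm]
  intro θ hθ
  have h := partials_sum Finset.univ (fun p : ι × κ => φ (Matrix.single p.1 p.2 1))
    (fun p η => F η p.1 p.2) l (fun p _ => hF p.1 p.2) hθ
  have e : (fun θ => φ (F θ))
      = fun θ => ∑ p : ι × κ, φ (Matrix.single p.1 p.2 1) * F θ p.1 p.2 := funext fun θ => hφ (F θ)
  rw [e]
  refine h.trans ?_
  refine Eq.trans ?_ (hφ (matPartials l F θ)).symm
  simp only [matPartials_apply]

lemma contDiffOn_linearMap (φ : Matrix ι κ ℝ →ₗ[ℝ] ℝ) {k : ℕ}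
    {F : (Fin 2 → ℝ) → Matrix ι κ ℝ} (hF : SmoothMat k F) :
    ContDiffOn ℝ k (fun θ => φ (F θ)) paramSpace := by
  have hφ : ∀ C : Matrix ι κ ℝ, φ C = ∑ i, ∑ j, C i j * φ (Matrix.single i j 1) := by
    intro C
    conv_lhs => rw [Matrix.matrix_eq_sum_single C]
    rw [map_sum]
    refine Finset.sum_congr rfl fun i _ => ?_
    rw [map_sum]
    refine Finset.sum_congr rfl fun j _ => ?_
    have : Matrix.single i j (C i j) = C i j • Matrix.single i j (1 : ℝ) := by simp
    rw [this, map_smul, smul_eq_mul]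
  have e : (fun θ => φ (F θ)) = fun θ => ∑ i, ∑ j, F θ i j * φ (Matrix.single i j 1) :=
    funext fun θ => hφ (F θ)
  rw [e]
  exact ContDiffOn.sum fun i _ => ContDiffOn.sum fun j _ => (hF i j).mul contDiffOn_const

lemma matPartials_add (l : List (Fin 2)) {F F' : (Fin 2 → ℝ) → Matrix ι κ ℝ}
    (hF : SmoothMat l.length F) (hF' : SmoothMat l.length F') :
    Set.EqOn (matPartials l fun θ => F θ + F' θ)
      (fun θ => matPartials l F θ + matPartials l F' θ) paramSpace := by
  intro θ hθ
  ext i j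
  have h := partials_sum (Finset.univ : Finset (Fin 2)) (fun _ => 1)
    ![fun η => F η i j, fun η => F' η i j] l
    (by intro a _; fin_cases a; exacts [hF i j, hF' i j]) hθ
  simp only [Fin.sum_univ_two, one_mul, Matrix.cons_val_zero, Matrix.cons_val_one] at h
  refine (matPartials_apply l _ θ i j).trans (h.trans ?_)
  exact (congrArg₂ (· + ·) (matPartials_apply l F θ i j) (matPartials_apply l F' θ i j)).symm

lemma matPartials_neg (l : List (Fin 2)) {F : (Fin 2 → ℝ) → Matrix ι κ ℝ}
    (hF : SmoothMat l.length F) :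
    Set.EqOn (matPartials l fun θ => -F θ) (fun θ => -matPartials l F θ) paramSpace := by
  intro θ hθ
  ext i j
  have h := partials_sum (Finset.univ : Finset (Fin 1)) (fun _ => -1)
    (fun _ η => F η i j) l (fun _ _ => hF i j) hθ
  simp only [Finset.univ_unique, Finset.sum_singleton, neg_one_mul] at h
  refine (matPartials_apply l _ θ i j).trans (h.trans ?_)
  exact congrArg Neg.neg (matPartials_apply l F θ i j).symm

lemma matPartials_transpose (l : List (Fin 2)) (F : (Fin 2 → ℝ) → Matrix ι κ ℝ) (θ : Fin 2 → ℝ) :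
    matPartials l (fun θ => (F θ)ᵀ) θ = (matPartials l F θ)ᵀ := by
  ext i j
  rw [Matrix.transpose_apply, matPartials_apply, matPartials_apply]
  rfl

lemma matPartials_isSymm (l : List (Fin 2)) {F : (Fin 2 → ℝ) → Matrix ι ι ℝ}
    (hF : ∀ θ ∈ paramSpace, (F θ).IsSymm) {θ : Fin 2 → ℝ} (hθ : θ ∈ paramSpace) :
    (matPartials l F θ).IsSymm := by
  rw [Matrix.IsSymm, ← matPartials_transpose]
  exact matPartials_congr (fun η hη => hF η hη) l hθ

lemma matPartial_mul (b : Fin 2) {F : (Fin 2 → ℝ) → Matrix ι κ ℝ}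
    {F' : (Fin 2 → ℝ) → Matrix κ μ ℝ} (hF : SmoothMat 1 F) (hF' : SmoothMat 1 F') :
    Set.EqOn (matPartial b fun θ => F θ * F' θ)
      (fun θ => matPartial b F θ * F' θ + F θ * matPartial b F' θ) paramSpace := by
  intro θ hθ
  ext i j
  have hd : ∀ x, DifferentiableAt ℝ (fun η => F η i x) θ := fun x =>
    differentiableAt_of_contDiffOn one_ne_zero (hF i x) hθ
  have hd' : ∀ x, DifferentiableAt ℝ (fun η => F' η x j) θ := fun x =>
    differentiableAt_of_contDiffOn one_ne_zero (hF' x j) hθ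
  simp only [matPartial, partialDeriv, Matrix.of_apply, Matrix.mul_apply, Matrix.add_apply]
  rw [fderiv_fun_sum fun x _ => (hd x).fun_mul (hd' x), ← Finset.sum_add_distrib]
  simp only [FunLike.coe_sum, Finset.sum_apply]
  refine Finset.sum_congr rfl fun x _ => ?_
  rw [fderiv_fun_mul (hd x) (hd' x)]
  simp only [FunLike.coe_add, FunLike.coe_smul, Pi.add_apply, Pi.smul_apply, smul_eq_mul]
  ring

/-- All partial derivatives of order at most `k` are bounded by `c` on `Θ`, in the size `ν`. -/
def BoundedPartials (ν : Matrix ι κ ℝ → ℝ) (Θ : Set (Fin 2 → ℝ)) (k : ℕ) (c : ℝ)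
    (F : (Fin 2 → ℝ) → Matrix ι κ ℝ) : Prop :=
  ∀ l : List (Fin 2), l.length ≤ k → ∀ θ ∈ Θ, ν (matPartials l F θ) ≤ c

lemma boundedPartials_succ_iff {ν : Matrix ι κ ℝ → ℝ} {Θ : Set (Fin 2 → ℝ)} {k : ℕ} {c : ℝ}
    {F : (Fin 2 → ℝ) → Matrix ι κ ℝ} :
    BoundedPartials ν Θ (k + 1) c F
      ↔ (∀ θ ∈ Θ, ν (F θ) ≤ c) ∧ ∀ b, BoundedPartials ν Θ k c (matPartial b F) := by
  constructor
  · intro h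
    refine ⟨h [] (by simp), fun b l hl => ?_⟩
    rw [← matPartials_append_singleton]
    exact h _ (by simpa using hl)
  · rintro ⟨h0, h1⟩ l hl
    rcases List.eq_nil_or_concat l with rfl | ⟨l', b, rfl⟩
    · exact h0
    · rw [List.concat_eq_append] at hl ⊢
      rw [matPartials_append_singleton]
      exact h1 b l' (by simpa using hl)

lemma BoundedPartials.congr {ν : Matrix ι κ ℝ → ℝ} {Θ : Set (Fin 2 → ℝ)} (hΘ : Θ ⊆ paramSpace)
    {k : ℕ} {c : ℝ} {F F' : (Fin 2 → ℝ) → Matrix ι κ ℝ} (h : BoundedPartials ν Θ k c F')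
    (hFF' : Set.EqOn F F' paramSpace) : BoundedPartials ν Θ k c F := by
  intro l hl θ hθ
  rw [matPartials_congr hFF' l (hΘ hθ)]
  exact h l hl θ hθ

lemma BoundedPartials.add {ν : Matrix ι κ ℝ → ℝ} (hν : ∀ A B, ν (A + B) ≤ ν A + ν B)
    {Θ : Set (Fin 2 → ℝ)} (hΘ : Θ ⊆ paramSpace) {k : ℕ} {c c' : ℝ}
    {F F' : (Fin 2 → ℝ) → Matrix ι κ ℝ} (hF : SmoothMat k F) (hF' : SmoothMat k F')
    (h : BoundedPartials ν Θ k c F) (h' : BoundedPartials ν Θ k c' F') :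
    BoundedPartials ν Θ k (c + c') (fun θ => F θ + F' θ) := by
  intro l hl θ hθ
  rw [matPartials_add l (hF.of_le hl) (hF'.of_le hl) (hΘ hθ)]
  exact (hν _ _).trans (add_le_add (h l hl θ hθ) (h' l hl θ hθ))

lemma BoundedPartials.neg {ν : Matrix ι κ ℝ → ℝ} (hν : ∀ A, ν (-A) = ν A)
    {Θ : Set (Fin 2 → ℝ)} (hΘ : Θ ⊆ paramSpace) {k : ℕ} {c : ℝ}
    {F : (Fin 2 → ℝ) → Matrix ι κ ℝ} (hF : SmoothMat k F) (h : BoundedPartials ν Θ k c F) :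
    BoundedPartials ν Θ k c (fun θ => -F θ) := by
  intro l hl θ hθ
  rw [matPartials_neg l (hF.of_le hl) (hΘ hθ), hν]
  exact h l hl θ hθ

lemma BoundedPartials.transpose {ν : Matrix ι κ ℝ → ℝ} {ν' : Matrix κ ι ℝ → ℝ}
    (hν : ∀ A, ν' Aᵀ = ν A) {Θ : Set (Fin 2 → ℝ)} {k : ℕ} {c : ℝ}
    {F : (Fin 2 → ℝ) → Matrix ι κ ℝ} (h : BoundedPartials ν Θ k c F) :
    BoundedPartials ν' Θ k c (fun θ => (F θ)ᵀ) := by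
  intro l hl θ hθ
  rw [matPartials_transpose, hν]
  exact h l hl θ hθ

lemma BoundedPartials.mono {ν ν' : Matrix ι κ ℝ → ℝ} (hν : ∀ A, ν' A ≤ ν A)
    {Θ : Set (Fin 2 → ℝ)} {k k' : ℕ} (hk : k' ≤ k) {c c' : ℝ} (hc : c ≤ c')
    {F : (Fin 2 → ℝ) → Matrix ι κ ℝ} (h : BoundedPartials ν Θ k c F) :
    BoundedPartials ν' Θ k' c' F :=
  fun l hl θ hθ => (hν _).trans ((h l (hl.trans hk) θ hθ).trans hc)

/-- The Leibniz rule, as a bound. -/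
lemma BoundedPartials.mul {ν₁ : Matrix ι κ ℝ → ℝ} {ν₂ : Matrix κ μ ℝ → ℝ} {ν : Matrix ι μ ℝ → ℝ}
    (hν₂ : ∀ A, 0 ≤ ν₂ A)
    (hν : ∀ A B, ν (A + B) ≤ ν A + ν B) (hmul : ∀ A B, ν (A * B) ≤ ν₁ A * ν₂ B)
    {Θ : Set (Fin 2 → ℝ)} (hΘ : Θ ⊆ paramSpace) {k : ℕ} {c₁ c₂ : ℝ} (hc₁ : 0 ≤ c₁) (hc₂ : 0 ≤ c₂)
    {F : (Fin 2 → ℝ) → Matrix ι κ ℝ} {F' : (Fin 2 → ℝ) → Matrix κ μ ℝ}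
    (hF : SmoothMat k F) (hF' : SmoothMat k F')
    (h : BoundedPartials ν₁ Θ k c₁ F) (h' : BoundedPartials ν₂ Θ k c₂ F') :
    BoundedPartials ν Θ k (2 ^ k * c₁ * c₂) (fun θ => F θ * F' θ) := by
  have hval : ∀ {k : ℕ} {F : (Fin 2 → ℝ) → Matrix ι κ ℝ} {F' : (Fin 2 → ℝ) → Matrix κ μ ℝ},
      BoundedPartials ν₁ Θ k c₁ F → BoundedPartials ν₂ Θ k c₂ F' →
      ∀ θ ∈ Θ, ν (F θ * F' θ) ≤ c₁ * c₂ := fun h h' θ hθ =>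
    (hmul _ _).trans (mul_le_mul (h [] (by simp) θ hθ) (h' [] (by simp) θ hθ) (hν₂ _) hc₁)
  induction k generalizing F F' with
  | zero =>
    intro l hl θ hθ
    obtain rfl : l = [] := List.length_eq_zero_iff.1 (Nat.le_zero.1 hl)
    rw [pow_zero, one_mul]
    exact hval h h' θ hθ
  | succ k ih =>
    rw [boundedPartials_succ_iff]
    refine ⟨fun θ hθ => (hval h h' θ hθ).trans ?_, fun b => ?_⟩
    · have : (1 : ℝ) ≤ 2 ^ (k + 1) := one_le_pow₀ (by norm_num)
      nlinarith [mul_nonneg hc₁ hc₂]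
    -- Every differentiation doubles the number of products, whence the factor `2 ^ k`.
    · have e := matPartial_mul b (hF.of_le (Nat.le_add_left 1 k)) (hF'.of_le (Nat.le_add_left 1 k))
      refine BoundedPartials.congr hΘ ?_ e
      have hk := Nat.le_succ k
      have h1 := (boundedPartials_succ_iff.1 h).2 b
      have h2 := (boundedPartials_succ_iff.1 h').2 b
      have b1 := ih (hF.matPartial b) (hF'.of_le hk) h1 (h'.mono (fun _ => le_rfl) hk le_rfl)
      have b2 := ih (hF.of_le hk) (hF'.matPartial b) (h.mono (fun _ => le_rfl) hk le_rfl) h2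
      have := BoundedPartials.add hν hΘ ((hF.matPartial b).mul (hF'.of_le hk))
        ((hF.of_le hk).mul (hF'.matPartial b)) b1 b2
      refine this.mono (fun _ => le_rfl) le_rfl (le_of_eq ?_)
      ring

end Partials

end NER

namespace NER

/-! ### First and second order Taylor estimates on convex sets. -/

section Taylor

lemma fderiv_apply_eq_sum (f : (Fin 2 → ℝ) → ℝ) (θ x : Fin 2 → ℝ) :
    fderiv ℝ f θ x = ∑ b, x b * partialDeriv b f θ := by
  have hx : x = ∑ b, x b • (Pi.single b 1 : Fin 2 → ℝ) := by
    ext i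
    fin_cases i <;> simp
  conv_lhs => rw [hx]
  rw [map_sum]
  exact Finset.sum_congr rfl fun b _ => by rw [map_smul, smul_eq_mul, partialDeriv]

lemma abs_sum_mul_le {x y : Fin 2 → ℝ} {X Y : ℝ} (hx : ∀ b, |x b| ≤ X) (hy : ∀ b, |y b| ≤ Y) :
    |∑ b, x b * y b| ≤ 2 * (X * Y) := by
  have h : ∀ b, |x b * y b| ≤ X * Y := fun b => by
    rw [abs_mul]
    exact mul_le_mul (hx b) (hy b) (abs_nonneg _) ((abs_nonneg _).trans (hx b))
  calc |∑ b, x b * y b| ≤ ∑ b, |x b * y b| := Finset.abs_sum_le_sum_abs _ _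
    _ ≤ ∑ _b : Fin 2, X * Y := Finset.sum_le_sum fun b _ => h b
    _ = 2 * (X * Y) := by simp

lemma abs_apply_le_norm (x : Fin 2 → ℝ) (b : Fin 2) : |x b| ≤ ‖x‖ := norm_le_pi_norm x b

variable {f : (Fin 2 → ℝ) → ℝ} {s : Set (Fin 2 → ℝ)} {k : ℝ}

/-- The mean value inequality for the sup norm; the factor 2 is the number of coordinates. -/
lemma abs_sub_le_of_partialDeriv_le (hf : ContDiffOn ℝ (1 : ℕ) f paramSpace) (hs : Convex ℝ s)
    (hsp : s ⊆ paramSpace) (hk : ∀ θ ∈ s, ∀ b, |partialDeriv b f θ| ≤ k) {x y : Fin 2 → ℝ}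
    (hx : x ∈ s) (hy : y ∈ s) : |f x - f y| ≤ 2 * k * ‖x - y‖ := by
  refine hs.norm_image_sub_le_of_norm_fderiv_le (𝕜 := ℝ)
    (fun θ hθ => differentiableAt_of_contDiffOn one_ne_zero hf (hsp hθ)) (fun θ hθ => ?_) hy hx
  refine ContinuousLinearMap.opNorm_le_bound _ ?_ fun z => ?_
  · have := (abs_nonneg _).trans (hk θ hθ 0)
    linarith
  · rw [fderiv_apply_eq_sum, Real.norm_eq_abs]
    refine (abs_sum_mul_le (abs_apply_le_norm z) (hk θ hθ)).trans (le_of_eq (by ring))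

lemma abs_sub_sub_le_of_partialDeriv_le (hf : ContDiffOn ℝ (2 : ℕ) f paramSpace)
    (hs : Convex ℝ s) (hsp : s ⊆ paramSpace)
    (hk : ∀ θ ∈ s, ∀ b d, |partialDeriv d (partialDeriv b f) θ| ≤ k) {x y : Fin 2 → ℝ}
    (hx : x ∈ s) (hy : y ∈ s) :
    |f x - f y - ∑ b, (x b - y b) * partialDeriv b f y| ≤ 4 * k * ‖x - y‖ ^ 2 := by
  have hk0 : 0 ≤ k := (abs_nonneg _).trans (hk x hx 0 0)
  -- Restricting to the ball of radius `‖x - y‖` makes the oscillation of the gradient proportional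
  -- to `‖x - y‖`, so the mean value inequality yields a quadratic remainder.
  have hs' : Convex ℝ (s ∩ Metric.closedBall y ‖x - y‖) := hs.inter (convex_closedBall _ _)
  have h := hs'.norm_image_sub_le_of_norm_fderiv_le' (𝕜 := ℝ) (f := f) (φ := fderiv ℝ f y)
    (C := 4 * k * ‖x - y‖) (x := y) (y := x)
    (fun θ hθ => differentiableAt_of_contDiffOn one_ne_zero (hf.of_le (by norm_num)) (hsp hθ.1))
    (fun θ hθ => ?_) ⟨hy, by simp⟩ ⟨hx, by simp [dist_eq_norm]⟩
  · rw [fderiv_apply_eq_sum, Real.norm_eq_abs] at h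
    refine h.trans (le_of_eq (by ring))
  · refine ContinuousLinearMap.opNorm_le_bound _ (by positivity) fun z => ?_
    have hd : ∀ b, |partialDeriv b f θ - partialDeriv b f y| ≤ 2 * k * ‖x - y‖ := by
      intro b
      have h1 := abs_sub_le_of_partialDeriv_le (contDiffOn_partialDeriv hf b) hs hsp
        (fun η hη => hk η hη b) hθ.1 hy
      have h2 : ‖θ - y‖ ≤ ‖x - y‖ := by simpa [dist_eq_norm] using hθ.2
      exact h1.trans (by gcongr)
    have e : (fderiv ℝ f θ - fderiv ℝ f y) z
        = ∑ b, z b * (partialDeriv b f θ - partialDeriv b f y) := by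
      rw [sub_apply, fderiv_apply_eq_sum, fderiv_apply_eq_sum,
        ← Finset.sum_sub_distrib]
      exact Finset.sum_congr rfl fun b _ => by ring
    rw [e, Real.norm_eq_abs]
    exact (abs_sum_mul_le (abs_apply_le_norm z) hd).trans (le_of_eq (by ring))

end Taylor

/-! ### Roots of the perturbed system: existence, localization and expansion. -/

section Root

/-- The linear-in-disguise form `a(θ) (θ - ψ) = ξ(θ)` of the estimating equations. -/
def IsRoot (a : Fin 2 → Fin 2 → (Fin 2 → ℝ) → ℝ) (ξ : Fin 2 → (Fin 2 → ℝ) → ℝ)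
    (ψ θ : Fin 2 → ℝ) : Prop :=
  ∀ i, ∑ b, a i b θ * (θ b - ψ b) = ξ i θ

/-- Uniform regularity of the coefficients of the equation `a(θ) (θ - ψ) = ξ(θ)`. -/
structure RegularSystem (Θ : Set (Fin 2 → ℝ)) (c : ℝ)
    (a : Fin 2 → Fin 2 → (Fin 2 → ℝ) → ℝ) (ξ : Fin 2 → (Fin 2 → ℝ) → ℝ) : Prop where
  smooth_a : ∀ i b, ContDiffOn ℝ (3 : ℕ) (a i b) paramSpace
  smooth_ξ : ∀ i, ContDiffOn ℝ (3 : ℕ) (ξ i) paramSpace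
  bound_a : ∀ i b, ∀ l : List (Fin 2), l.length ≤ 3 → ∀ θ ∈ Θ, |partials l (a i b) θ| ≤ c
  bound_ξ : ∀ i, ∀ l : List (Fin 2), l.length ≤ 3 → ∀ θ ∈ Θ, |partials l (ξ i) θ| ≤ c
  coercive : ∀ θ ∈ Θ, ∀ x : Fin 2 → ℝ, ‖x‖ ≤ c * ‖fun i => ∑ b, a i b θ * x b‖

variable {Θ : Set (Fin 2 → ℝ)} {c : ℝ} {a : Fin 2 → Fin 2 → (Fin 2 → ℝ) → ℝ}
  {ξ : Fin 2 → (Fin 2 → ℝ) → ℝ} {ψ : Fin 2 → ℝ} {S : ℝ}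

/-- Smallness is known only at one point and is transported by the bounded derivative of the next
order. Three bounded orders therefore give control of two. -/
lemma RegularSystem.abs_partials_ξ_le (h : RegularSystem Θ c a ξ) (hΘconv : Convex ℝ Θ)
    (hΘpos : Θ ⊆ paramSpace) (hψ : ψ ∈ Θ) {r : ℝ} {θ : Fin 2 → ℝ} (hθ : θ ∈ Θ)
    (hr : ‖θ - ψ‖ ≤ r) (i : Fin 2) {l : List (Fin 2)} (hl : l.length ≤ 2)
    (hS : |partials l (ξ i) ψ| ≤ S) : |partials l (ξ i) θ| ≤ S + 2 * c * r := by
  have hc : 0 ≤ c := (abs_nonneg _).trans (h.bound_a 0 0 [] (by simp) ψ hψ)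
  have hsm : ContDiffOn ℝ (1 : ℕ) (partials l (ξ i)) paramSpace :=
    contDiffOn_partials l ((h.smooth_ξ i).of_le (by
      have : 1 + l.length ≤ 3 := by omega
      exact_mod_cast this))
  have h1 := abs_sub_le_of_partialDeriv_le hsm hΘconv hΘpos
    (fun η hη b => h.bound_ξ i (b :: l) (Nat.succ_le_succ hl) η hη) hθ hψ
  have h2 : 2 * c * ‖θ - ψ‖ ≤ 2 * c * r := by gcongr
  have h3 := abs_sub_abs_le_abs_sub (partials l (ξ i) θ) (partials l (ξ i) ψ)
  linarith

/-- Existence of a root when the data are small. -/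
lemma RegularSystem.exists_isRoot (h : RegularSystem Θ c a ξ) (hc : 1 ≤ c)
    (hΘconv : Convex ℝ Θ) (hΘpos : Θ ⊆ paramSpace) {g : Matrix (Fin 2) (Fin 2) ℝ}
    (hg : g * Matrix.of (fun i b => a i b ψ) = 1) {r : ℝ} (hr : 0 < r)
    (hrΘ : Metric.closedBall ψ r ⊆ Θ) (hrc : r ≤ 1 / (48 * c ^ 2))
    (hS : ∀ i, ∀ l : List (Fin 2), l.length ≤ 2 → |partials l (ξ i) ψ| ≤ S)
    (hS1 : S ≤ 1 / (8 * c)) (hS2 : S ≤ r / (2 * c)) : ∃ θ ∈ Θ, IsRoot a ξ ψ θ := by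
  have hψ : ψ ∈ Θ := hrΘ (Metric.mem_closedBall_self hr.le)
  have hc0 : 0 < c := by linarith
  have hS0 : 0 ≤ S := (abs_nonneg _).trans (hS 0 [] (by simp))
  set aψ : Matrix (Fin 2) (Fin 2) ℝ := Matrix.of fun i b => a i b ψ with haψ
  have hg' : aψ * g = 1 := mul_eq_one_comm.1 hg
  set f : (Fin 2 → ℝ) → (Fin 2 → ℝ) := fun θ i => ξ i θ - ∑ b, a i b θ * (θ b - ψ b) with hf
  set f' : (Fin 2 → ℝ) →L[ℝ] (Fin 2 → ℝ) := -(LinearMap.toContinuousLinearMap aψ.mulVecLin)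
    with hf'
  have hf'apply : ∀ x i, f' x i = -∑ b, a i b ψ * x b := by
    intro x i
    rfl
  -- The variation of `ξ` contributes `2S + 4cr`; the deviation of `a(θ)(θ - ψ)` from its
  -- linearization contributes `4cr` twice.
  set k : ℝ := 2 * S + 12 * c * r with hk
  have hk0 : 0 ≤ k := by positivity
  have hkc : k ≤ 1 / (2 * c) := by
    have h1 : 12 * c * r ≤ 12 * c * (1 / (48 * c ^ 2)) := by gcongr
    have h2 : 12 * c * (1 / (48 * c ^ 2)) = 1 / (4 * c) := by field_simp; norm_num
    have h3 : 2 * (1 / (8 * c)) = 1 / (4 * c) := by field_simp; norm_num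
    have h4 : 1 / (4 * c) + 1 / (4 * c) = 1 / (2 * c) := by field_simp; norm_num
    linarith
  have happrox : ApproximatesLinearOn f f' (Metric.closedBall ψ r) ⟨k, hk0⟩ := by
    intro x hx y hy
    change _ ≤ k * ‖x - y‖
    rw [pi_norm_le_iff_of_nonneg (by positivity)]
    intro i
    have hxr : ‖x - ψ‖ ≤ r := by simpa [dist_eq_norm] using hx
    have hyr : ‖y - ψ‖ ≤ r := by simpa [dist_eq_norm] using hy
    have h1 : |ξ i x - ξ i y| ≤ 2 * (S + 2 * c * r) * ‖x - y‖ :=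
      abs_sub_le_of_partialDeriv_le ((h.smooth_ξ i).of_le (by norm_num)) (convex_closedBall ψ r)
        (hrΘ.trans hΘpos) (fun η hη b => h.abs_partials_ξ_le hΘconv hΘpos hψ (hrΘ hη)
          (by simpa [dist_eq_norm] using hη) i (l := [b]) (by simp) (hS i [b] (by simp))) hx hy
    have ha : ∀ b, ∀ x ∈ Metric.closedBall ψ r, ∀ y ∈ Metric.closedBall ψ r,
        |a i b x - a i b y| ≤ 2 * c * ‖x - y‖ := fun b x hx y hy =>
      abs_sub_le_of_partialDeriv_le ((h.smooth_a i b).of_le (by norm_num)) hΘconv hΘpos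
        (fun η hη d => h.bound_a i b [d] (by simp) η hη) (hrΘ hx) (hrΘ hy)
    have h2 : |∑ b, (a i b x - a i b ψ) * (x - y) b| ≤ 2 * (2 * c * r * ‖x - y‖) := by
      refine abs_sum_mul_le (fun b => ?_) (abs_apply_le_norm _)
      exact (ha b x hx ψ (Metric.mem_closedBall_self hr.le)).trans (by gcongr)
    have h3 : |∑ b, (a i b x - a i b y) * (y - ψ) b| ≤ 2 * (2 * c * ‖x - y‖ * r) :=
      abs_sum_mul_le (fun b => ha b x hx y hy) fun b => (abs_apply_le_norm _ b).trans hyr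
    have e : (f x - f y - f' (x - y)) i = (ξ i x - ξ i y)
        - ∑ b, (a i b x - a i b ψ) * (x - y) b - ∑ b, (a i b x - a i b y) * (y - ψ) b := by
      simp only [Pi.sub_apply, hf'apply, hf, Fin.sum_univ_two]
      ring
    rw [e, Real.norm_eq_abs]
    rw [abs_le] at h1 h2 h3 ⊢
    have e2 : k * ‖x - y‖ = 2 * (S + 2 * c * r) * ‖x - y‖ + 2 * (2 * c * r * ‖x - y‖)
        + 2 * (2 * c * ‖x - y‖ * r) := by rw [hk]; ring
    rw [e2]
    constructor <;> linarith [h1.1, h1.2, h2.1, h2.2, h3.1, h3.2]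
  let F : f'.NonlinearRightInverse :=
    { toFun := fun y => -(g *ᵥ y)
      nnnorm := ⟨c, hc0.le⟩
      bound' := fun y => by
        change ‖-(g *ᵥ y)‖ ≤ c * ‖y‖
        rw [norm_neg]
        have := h.coercive ψ hψ (g *ᵥ y)
        have e : (fun i => ∑ b, a i b ψ * (g *ᵥ y) b) = y := by
          have : aψ *ᵥ (g *ᵥ y) = y := by rw [Matrix.mulVec_mulVec, hg', Matrix.one_mulVec]
          exact this
        rwa [e] at this
      right_inv' := fun y => by
        have : aψ *ᵥ (g *ᵥ y) = y := by rw [Matrix.mulVec_mulVec, hg', Matrix.one_mulVec]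
        change -(aψ *ᵥ -(g *ᵥ y)) = y
        rw [Matrix.mulVec_neg, neg_neg, this] }
  -- Quantitative open mapping: the image of the ball contains the ball of radius `(c⁻¹ - k) r ≥ r /
  -- (2c)` about `f ψ = ξ(ψ)`, and hence contains zero.
  have hsurj := happrox.surjOn_closedBall_of_nonlinearRightInverse F hr.le subset_rfl
  have hmem : (0 : Fin 2 → ℝ) ∈ Metric.closedBall (f ψ)
      (((F.nnnorm : ℝ)⁻¹ - (⟨k, hk0⟩ : NNReal)) * r) := by
    rw [Metric.mem_closedBall, dist_eq_norm, zero_sub, norm_neg]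
    have h1 : ‖f ψ‖ ≤ S := by
      rw [pi_norm_le_iff_of_nonneg hS0]
      intro i
      simpa [hf, partials] using hS i [] (by simp)
    refine h1.trans (hS2.trans ?_)
    change r / (2 * c) ≤ (c⁻¹ - k) * r
    have h3 : c⁻¹ - k ≥ 1 / (2 * c) := by
      have : c⁻¹ = 1 / (2 * c) + 1 / (2 * c) := by field_simp; norm_num
      linarith
    calc r / (2 * c) = 1 / (2 * c) * r := by ring
      _ ≤ _ := by gcongr
  obtain ⟨θ, hθ, hθ0⟩ := hsurj hmem
  refine ⟨θ, hrΘ hθ, fun i => ?_⟩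
  have := congrFun hθ0 i
  simp only [hf, Pi.zero_apply] at this
  linarith

lemma RegularSystem.norm_sub_le_of_isRoot (h : RegularSystem Θ c a ξ) {θ : Fin 2 → ℝ}
    (hθ : θ ∈ Θ) (hroot : IsRoot a ξ ψ θ) : ‖θ - ψ‖ ≤ c * ‖fun i => ξ i θ‖ := by
  have := h.coercive θ hθ (θ - ψ)
  have e : (fun i => ∑ b, a i b θ * (θ - ψ) b) = fun i => ξ i θ := funext fun i => hroot i
  rwa [e] at this

/-- Every root is close to `ψ` when the data are small on a fine net. -/
lemma RegularSystem.norm_sub_le (h : RegularSystem Θ c a ξ) (hc : 1 ≤ c)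
    (hΘconv : Convex ℝ Θ) (hΘpos : Θ ⊆ paramSpace) (hψ : ψ ∈ Θ) {T : Set (Fin 2 → ℝ)}
    (hTΘ : T ⊆ Θ) (hψT : ψ ∈ T) (hT : ∀ θ ∈ Θ, ∃ τ ∈ T, ‖θ - τ‖ ≤ 1 / (64 * c ^ 4))
    (hS : ∀ i, ∀ l : List (Fin 2), l.length ≤ 2 → ∀ τ ∈ T, |partials l (ξ i) τ| ≤ S)
    (hS1 : S ≤ 1 / (32 * c ^ 3)) {θ : Fin 2 → ℝ} (hθ : θ ∈ Θ) (hroot : IsRoot a ξ ψ θ) :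
    ‖θ - ψ‖ ≤ 2 * c * S := by
  have hc0 : 0 < c := by linarith
  have hS0 : 0 ≤ S := (abs_nonneg _).trans (hS 0 [] (by simp) ψ hψT)
  have hroot' := h.norm_sub_le_of_isRoot hθ hroot
  set d := ‖θ - ψ‖ with hd
  have hd0 : 0 ≤ d := norm_nonneg _
  -- Coercivity bounds `d` by `c ‖ξ(θ)‖`, and `ξ(θ)` is compared with its value at a net point. The
  -- mesh and the bound on `S` contribute `1 / (32 c²)` each.
  have hcoarse : d ≤ 1 / (16 * c ^ 2) := by
    obtain ⟨τ, hτ, hθτ⟩ := hT θ hθ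
    have h1 : ‖fun i => ξ i θ‖ ≤ S + 2 * c * (1 / (64 * c ^ 4)) := by
      rw [pi_norm_le_iff_of_nonneg (by positivity)]
      intro i
      exact h.abs_partials_ξ_le hΘconv hΘpos (hTΘ hτ) hθ hθτ i (l := []) (by simp)
        (hS i [] (by simp) τ hτ)
    have h2 : c * (S + 2 * c * (1 / (64 * c ^ 4)))
        ≤ c * (1 / (32 * c ^ 3) + 2 * c * (1 / (64 * c ^ 4))) := by gcongr
    have h3 : c * (1 / (32 * c ^ 3) + 2 * c * (1 / (64 * c ^ 4))) = 1 / (16 * c ^ 2) := by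
      field_simp
      norm_num
    calc d ≤ c * ‖fun i => ξ i θ‖ := hroot'
      _ ≤ c * (S + 2 * c * (1 / (64 * c ^ 4))) := by gcongr
      _ ≤ _ := h2.trans h3.le
  -- Now `ξ(θ)` is compared with `ξ(ψ)` through a gradient of size at most `S + 2cd`. By the coarse
  -- bound, the term proportional to `d` is at most `d / 2` after multiplication by `c` and can be
  -- absorbed.
  have hfine : ‖fun i => ξ i θ‖ ≤ S + 2 * (S + 2 * c * d) * d := by
    rw [pi_norm_le_iff_of_nonneg (by positivity)]
    intro i
    have h1 : |ξ i θ - ξ i ψ| ≤ 2 * (S + 2 * c * d) * ‖θ - ψ‖ := by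
      refine abs_sub_le_of_partialDeriv_le (s := Θ ∩ Metric.closedBall ψ d)
        ((h.smooth_ξ i).of_le (by norm_num)) (hΘconv.inter (convex_closedBall _ _))
        (Set.inter_subset_left.trans hΘpos) (fun η hη b => ?_)
        ⟨hθ, by simp [dist_eq_norm, hd]⟩ ⟨hψ, by simp [hd0]⟩
      exact h.abs_partials_ξ_le hΘconv hΘpos hψ hη.1 (by simpa [dist_eq_norm] using hη.2) i
        (l := [b]) (by simp) (hS i [b] (by simp) ψ hψT)
    have h2 := hS i [] (by simp) ψ hψT
    have h3 := abs_sub_abs_le_abs_sub (ξ i θ) (ξ i ψ)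
    simp only [partials] at h2
    rw [Real.norm_eq_abs]
    linarith
  have h1 : d ≤ c * (S + 2 * (S + 2 * c * d) * d) := hroot'.trans (by gcongr)
  have h2 : c * (2 * (S + 2 * c * d)) ≤ 1 / 2 := by
    have e1 : S ≤ 1 / (8 * c) := by
      refine hS1.trans ?_
      gcongr
      · norm_num
      · calc c = c ^ 1 := (pow_one c).symm
          _ ≤ c ^ 3 := pow_le_pow_right₀ hc (by norm_num)
    have e2 : c * (2 * (S + 2 * c * d))
        ≤ c * (2 * (1 / (8 * c) + 2 * c * (1 / (16 * c ^ 2)))) := by gcongr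
    have e3 : c * (2 * (1 / (8 * c) + 2 * c * (1 / (16 * c ^ 2)))) = 1 / 2 := by
      field_simp
      norm_num
    linarith
  have h3 : c * (2 * (S + 2 * c * d)) * d ≤ 1 / 2 * d := by gcongr
  nlinarith

/-- The leading term `g ξ(ψ)` of the root. -/
def rootLin (g : Matrix (Fin 2) (Fin 2) ℝ) (ξ : Fin 2 → (Fin 2 → ℝ) → ℝ) (ψ : Fin 2 → ℝ)
    (j : Fin 2) : ℝ := ∑ i, g j i * ξ i ψ

/-- The second-order term of the root. -/
noncomputable def rootQuad (g : Matrix (Fin 2) (Fin 2) ℝ) (a : Fin 2 → Fin 2 → (Fin 2 → ℝ) → ℝ)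
    (ξ : Fin 2 → (Fin 2 → ℝ) → ℝ) (ψ : Fin 2 → ℝ) (j : Fin 2) : ℝ :=
  ∑ i, g j i * (∑ b, partialDeriv b (ξ i) ψ * rootLin g ξ ψ b
    - ∑ b, (∑ d, partialDeriv d (a i b) ψ * rootLin g ξ ψ d) * rootLin g ξ ψ b)

lemma abs_rootLin_le {g : Matrix (Fin 2) (Fin 2) ℝ} (hg : ∀ i j, |g i j| ≤ c)
    (hS : ∀ i, |ξ i ψ| ≤ S) (j : Fin 2) : |rootLin g ξ ψ j| ≤ 2 * c * S :=
  (abs_sum_mul_le (hg j) hS).trans (le_of_eq (by ring))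

lemma abs_rootQuad_le {g : Matrix (Fin 2) (Fin 2) ℝ} (hg : ∀ i j, |g i j| ≤ c)
    (hS : ∀ i, |ξ i ψ| ≤ S) (hS' : ∀ i b, |partialDeriv b (ξ i) ψ| ≤ S)
    (ha : ∀ i b d, |partialDeriv d (a i b) ψ| ≤ c) (j : Fin 2) :
    |rootQuad g a ξ ψ j| ≤ (8 * c ^ 2 + 32 * c ^ 4) * S ^ 2 := by
  have hl := abs_rootLin_le hg hS
  refine (abs_sum_mul_le (X := c) (Y := 4 * c * S ^ 2 + 16 * c ^ 3 * S ^ 2) (hg j)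
    fun i => ?_).trans (le_of_eq (by ring))
  have h1 := abs_sum_mul_le (hS' i) hl
  have h2 := abs_sum_mul_le (fun b => abs_sum_mul_le (ha i b) hl) hl
  refine (abs_sub _ _).trans ((add_le_add h1 h2).trans (le_of_eq (by ring)))

/-- The constants of the second-order expansion of the root. -/
def expansionConst (c : ℝ) : ℝ := 2 * c * (6 + 20 * c)

/-- The second-order expansion of a root. -/
lemma RegularSystem.expansion (h : RegularSystem Θ c a ξ) (hc : 1 ≤ c)
    (hΘconv : Convex ℝ Θ) (hΘpos : Θ ⊆ paramSpace) (hψ : ψ ∈ Θ)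
    {g : Matrix (Fin 2) (Fin 2) ℝ} (hg : g * Matrix.of (fun i b => a i b ψ) = 1)
    (hgc : ∀ i j, |g i j| ≤ c)
    (hS : ∀ i, ∀ l : List (Fin 2), l.length ≤ 2 → |partials l (ξ i) ψ| ≤ S) (hS1 : S ≤ 1)
    {θ : Fin 2 → ℝ} (hθ : θ ∈ Θ) (hroot : IsRoot a ξ ψ θ) (hθS : ‖θ - ψ‖ ≤ S) :
    (∀ j, |θ j - ψ j - rootLin g ξ ψ j| ≤ expansionConst c * S ^ 2) ∧
    ∀ j, |θ j - ψ j - rootLin g ξ ψ j - rootQuad g a ξ ψ j|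
      ≤ 2 * c * (4 + 16 * c + 2 * expansionConst c
        + 4 * c * (1 + 2 * c) * expansionConst c) * S ^ 3 := by
  have hc0 : 0 < c := by linarith
  have hS0 : 0 ≤ S := (norm_nonneg _).trans hθS
  set K := expansionConst c with hK
  have hK0 : 0 ≤ K := by rw [hK, expansionConst]; positivity
  set δ : Fin 2 → ℝ := fun b => θ b - ψ b with hδ
  have hδS : ∀ b, |δ b| ≤ S := fun b => (abs_apply_le_norm (θ - ψ) b).trans hθS
  have hξ' : ∀ i b, |partialDeriv b (ξ i) ψ| ≤ S := fun i b => hS i [b] (by simp)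
  have ha' : ∀ i b d, |partialDeriv d (a i b) ψ| ≤ c := fun i b d =>
    h.bound_a i b [d] (by simp) ψ hψ
  set R : Fin 2 → ℝ := fun i => ξ i θ - ξ i ψ - ∑ b, δ b * partialDeriv b (ξ i) ψ with hR
  have hRb : ∀ i, |R i| ≤ (4 + 8 * c) * S ^ 3 := by
    intro i
    have h1 : |R i| ≤ 4 * (S + 2 * c * S) * ‖θ - ψ‖ ^ 2 := by
      refine abs_sub_sub_le_of_partialDeriv_le (s := Θ ∩ Metric.closedBall ψ S)
        ((h.smooth_ξ i).of_le (by norm_num)) (hΘconv.inter (convex_closedBall _ _))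
        (Set.inter_subset_left.trans hΘpos) (fun η hη b d => ?_)
        ⟨hθ, by simpa [dist_eq_norm] using hθS⟩ ⟨hψ, by simp [hS0]⟩
      exact h.abs_partials_ξ_le hΘconv hΘpos hψ hη.1 (by simpa [dist_eq_norm] using hη.2) i
        (l := [d, b]) (by simp) (hS i [d, b] (by simp))
    calc |R i| ≤ 4 * (S + 2 * c * S) * ‖θ - ψ‖ ^ 2 := h1
      _ ≤ 4 * (S + 2 * c * S) * S ^ 2 := by gcongr
      _ = _ := by ring
  set U : Fin 2 → Fin 2 → ℝ := fun i b =>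
    a i b θ - a i b ψ - ∑ d, δ d * partialDeriv d (a i b) ψ with hU
  have hUb : ∀ i b, |U i b| ≤ 4 * c * S ^ 2 := by
    intro i b
    have h1 : |U i b| ≤ 4 * c * ‖θ - ψ‖ ^ 2 :=
      abs_sub_sub_le_of_partialDeriv_le ((h.smooth_a i b).of_le (by norm_num)) hΘconv hΘpos
        (fun η hη d e => h.bound_a i b [e, d] (by simp) η hη) hθ hψ
    exact h1.trans (by gcongr)
  -- The defect of the linearized equation `a(ψ) δ = ξ(ψ)`. Taylor expansion shows it to be
  -- quadratic in `S` up to a cubic error, and `S ≤ 1` lets that error be included in the quadratic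
  -- bound.
  set e : Fin 2 → ℝ := fun i => ∑ b, a i b ψ * δ b - ξ i ψ with he
  have heq : ∀ i, e i = ∑ b, partialDeriv b (ξ i) ψ * δ b
      - ∑ b, (∑ d, partialDeriv d (a i b) ψ * δ d) * δ b + (R i - ∑ b, U i b * δ b) := by
    intro i
    have h1 := hroot i
    simp only [Fin.sum_univ_two, he, hR, hU, hδ] at h1 ⊢
    linear_combination h1
  have hrem : ∀ i, |R i - ∑ b, U i b * δ b| ≤ (4 + 16 * c) * S ^ 3 := by
    intro i
    have h1 := abs_sum_mul_le (hUb i) hδS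
    refine (abs_sub _ _).trans ((add_le_add (hRb i) h1).trans (le_of_eq (by ring)))
  have heb : ∀ i, |e i| ≤ (6 + 20 * c) * S ^ 2 := by
    intro i
    have h1 := abs_sum_mul_le (hξ' i) hδS
    have h2 := abs_sum_mul_le (fun b => abs_sum_mul_le (ha' i b) hδS) hδS
    have h3 := hrem i
    have h4 : (4 + 16 * c) * S ^ 3 ≤ (4 + 16 * c) * S ^ 2 := by
      have : S ^ 3 ≤ S ^ 2 := pow_le_pow_of_le_one hS0 hS1 (by norm_num)
      gcongr
    rw [heq]
    refine (abs_add_le _ _).trans ((add_le_add ((abs_sub _ _).trans (add_le_add h1 h2)) h3).trans ?_)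
    nlinarith
  have hδeq : ∀ j, δ j - rootLin g ξ ψ j = ∑ i, g j i * e i := by
    intro j
    have h1 : g *ᵥ (Matrix.of (fun i b => a i b ψ) *ᵥ δ) = δ := by
      rw [Matrix.mulVec_mulVec, hg, Matrix.one_mulVec]
    have h2 := congrFun h1 j
    simp only [Matrix.mulVec, dotProduct, Matrix.of_apply] at h2
    simp only [he, rootLin, mul_sub, Finset.sum_sub_distrib]
    rw [h2]
  have hρ : ∀ j, |δ j - rootLin g ξ ψ j| ≤ K * S ^ 2 := by
    intro j
    rw [hδeq]
    refine (abs_sum_mul_le (hgc j) heb).trans (le_of_eq ?_)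
    rw [hK, expansionConst]
    ring
  refine ⟨hρ, fun j => ?_⟩
  set lin := rootLin g ξ ψ with hlin
  have hlinb : ∀ j, |lin j| ≤ 2 * c * S := abs_rootLin_le hgc fun i => hS i [] (by simp)
  -- In the quadratic part of the defect, `δ` is replaced by `lin`. Each replacement costs a factor
  -- `O(S²)` and multiplies a term of order `S`, so the error is cubic.
  have hfin : δ j - lin j - rootQuad g a ξ ψ j
      = ∑ i, g j i * (∑ b, partialDeriv b (ξ i) ψ * (δ b - lin b)
        - (∑ b, (∑ d, partialDeriv d (a i b) ψ * (δ d - lin d)) * δ b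
          + ∑ b, (∑ d, partialDeriv d (a i b) ψ * lin d) * (δ b - lin b))
        + (R i - ∑ b, U i b * δ b)) := by
    rw [hδeq, rootQuad, ← hlin, ← Finset.sum_sub_distrib]
    refine Finset.sum_congr rfl fun i _ => ?_
    rw [← mul_sub, heq]
    congr 1
    simp only [Fin.sum_univ_two]
    ring
  have hbr : ∀ i, |∑ b, partialDeriv b (ξ i) ψ * (δ b - lin b)
        - (∑ b, (∑ d, partialDeriv d (a i b) ψ * (δ d - lin d)) * δ b
          + ∑ b, (∑ d, partialDeriv d (a i b) ψ * lin d) * (δ b - lin b))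
        + (R i - ∑ b, U i b * δ b)|
      ≤ (4 + 16 * c + 2 * K + 4 * c * (1 + 2 * c) * K) * S ^ 3 := by
    intro i
    have h1 := abs_sum_mul_le (hξ' i) hρ
    have h2 := abs_sum_mul_le (fun b => abs_sum_mul_le (ha' i b) hρ) hδS
    have h3 := abs_sum_mul_le (fun b => abs_sum_mul_le (ha' i b) hlinb) hρ
    refine (abs_add_le _ _).trans ((add_le_add ((abs_sub _ _).trans (add_le_add h1
      ((abs_add_le _ _).trans (add_le_add h2 h3)))) (hrem i)).trans (le_of_eq ?_))
    ring
  change |δ j - lin j - rootQuad g a ξ ψ j| ≤ _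
  rw [hfin]
  exact (abs_sum_mul_le (hgc j) hbr).trans (le_of_eq (by ring))

end Root

end NER

namespace NER

open scoped Matrix.Norms.L2Operator

/-! ### The weights `Qᵀ W Q` and the reduction of the estimating equations. -/

section Design

variable {m p : ℕ} {n : Fin m → ℕ}

/-- The regularity assumptions on a single design. -/
structure RegularDesign (Θ : Set (Fin 2 → ℝ)) (nmax : ℕ) (C : ℝ) (n : Fin m → ℕ)
    (X : Matrix (Obs n) (Fin p) ℝ) (L : (Fin 2 → ℝ) → Matrix (Fin p) (Obs n) ℝ)
    (W : Fin 2 → (Fin 2 → ℝ) → Matrix (Obs n) (Obs n) ℝ) : Prop where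
  pos : Θ ⊆ paramSpace
  size_le : ∀ i, n i ≤ nmax
  const_nonneg : 0 ≤ C
  unbiased : ∀ θ ∈ paramSpace, L θ * X = 1
  smooth_L : SmoothMat 3 L
  symm : ∀ a, ∀ θ ∈ paramSpace, (W a θ).IsSymm
  smooth_W : ∀ a, SmoothMat 3 (W a)
  bound_XL : ∀ l : List (Fin 2), l.length ≤ 3 → ∀ θ ∈ Θ, ∀ j k,
    |matPartials l (fun η => X * L η) θ j k| ≤ C / total n
  bound_W : ∀ a, ∀ l : List (Fin 2), l.length ≤ 3 → ∀ θ ∈ Θ, ∀ x : Obs n → ℝ,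
    |x ⬝ᵥ (matPartials l (W a) θ *ᵥ x)| ≤ C * (x ⬝ᵥ x)

/-- The difference between `Qᵀ W Q` and `W`, where `Q = I - X L`. -/
def corr (X : Matrix (Obs n) (Fin p) ℝ) (L : (Fin 2 → ℝ) → Matrix (Fin p) (Obs n) ℝ)
    (W : Fin 2 → (Fin 2 → ℝ) → Matrix (Obs n) (Obs n) ℝ) (a : Fin 2) (θ : Fin 2 → ℝ) :
    Matrix (Obs n) (Obs n) ℝ :=
  (X * L θ)ᵀ * W a θ * (X * L θ) + (-((X * L θ)ᵀ * W a θ) + -(W a θ * (X * L θ)))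

/-- The weight matrix `Qᵀ W Q`, where `Q = I - X L`. -/
def projWeight (X : Matrix (Obs n) (Fin p) ℝ) (L : (Fin 2 → ℝ) → Matrix (Fin p) (Obs n) ℝ)
    (W : Fin 2 → (Fin 2 → ℝ) → Matrix (Obs n) (Obs n) ℝ) (a : Fin 2) (θ : Fin 2 → ℝ) :
    Matrix (Obs n) (Obs n) ℝ := W a θ + corr X L W a θ

/-- The constant that bounds the derivatives of `corr`. -/
def corrConst (C : ℝ) : ℝ := 64 * C ^ 3 + 16 * C ^ 2

variable {Θ : Set (Fin 2 → ℝ)} {nmax : ℕ} {C : ℝ} {X : Matrix (Obs n) (Fin p) ℝ}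
  {L : (Fin 2 → ℝ) → Matrix (Fin p) (Obs n) ℝ}
  {W : Fin 2 → (Fin 2 → ℝ) → Matrix (Obs n) (Obs n) ℝ}

lemma projWeight_eq (a : Fin 2) (θ : Fin 2 → ℝ) :
    projWeight X L W a θ = (1 - X * L θ)ᵀ * W a θ * (1 - X * L θ) := by
  simp only [projWeight, corr, Matrix.transpose_sub, Matrix.transpose_one, Matrix.sub_mul,
    Matrix.mul_sub, Matrix.one_mul, Matrix.mul_one]
  abel

lemma corrConst_nonneg (hC : 0 ≤ C) : 0 ≤ corrConst C := by
  unfold corrConst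
  positivity

namespace RegularDesign

variable (h : RegularDesign Θ nmax C n X L W)
include h

lemma smooth_XL : SmoothMat 3 (fun θ => X * L θ) :=
  SmoothMat.mul (F := fun _ => X) (fun _ _ => contDiffOn_const) h.smooth_L

/-- There are `N²` entries, each of size at most `C / N`. -/
lemma frob_XL : BoundedPartials frob Θ 3 C (fun θ => X * L θ) := by
  intro l hl θ hθ
  refine frob_le_of_sq_le h.const_nonneg ?_
  have hC := h.const_nonneg
  have h1 : ∀ j k, matPartials l (fun η => X * L η) θ j k ^ 2 ≤ (C / total n) ^ 2 := fun j k =>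
    sq_le_sq' (abs_le.1 (h.bound_XL l hl θ hθ j k)).1 (abs_le.1 (h.bound_XL l hl θ hθ j k)).2
  calc _ ≤ ∑ _j : Obs n, ∑ _k : Obs n, (C / total n) ^ 2 :=
        Finset.sum_le_sum fun j _ => Finset.sum_le_sum fun k _ => h1 j k
    _ = total n * (total n * (C / total n) ^ 2) := by
        simp only [Finset.sum_const, Finset.card_univ, card_Obs, nsmul_eq_mul]
    _ ≤ C ^ 2 := by
        rcases (Nat.cast_nonneg (total n) : (0 : ℝ) ≤ total n).eq_or_lt with h0 | h0
        · rw [← h0]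
          simp [sq_nonneg]
        · apply le_of_eq
          field_simp

lemma norm_W (a : Fin 2) : BoundedPartials (fun A => ‖A‖) Θ 3 C (W a) := fun l hl θ hθ =>
  l2_opNorm_le_of_isSymm (matPartials_isSymm l (h.symm a) (h.pos hθ)) h.const_nonneg
    (h.bound_W a l hl θ hθ)

lemma smooth_corr (a : Fin 2) : SmoothMat 3 (corr X L W a) :=
  ((h.smooth_XL.transpose.mul (h.smooth_W a)).mul h.smooth_XL).add
    ((h.smooth_XL.transpose.mul (h.smooth_W a)).neg.add ((h.smooth_W a).mul h.smooth_XL).neg)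

/-- Every term has a factor `X L` of bounded Frobenius norm; the other factors are bounded in
spectral norm. -/
lemma frob_corr (a : Fin 2) : BoundedPartials frob Θ 3 (corrConst C) (corr X L W a) := by
  have hC := h.const_nonneg
  have hD := h.frob_XL
  have hDt : BoundedPartials frob Θ 3 C (fun θ => (X * L θ)ᵀ) := hD.transpose frob_transpose
  have hW := h.norm_W a
  have sD := h.smooth_XL
  have sDt := sD.transpose
  have sW := h.smooth_W a
  have b1 := BoundedPartials.mul (fun A => norm_nonneg A) frob_add_le frob_mul_le' h.pos hC hC
    sDt sW hDt hW
  have b2 := BoundedPartials.mul frob_nonneg frob_add_le frob_mul_le h.pos hC hC sW sD hW hD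
  have b3 := BoundedPartials.mul frob_nonneg frob_add_le (fun A B => (frob_mul_le A B).trans
    (mul_le_mul_of_nonneg_right (norm_le_frob A) (frob_nonneg B))) h.pos (by positivity) hC
    (sDt.mul sW) sD b1 hD
  have := b3.add frob_add_le h.pos ((sDt.mul sW).mul sD) ((sDt.mul sW).neg.add (sW.mul sD).neg)
    ((b1.neg frob_neg h.pos (sDt.mul sW)).add frob_add_le h.pos (sDt.mul sW).neg (sW.mul sD).neg
      (b2.neg frob_neg h.pos (sW.mul sD)))
  -- The triple product contributes `8 · 8 C³`, and each of the two double products `8 C²`.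
  refine this.mono (fun _ => le_rfl) le_rfl (le_of_eq ?_)
  unfold corrConst
  ring

lemma smooth_projWeight (a : Fin 2) : SmoothMat 3 (projWeight X L W a) :=
  (h.smooth_W a).add (h.smooth_corr a)

lemma matPartials_projWeight (a : Fin 2) {l : List (Fin 2)} (hl : l.length ≤ 3) {θ : Fin 2 → ℝ}
    (hθ : θ ∈ paramSpace) :
    matPartials l (projWeight X L W a) θ
      = matPartials l (W a) θ + matPartials l (corr X L W a) θ :=
  matPartials_add l ((h.smooth_W a).of_le hl) ((h.smooth_corr a).of_le hl) hθ

lemma norm_projWeight (a : Fin 2) :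
    BoundedPartials (fun A => ‖A‖) Θ 3 (C + corrConst C) (projWeight X L W a) :=
  (h.norm_W a).add norm_add_le h.pos (h.smooth_W a) (h.smooth_corr a)
    ((h.frob_corr a).mono norm_le_frob le_rfl le_rfl)

lemma isSymm_projWeight (a : Fin 2) (l : List (Fin 2)) {θ : Fin 2 → ℝ} (hθ : θ ∈ paramSpace) :
    (matPartials l (projWeight X L W a) θ).IsSymm :=
  matPartials_isSymm l (fun η hη => by
    rw [projWeight_eq]
    exact isSymm_conj (h.symm a η hη) _) hθ

end RegularDesign

/-- The functional `C ↦ (xᵀ C x - tr (C Σ(ψ))) / N`. -/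
noncomputable def quadFunctional (ψ : Fin 2 → ℝ) (x : Obs n → ℝ) :
    Matrix (Obs n) (Obs n) ℝ →ₗ[ℝ] ℝ where
  toFun C := centredQuad ψ C x / total n
  map_add' C D := by
    simp only [centredQuad, Matrix.add_mulVec, dotProduct_add, Matrix.add_mul, Matrix.trace_add]
    ring
  map_smul' r C := by
    simp only [centredQuad, Matrix.smul_mulVec, dotProduct_smul, Matrix.smul_mul,
      Matrix.trace_smul, smul_eq_mul, RingHom.id_apply]
    ring

/-- The functional `C ↦ tr (C Σ_(b)) / N`. -/
noncomputable def traceFunctional (n : Fin m → ℕ) (b : Fin 2) :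
    Matrix (Obs n) (Obs n) ℝ →ₗ[ℝ] ℝ where
  toFun C := (C * dSig n b).trace / total n
  map_add' C D := by
    simp only [Matrix.add_mul, Matrix.trace_add]
    ring
  map_smul' r C := by
    simp only [Matrix.smul_mul, Matrix.trace_smul, smul_eq_mul, RingHom.id_apply]
    ring

lemma frob_le_sqrt_total_mul (A : Matrix (Obs n) (Obs n) ℝ) : frob A ≤ √(total n) * ‖A‖ := by
  have := frob_le_sqrt_card_mul A
  rwa [card_Obs] at this

lemma abs_trace_mul_le_frob (A B : Matrix (Obs n) (Obs n) ℝ) :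
    |(A * B).trace| ≤ √(total n) * (frob A * ‖B‖) := by
  refine (abs_trace_mul_le A B).trans ?_
  have := mul_le_mul_of_nonneg_left (frob_le_sqrt_total_mul B) (frob_nonneg A)
  linarith

lemma abs_trace_mul_le_norm (A B : Matrix (Obs n) (Obs n) ℝ) :
    |(A * B).trace| ≤ total n * (‖A‖ * ‖B‖) := by
  refine (abs_trace_mul_le_frob A B).trans ?_
  have h1 : frob A * ‖B‖ ≤ √(total n) * ‖A‖ * ‖B‖ :=
    mul_le_mul_of_nonneg_right (frob_le_sqrt_total_mul A) (norm_nonneg _)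
  calc √(total n) * (frob A * ‖B‖) ≤ √(total n) * (√(total n) * ‖A‖ * ‖B‖) :=
        mul_le_mul_of_nonneg_left h1 (Real.sqrt_nonneg _)
    _ = (√(total n) * √(total n)) * (‖A‖ * ‖B‖) := by ring
    _ = _ := by rw [Real.mul_self_sqrt (Nat.cast_nonneg _)]

lemma abs_traceFunctional_le (hn : ∀ i, n i ≤ nmax) (hN : 0 < total n) (b : Fin 2)
    (A : Matrix (Obs n) (Obs n) ℝ) : |traceFunctional n b A| ≤ (nmax + 1) * ‖A‖ := by
  have hN' : (0 : ℝ) < total n := by exact_mod_cast hN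
  change |(A * dSig n b).trace / total n| ≤ _
  rw [abs_div, abs_of_pos hN', div_le_iff₀ hN']
  refine (abs_trace_mul_le_norm _ _).trans ?_
  have h1 := norm_dSig_le hn b
  have h2 : ‖A‖ * ‖dSig n b‖ ≤ ‖A‖ * (nmax + 1) := by gcongr
  calc (total n : ℝ) * (‖A‖ * ‖dSig n b‖) ≤ total n * (‖A‖ * (nmax + 1)) := by gcongr
    _ = _ := by ring

/-- For matrices of bounded Frobenius norm this gains `N^{-1/2}` over the spectral bound, since
`Σ_(b)` has Frobenius norm `O(√N)`. -/
lemma abs_traceFunctional_le_frob (hn : ∀ i, n i ≤ nmax) (hN : 0 < total n) (b : Fin 2)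
    (A : Matrix (Obs n) (Obs n) ℝ) :
    |traceFunctional n b A| ≤ (nmax + 1) * frob A / √(total n) := by
  have hN' : (0 : ℝ) < total n := by exact_mod_cast hN
  change |(A * dSig n b).trace / total n| ≤ _
  rw [abs_div, abs_of_pos hN', div_le_div_iff₀ hN' (Real.sqrt_pos.2 hN')]
  have h0 := frob_nonneg A
  have h1 := norm_dSig_le hn b
  have h2 : frob A * ‖dSig n b‖ ≤ frob A * (nmax + 1) := by gcongr
  calc _ ≤ √(total n) * (frob A * ‖dSig n b‖) * √(total n) :=
        mul_le_mul_of_nonneg_right (abs_trace_mul_le_frob _ _) (Real.sqrt_nonneg _)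
    _ = (√(total n) * √(total n)) * (frob A * ‖dSig n b‖) := by ring
    _ = total n * (frob A * ‖dSig n b‖) := by rw [Real.mul_self_sqrt hN'.le]
    _ ≤ total n * (frob A * (nmax + 1)) := by gcongr
    _ = _ := by ring

/-- A bound for the spectral norm of `Σ(ψ)`. -/
def sigConst (ψ : Fin 2 → ℝ) (nmax : ℕ) : ℝ := |ψ 0| * nmax + |ψ 1|

lemma sigConst_nonneg (ψ : Fin 2 → ℝ) (nmax : ℕ) : 0 ≤ sigConst ψ nmax := by
  unfold sigConst
  positivity

/-- The quadratic form is at most `‖A‖` times `x ⬝ᵥ x`, and `x ⬝ᵥ x / N` is recovered from the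
functional at the identity. Controlling this single random number thus controls all weight matrices
at once. -/
lemma abs_quadFunctional_le (hn : ∀ i, n i ≤ nmax) (hN : 0 < total n) (ψ : Fin 2 → ℝ)
    (x : Obs n → ℝ) (A : Matrix (Obs n) (Obs n) ℝ) :
    |quadFunctional ψ x A| ≤ ‖A‖ * (|quadFunctional ψ x 1| + 2 * sigConst ψ nmax) := by
  have hN' : (0 : ℝ) < total n := by exact_mod_cast hN
  have hS : ‖Sig n ψ‖ ≤ sigConst ψ nmax := norm_Sig_le hn ψ
  have h1 : ∀ A : Matrix (Obs n) (Obs n) ℝ,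
      |(A * Sig n ψ).trace / total n| ≤ ‖A‖ * sigConst ψ nmax := by
    intro A
    rw [abs_div, abs_of_pos hN', div_le_iff₀ hN']
    refine (abs_trace_mul_le_norm _ _).trans ?_
    have : ‖A‖ * ‖Sig n ψ‖ ≤ ‖A‖ * sigConst ψ nmax := by gcongr
    nlinarith
  have h2 : ∀ A : Matrix (Obs n) (Obs n) ℝ, quadFunctional ψ x A
      = (x ⬝ᵥ A *ᵥ x) / total n - (A * Sig n ψ).trace / total n := fun A => sub_div _ _ _
  have h3 : |(x ⬝ᵥ A *ᵥ x) / total n| ≤ ‖A‖ * ((x ⬝ᵥ x) / total n) := by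
    rw [abs_div, abs_of_pos hN', ← mul_div_assoc]
    gcongr
    exact dotProduct_mulVec_le A x
  have h4 : (x ⬝ᵥ x) / total n ≤ |quadFunctional ψ x 1| + sigConst ψ nmax := by
    have e := h2 1
    rw [Matrix.one_mulVec] at e
    have h5 := le_abs_self (quadFunctional ψ x 1)
    have h6 := (abs_le.1 (h1 1)).2
    have h7 : ‖(1 : Matrix (Obs n) (Obs n) ℝ)‖ * sigConst ψ nmax ≤ 1 * sigConst ψ nmax :=
      mul_le_mul_of_nonneg_right norm_one_le (sigConst_nonneg _ _)
    linarith
  rw [h2]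
  refine (abs_sub _ _).trans ((add_le_add h3 (h1 A)).trans ?_)
  have := mul_le_mul_of_nonneg_left h4 (norm_nonneg A)
  linarith

/-- The coefficients `tr (M_i(θ) Σ_(b)) / N` of the estimating equations. -/
noncomputable def coefA (X : Matrix (Obs n) (Fin p) ℝ)
    (L : (Fin 2 → ℝ) → Matrix (Fin p) (Obs n) ℝ)
    (W : Fin 2 → (Fin 2 → ℝ) → Matrix (Obs n) (Obs n) ℝ) (i b : Fin 2) (θ : Fin 2 → ℝ) : ℝ :=
  traceFunctional n b (projWeight X L W i θ)

/-- The fluctuations `(uᵀ M_i(θ) u - tr (M_i(θ) Σ(ψ))) / N` of the estimating equations. -/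
noncomputable def fluct (X : Matrix (Obs n) (Fin p) ℝ)
    (L : (Fin 2 → ℝ) → Matrix (Fin p) (Obs n) ℝ)
    (W : Fin 2 → (Fin 2 → ℝ) → Matrix (Obs n) (Obs n) ℝ) (ψ : Fin 2 → ℝ) (u : Obs n → ℝ)
    (i : Fin 2) (θ : Fin 2 → ℝ) : ℝ :=
  quadFunctional ψ u (projWeight X L W i θ)

namespace RegularDesign

variable (h : RegularDesign Θ nmax C n X L W)
include h

lemma partials_coefA (i b : Fin 2) {l : List (Fin 2)} (hl : l.length ≤ 3) {θ : Fin 2 → ℝ}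
    (hθ : θ ∈ paramSpace) :
    partials l (coefA X L W i b) θ
      = traceFunctional n b (matPartials l (projWeight X L W i) θ) :=
  matPartials_linearMap _ l ((h.smooth_projWeight i).of_le hl) hθ

lemma partials_fluct (ψ : Fin 2 → ℝ) (u : Obs n → ℝ) (i : Fin 2) {l : List (Fin 2)}
    (hl : l.length ≤ 3) {θ : Fin 2 → ℝ} (hθ : θ ∈ paramSpace) :
    partials l (fluct X L W ψ u i) θ
      = quadFunctional ψ u (matPartials l (projWeight X L W i) θ) :=
  matPartials_linearMap _ l ((h.smooth_projWeight i).of_le hl) hθ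

/-- The estimating equations in the form `a(θ) (θ - ψ) = ξ(θ)`. -/
lemma solves_iff (hN : 0 < total n) (ψ : Fin 2 → ℝ) (β : Fin p → ℝ) (v : Fin m → ℝ)
    (ε : Obs n → ℝ) {θ : Fin 2 → ℝ} (hθ : θ ∈ paramSpace) :
    Solves X L W (response X β v ε) θ
      ↔ IsRoot (coefA X L W) (fluct X L W ψ (Z n *ᵥ v + ε)) ψ θ := by
  have hN' : (total n : ℝ) ≠ 0 := by exact_mod_cast hN.ne'
  refine forall_congr' fun i => ?_
  set u := Z n *ᵥ v + ε with hu
  have hQX : (1 - X * L θ) *ᵥ (X *ᵥ β) = 0 := by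
    rw [Matrix.mulVec_mulVec, Matrix.sub_mul, Matrix.one_mul, Matrix.mul_assoc,
      h.unbiased θ hθ, Matrix.mul_one, sub_self, Matrix.zero_mulVec]
  have hy : (1 - X * L θ) *ᵥ response X β v ε = (1 - X * L θ) *ᵥ u := by
    rw [response, add_assoc, Matrix.mulVec_add, hQX, zero_add]
  have hquad : response X β v ε ⬝ᵥ (projWeight X L W i θ *ᵥ response X β v ε)
      = u ⬝ᵥ (projWeight X L W i θ *ᵥ u) := by
    have e : ∀ x : Obs n → ℝ, x ⬝ᵥ (projWeight X L W i θ *ᵥ x)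
        = ((1 - X * L θ) *ᵥ x) ⬝ᵥ (W i θ *ᵥ ((1 - X * L θ) *ᵥ x)) := by
      intro x
      rw [projWeight_eq, ← Matrix.mulVec_mulVec, ← Matrix.mulVec_mulVec, Matrix.dotProduct_mulVec,
        Matrix.vecMul_transpose]
    rw [e, e, hy]
  -- Linearity of `Σ` splits `tr(M Σ(θ))` into the centring `tr(M Σ(ψ))` and the terms `(θ b - ψ b)
  -- tr(M Σ_(b))`.
  have hest : estEq X L W (response X β v ε) θ i
      = total n * (fluct X L W ψ u i θ - ∑ b, coefA X L W i b θ * (θ b - ψ b)) := by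
    have e1 : estEq X L W (response X β v ε) θ i
        = u ⬝ᵥ (projWeight X L W i θ *ᵥ u) - (projWeight X L W i θ * Sig n θ).trace := by
      rw [← hquad, projWeight_eq]
      rfl
    have e2 : ∀ η : Fin 2 → ℝ, (projWeight X L W i θ * Sig n η).trace
        = ∑ b, η b * (projWeight X L W i θ * dSig n b).trace := by
      intro η
      simp [Sig_eq_sum, Matrix.mul_add, Fin.sum_univ_two]
    have e3 : total n * fluct X L W ψ u i θ
        = u ⬝ᵥ (projWeight X L W i θ *ᵥ u) - (projWeight X L W i θ * Sig n ψ).trace :=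
      mul_div_cancel₀ _ hN'
    have e4 : ∀ b, total n * coefA X L W i b θ = (projWeight X L W i θ * dSig n b).trace :=
      fun b => mul_div_cancel₀ _ hN'
    rw [mul_sub, e3, e1, e2, e2]
    simp only [Fin.sum_univ_two, ← e4]
    ring
  rw [hest]
  constructor
  · intro h0
    rcases mul_eq_zero.1 h0 with h1 | h1
    · exact absurd h1 hN'
    · linarith
  · intro h0
    rw [h0, sub_self, mul_zero]

end RegularDesign

end Design

end NER

namespace NER

open scoped Matrix.Norms.L2Operator

/-! ### An error bound for the expansion that holds on every outcome. -/

section RootBound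

/-- The index lists of the partial derivatives of order at most two. -/
noncomputable def shortLists : Finset (List (Fin 2)) := (List.finite_length_le (Fin 2) 2).toFinset

lemma mem_shortLists {l : List (Fin 2)} : l ∈ shortLists ↔ l.length ≤ 2 := by
  simp [shortLists]

variable {Θ : Set (Fin 2 → ℝ)} {c : ℝ} {ψ : Fin 2 → ℝ}

/-- The expansion of the root holds with the constant `K`, as soon as the data are controlled by
`S` on the finite set `T`. The bounds also hold when a root need not exist. -/
def ExpansionBound (Θ : Set (Fin 2 → ℝ)) (c : ℝ) (ψ : Fin 2 → ℝ) (T : Finset (Fin 2 → ℝ))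
    (K : ℝ) : Prop :=
  ∀ (a : Fin 2 → Fin 2 → (Fin 2 → ℝ) → ℝ) (ξ : Fin 2 → (Fin 2 → ℝ) → ℝ) (S : ℝ)
    (θ : Fin 2 → ℝ) (g : Matrix (Fin 2) (Fin 2) ℝ),
    (S ≤ 1 → RegularSystem Θ c a ξ) → g * Matrix.of (fun i b => a i b ψ) = 1 →
    (∀ i j, |g i j| ≤ c) → (∀ i b d, |partialDeriv d (a i b) ψ| ≤ c) →
    (∀ i, ∀ l ∈ shortLists, ∀ τ ∈ T, |partials l (ξ i) τ| ≤ S) →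
    ((∃ η ∈ Θ, IsRoot a ξ ψ η) → θ ∈ Θ ∧ IsRoot a ξ ψ θ) →
    (∀ j, |θ j - ψ j - (rootLin g ξ ψ j + rootQuad g a ξ ψ j)|
        ≤ K * (S ^ 3 * (1 + ‖θ - ψ‖ ^ 2))) ∧
      ∀ i j, |(θ i - ψ i) * (θ j - ψ j) - rootLin g ξ ψ i * rootLin g ξ ψ j|
        ≤ K * (S ^ 3 * (1 + ‖θ - ψ‖ ^ 2))

/-- For `S ≤ s₀` a root exists, so `θ` is a root and can be expanded. For `S > s₀` the quantities
`1`, `S` and `S²` are at most constant multiples of `S³`, and the factor `1 + ‖θ - ψ‖²` absorbs an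
arbitrary `θ`. -/
lemma exists_expansionBound (hΘc : IsCompact Θ) (hΘconv : Convex ℝ Θ) (hΘpos : Θ ⊆ paramSpace)
    (hψ : ψ ∈ interior Θ) (hc : 1 ≤ c) :
    ∃ T : Finset (Fin 2 → ℝ), ↑T ⊆ Θ ∧ ψ ∈ T ∧ ∃ K : ℝ, 0 ≤ K ∧ ExpansionBound Θ c ψ T K := by
  have hc0 : 0 < c := by linarith
  have hψΘ : ψ ∈ Θ := interior_subset hψ
  obtain ⟨r₀, hr₀, hr₀Θ⟩ := Metric.nhds_basis_closedBall.mem_iff.1 (mem_interior_iff_mem_nhds.1 hψ)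
  set r := min r₀ (1 / (48 * c ^ 2)) with hr
  have hr0 : 0 < r := lt_min hr₀ (by positivity)
  have hrΘ : Metric.closedBall ψ r ⊆ Θ :=
    (Metric.closedBall_subset_closedBall (min_le_left _ _)).trans hr₀Θ
  obtain ⟨T₀, hT₀Θ, hT₀fin, hT₀⟩ := hΘc.finite_cover_balls (e := 1 / (64 * c ^ 4)) (by positivity)
  have hTfin : (insert ψ T₀).Finite := hT₀fin.insert ψ
  -- The first two thresholds give existence of a root, the third its localization, and the last
  -- ensures `2 * c * S ≤ 1` in the expansion.
  set s₀ := min (min (1 / (8 * c)) (r / (2 * c))) (min (1 / (32 * c ^ 3)) (1 / (2 * c))) with hs₀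
  have hs₀0 : 0 < s₀ := lt_min (lt_min (by positivity) (by positivity))
    (lt_min (by positivity) (by positivity))
  -- The expansion is applied with `2 * c * S` in place of `S`, because its data bound must also
  -- bound the distance of the root from `ψ`.
  set k₁ := expansionConst c * (2 * c) ^ 2 with hk₁
  set k₂ := 2 * c * (4 + 16 * c + 2 * expansionConst c
        + 4 * c * (1 + 2 * c) * expansionConst c) * (2 * c) ^ 3 with hk₂
  have hexp0 : 0 ≤ expansionConst c := by unfold expansionConst; positivity
  have hk₁0 : 0 ≤ k₁ := by positivity
  have hk₂0 : 0 ≤ k₂ := by positivity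
  set q := 8 * c ^ 2 + 32 * c ^ 4 with hq
  have hq0 : 0 ≤ q := by positivity
  -- The first two summands serve the case `S ≤ s₀`, the bracket the case `S > s₀`.
  set K := k₂ + 4 * c * k₁ + (1 / s₀ ^ 3 + 2 * c / s₀ ^ 2 + (q + 4 * c ^ 2) / s₀) with hK
  refine ⟨hTfin.toFinset, ?_, by simp, K, by positivity, ?_⟩
  · rw [Set.Finite.coe_toFinset]
    exact Set.insert_subset hψΘ hT₀Θ
  intro a ξ S θ g hreg hg hgc ha hS hsol
  have hSψ : ∀ i, ∀ l : List (Fin 2), l.length ≤ 2 → |partials l (ξ i) ψ| ≤ S := fun i l hl =>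
    hS i l (mem_shortLists.2 hl) ψ (by simp)
  have hS0 : 0 ≤ S := (abs_nonneg _).trans (hSψ 0 [] (by simp))
  set d := ‖θ - ψ‖ with hd
  have hd0 : 0 ≤ d := norm_nonneg _
  have hδ : ∀ j, |θ j - ψ j| ≤ d := fun j => abs_apply_le_norm (θ - ψ) j
  have hlin : ∀ j, |rootLin g ξ ψ j| ≤ 2 * c * S :=
    abs_rootLin_le hgc fun i => hSψ i [] (by simp)
  have hquad : ∀ j, |rootQuad g a ξ ψ j| ≤ q * S ^ 2 :=
    abs_rootQuad_le hgc (fun i => hSψ i [] (by simp)) (fun i b => hSψ i [b] (by simp)) ha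
  have h1d : 1 ≤ 1 + d ^ 2 := by nlinarith
  have hS3 : 0 ≤ S ^ 3 := by positivity
  have hS3d : S ^ 3 ≤ S ^ 3 * (1 + d ^ 2) := le_mul_of_one_le_right hS3 h1d
  rcases le_or_gt S s₀ with hSs | hSs
  · have hSa : S ≤ 1 / (8 * c) := hSs.trans ((min_le_left _ _).trans (min_le_left _ _))
    have hSb : S ≤ r / (2 * c) := hSs.trans ((min_le_left _ _).trans (min_le_right _ _))
    have hSc : S ≤ 1 / (32 * c ^ 3) := hSs.trans ((min_le_right _ _).trans (min_le_left _ _))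
    have hSd : S ≤ 1 / (2 * c) := hSs.trans ((min_le_right _ _).trans (min_le_right _ _))
    have h2cS : 2 * c * S ≤ 1 := by
      rw [le_div_iff₀ (by positivity)] at hSd
      linarith
    have hS1 : S ≤ 1 := by nlinarith
    have hR := hreg hS1
    obtain ⟨hθ, hroot⟩ := hsol (hR.exists_isRoot hc hΘconv hΘpos hg hr0 hrΘ (min_le_right _ _)
      hSψ hSa hSb)
    have hdS : d ≤ 2 * c * S := by
      refine hR.norm_sub_le hc hΘconv hΘpos hψΘ (T := insert ψ T₀)
        (Set.insert_subset hψΘ hT₀Θ) (Set.mem_insert _ _) (fun η hη => ?_) (fun i l hl τ hτ => ?_)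
        hSc hθ hroot
      · obtain ⟨τ, hτ, hητ⟩ := Set.mem_iUnion₂.1 (hT₀ hη)
        exact ⟨τ, Set.mem_insert_of_mem _ hτ, by
          rw [← dist_eq_norm]; exact (Metric.mem_ball.1 hητ).le⟩
      · exact hS i l (mem_shortLists.2 hl) τ (by simpa using hτ)
    have hSS : S ≤ 2 * c * S := by nlinarith
    obtain ⟨e1, e2⟩ := hR.expansion hc hΘconv hΘpos hψΘ hg hgc
      (fun i l hl => (hSψ i l hl).trans hSS) h2cS hθ hroot hdS
    have hrest : 0 ≤ 1 / s₀ ^ 3 + 2 * c / s₀ ^ 2 + (q + 4 * c ^ 2) / s₀ := by positivity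
    constructor
    · intro j
      rw [← sub_sub]
      calc _ ≤ k₂ * S ^ 3 := (e2 j).trans (le_of_eq (by rw [hk₂]; ring))
        _ ≤ K * S ^ 3 := by
          have : 0 ≤ 4 * c * k₁ := by positivity
          exact mul_le_mul_of_nonneg_right (by linarith) hS3
        _ ≤ _ := by gcongr
    · intro i j
      have e : (θ i - ψ i) * (θ j - ψ j) - rootLin g ξ ψ i * rootLin g ξ ψ j
          = (θ i - ψ i) * (θ j - ψ j - rootLin g ξ ψ j)
            + (θ i - ψ i - rootLin g ξ ψ i) * rootLin g ξ ψ j := by ring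
      have e1' : ∀ j, |θ j - ψ j - rootLin g ξ ψ j| ≤ k₁ * S ^ 2 := fun j =>
        (e1 j).trans (le_of_eq (by rw [hk₁]; ring))
      have f1 : |(θ i - ψ i) * (θ j - ψ j - rootLin g ξ ψ j)| ≤ (2 * c * S) * (k₁ * S ^ 2) := by
        rw [abs_mul]
        exact mul_le_mul ((hδ i).trans hdS) (e1' j) (abs_nonneg _) (by positivity)
      have f2 : |(θ i - ψ i - rootLin g ξ ψ i) * rootLin g ξ ψ j|
          ≤ (k₁ * S ^ 2) * (2 * c * S) := by
        rw [abs_mul]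
        exact mul_le_mul (e1' i) (hlin j) (abs_nonneg _) (by positivity)
      rw [e]
      calc _ ≤ 4 * c * k₁ * S ^ 3 := (abs_add_le _ _).trans ((add_le_add f1 f2).trans
            (le_of_eq (by ring)))
        _ ≤ K * S ^ 3 := mul_le_mul_of_nonneg_right (by linarith) hS3
        _ ≤ _ := by gcongr
  · have hSpos : 0 < S := hs₀0.trans hSs
    have t3 : 1 ≤ 1 / s₀ ^ 3 * S ^ 3 := by
      rw [one_div, ← inv_pow, ← mul_pow]
      refine one_le_pow₀ ?_
      rw [inv_mul_eq_div, one_le_div hs₀0]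
      exact hSs.le
    have t2 : S ≤ 1 / s₀ ^ 2 * S ^ 3 := by
      have : 1 ≤ (s₀⁻¹ * S) ^ 2 := by
        refine one_le_pow₀ ?_
        rw [inv_mul_eq_div, one_le_div hs₀0]
        exact hSs.le
      calc S = 1 * S := (one_mul S).symm
        _ ≤ (s₀⁻¹ * S) ^ 2 * S := by gcongr
        _ = _ := by rw [mul_pow, inv_pow]; ring
    have t1 : S ^ 2 ≤ 1 / s₀ * S ^ 3 := by
      have : 1 ≤ s₀⁻¹ * S := by
        rw [inv_mul_eq_div, one_le_div hs₀0]
        exact hSs.le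
      calc S ^ 2 = 1 * S ^ 2 := (one_mul _).symm
        _ ≤ (s₀⁻¹ * S) * S ^ 2 := by gcongr
        _ = _ := by ring
    have hkk : 0 ≤ k₂ + 4 * c * k₁ := by positivity
    have total : ∀ x : ℝ, x ≤ (1 + d ^ 2) + 2 * c * S + (q + 4 * c ^ 2) * S ^ 2 →
        x ≤ K * (S ^ 3 * (1 + d ^ 2)) := by
      intro x hx
      have g1 : 1 + d ^ 2 ≤ 1 / s₀ ^ 3 * (S ^ 3 * (1 + d ^ 2)) := by
        have := mul_le_mul_of_nonneg_right t3 (by linarith : 0 ≤ 1 + d ^ 2)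
        linarith
      have g2 : 2 * c * S ≤ 2 * c / s₀ ^ 2 * (S ^ 3 * (1 + d ^ 2)) := by
        calc 2 * c * S ≤ 2 * c * (1 / s₀ ^ 2 * S ^ 3) := by gcongr
          _ = 2 * c / s₀ ^ 2 * S ^ 3 := by ring
          _ ≤ _ := by gcongr
      have g3 : (q + 4 * c ^ 2) * S ^ 2 ≤ (q + 4 * c ^ 2) / s₀ * (S ^ 3 * (1 + d ^ 2)) := by
        calc (q + 4 * c ^ 2) * S ^ 2 ≤ (q + 4 * c ^ 2) * (1 / s₀ * S ^ 3) := by gcongr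
          _ = (q + 4 * c ^ 2) / s₀ * S ^ 3 := by ring
          _ ≤ _ := by gcongr
      have g4 : 0 ≤ (k₂ + 4 * c * k₁) * (S ^ 3 * (1 + d ^ 2)) := by positivity
      rw [hK]
      linarith
    constructor
    · intro j
      rw [← sub_sub]
      refine total _ ?_
      have h1 := abs_sub (θ j - ψ j - rootLin g ξ ψ j) (rootQuad g a ξ ψ j)
      have h2 := abs_sub (θ j - ψ j) (rootLin g ξ ψ j)
      have h3 := hδ j
      have h4 := hlin j
      have h5 := hquad j
      have h6 : d ≤ 1 + d ^ 2 := by nlinarith [sq_nonneg (d - 1)]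
      have h7 : 0 ≤ 4 * c ^ 2 * S ^ 2 := by positivity
      linarith
    · intro i j
      refine total _ ?_
      have h1 := abs_sub ((θ i - ψ i) * (θ j - ψ j)) (rootLin g ξ ψ i * rootLin g ξ ψ j)
      have h2 : |(θ i - ψ i) * (θ j - ψ j)| ≤ d * d := by
        rw [abs_mul]
        exact mul_le_mul (hδ i) (hδ j) (abs_nonneg _) hd0
      have h3 : |rootLin g ξ ψ i * rootLin g ξ ψ j| ≤ (2 * c * S) * (2 * c * S) := by
        rw [abs_mul]
        exact mul_le_mul (hlin i) (hlin j) (abs_nonneg _) (by positivity)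
      have h4 : 0 ≤ q * S ^ 2 := by positivity
      have h5 : 0 ≤ 2 * c * S := by positivity
      have h6 : d * d = d ^ 2 := (sq d).symm
      have h7 : (2 * c * S) * (2 * c * S) = 4 * c ^ 2 * S ^ 2 := by ring
      linarith

end RootBound

/-! ### Regularity of the system of estimating equations for large samples. -/

section Design

variable {m p : ℕ} {n : Fin m → ℕ} {Θ : Set (Fin 2 → ℝ)} {nmax : ℕ} {C : ℝ}
  {X : Matrix (Obs n) (Fin p) ℝ} {L : (Fin 2 → ℝ) → Matrix (Fin p) (Obs n) ℝ}
  {W : Fin 2 → (Fin 2 → ℝ) → Matrix (Obs n) (Obs n) ℝ}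

lemma A_apply (θ : Fin 2 → ℝ) (i b : Fin 2) : A W θ i b = (W i θ * dSig n b).trace := by
  fin_cases i <;> fin_cases b <;> simp [A, dSig]

lemma A_eq_traceFunctional (hN : 0 < total n) (θ : Fin 2 → ℝ) (i b : Fin 2) :
    A W θ i b = total n * traceFunctional n b (W i θ) := by
  rw [A_apply]
  exact (mul_div_cancel₀ _ (by exact_mod_cast hN.ne')).symm

/-- The constant that controls the system of estimating equations. -/
def sysConst (ψ : Fin 2 → ℝ) (nmax : ℕ) (C : ℝ) : ℝ :=
  1 + (nmax + 1) * (C + corrConst C) + (C + corrConst C) * (1 + 2 * sigConst ψ nmax) + 4 * C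

lemma one_le_sysConst (ψ : Fin 2 → ℝ) (nmax : ℕ) (hC : 0 ≤ C) : 1 ≤ sysConst ψ nmax C := by
  have h1 := corrConst_nonneg hC
  have h2 := sigConst_nonneg ψ nmax
  have : 0 ≤ (nmax + 1) * (C + corrConst C) + (C + corrConst C) * (1 + 2 * sigConst ψ nmax)
      + 4 * C := by positivity
  unfold sysConst
  linarith

/-- The asymptotic nondegeneracy of `A` and the size of the sample. -/
structure LargeDesign (Θ : Set (Fin 2 → ℝ)) (nmax : ℕ) (C : ℝ)
    (W : Fin 2 → (Fin 2 → ℝ) → Matrix (Obs n) (Obs n) ℝ) : Prop where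
  total_pos : 0 < total n
  isUnit_det : ∀ θ ∈ Θ, IsUnit (A W θ).det
  inv_le : ∀ θ ∈ Θ, ∀ a b, |(A W θ)⁻¹ a b| ≤ C / total n
  large : 8 * C * ((nmax + 1) * corrConst C) ≤ √(total n)

namespace RegularDesign

variable (h : RegularDesign Θ nmax C n X L W)
include h

lemma abs_coefA_sub_le (hN : 0 < total n) {θ : Fin 2 → ℝ} (hθ : θ ∈ Θ) (i b : Fin 2) :
    |coefA X L W i b θ - traceFunctional n b (W i θ)|
      ≤ (nmax + 1) * corrConst C / √(total n) := by
  have e : coefA X L W i b θ - traceFunctional n b (W i θ)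
      = traceFunctional n b (corr X L W i θ) := by
    rw [coefA, projWeight, map_add]
    ring
  rw [e]
  refine (abs_traceFunctional_le_frob h.size_le hN b _).trans ?_
  have := h.frob_corr i [] (by simp) θ hθ
  have h1 : frob (corr X L W i θ) ≤ corrConst C := this
  gcongr

/-- `A / N` has an inverse with bounded entries. Passing from `W` to `Qᵀ W Q` moves its entries by
`O(N^{-1/2})`; by `LargeDesign.large` the resulting term is at most `‖x‖ / 2`, which turns `2C` into
`4C`. -/
lemma coercive (hL : LargeDesign Θ nmax C W) {θ : Fin 2 → ℝ} (hθ : θ ∈ Θ) (x : Fin 2 → ℝ) :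
    ‖x‖ ≤ 4 * C * ‖fun i => ∑ b, coefA X L W i b θ * x b‖ := by
  have hC := h.const_nonneg
  have hN' : (0 : ℝ) < total n := by exact_mod_cast hL.total_pos
  have hsN : 0 < √(total n) := Real.sqrt_pos.2 hN'
  have hk := corrConst_nonneg hC
  set y : Fin 2 → ℝ := fun i => ∑ b, coefA X L W i b θ * x b with hy
  set e := (nmax + 1) * corrConst C / √(total n) with he
  have he0 : 0 ≤ e := by positivity
  have hAx : ∀ i, |(A W θ *ᵥ x) i| ≤ total n * (‖y‖ + 2 * (e * ‖x‖)) := by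
    intro i
    have e1 : (A W θ *ᵥ x) i = total n * (y i
        - ∑ b, (coefA X L W i b θ - traceFunctional n b (W i θ)) * x b) := by
      simp only [Matrix.mulVec, dotProduct, A_eq_traceFunctional hL.total_pos, hy,
        Fin.sum_univ_two]
      ring
    rw [e1, abs_mul, abs_of_pos hN']
    refine mul_le_mul_of_nonneg_left ((abs_sub _ _).trans (add_le_add (abs_apply_le_norm y i) ?_))
      hN'.le
    exact abs_sum_mul_le (fun b => h.abs_coefA_sub_le hL.total_pos hθ i b) (abs_apply_le_norm x)
  have hx : ‖x‖ ≤ 2 * C * (‖y‖ + 2 * (e * ‖x‖)) := by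
    rw [pi_norm_le_iff_of_nonneg (by positivity)]
    intro i
    have e2 : x i = ∑ b, (A W θ)⁻¹ i b * (A W θ *ᵥ x) b := by
      have : (A W θ)⁻¹ *ᵥ (A W θ *ᵥ x) = x := by
        rw [Matrix.mulVec_mulVec, Matrix.nonsing_inv_mul _ (hL.isUnit_det θ hθ),
          Matrix.one_mulVec]
      exact (congrFun this i).symm
    rw [Real.norm_eq_abs]
    conv_lhs => rw [e2]
    refine (abs_sum_mul_le (hL.inv_le θ hθ i) hAx).trans (le_of_eq ?_)
    field_simp
  have he8 : 8 * C * e ≤ 1 := by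
    rw [he, ← mul_div_assoc, div_le_one hsN]
    exact hL.large
  have : 4 * C * e * ‖x‖ ≤ 1 / 2 * ‖x‖ :=
    mul_le_mul_of_nonneg_right (by linarith) (norm_nonneg x)
  linarith

lemma abs_partials_coefA_le (hN : 0 < total n) (ψ : Fin 2 → ℝ) (i b : Fin 2) {l : List (Fin 2)}
    (hl : l.length ≤ 3) {θ : Fin 2 → ℝ} (hθ : θ ∈ Θ) :
    |partials l (coefA X L W i b) θ| ≤ sysConst ψ nmax C := by
  have hC := h.const_nonneg
  have hk := corrConst_nonneg hC
  have hs := sigConst_nonneg ψ nmax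
  rw [h.partials_coefA i b hl (h.pos hθ)]
  refine (abs_traceFunctional_le h.size_le hN b _).trans ?_
  have h1 : ‖matPartials l (projWeight X L W i) θ‖ ≤ C + corrConst C :=
    h.norm_projWeight i l hl θ hθ
  have h2 : (nmax + 1) * ‖matPartials l (projWeight X L W i) θ‖
      ≤ (nmax + 1) * (C + corrConst C) := by gcongr
  have h3 : 0 ≤ (C + corrConst C) * (1 + 2 * sigConst ψ nmax) + 4 * C := by positivity
  unfold sysConst
  linarith

/-- The third derivatives of `ξ` need only be bounded, not small, and this follows on all of `Θ`
from control of the identity matrix alone, by `abs_quadFunctional_le`. -/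
lemma regularSystem (hL : LargeDesign Θ nmax C W) (ψ : Fin 2 → ℝ) {u : Obs n → ℝ}
    (hu : |quadFunctional ψ u 1| ≤ 1) :
    RegularSystem Θ (sysConst ψ nmax C) (coefA X L W) (fluct X L W ψ u) := by
  have hC := h.const_nonneg
  have hk := corrConst_nonneg hC
  have hs := sigConst_nonneg ψ nmax
  refine ⟨fun i b => contDiffOn_linearMap _ (h.smooth_projWeight i),
    fun i => contDiffOn_linearMap _ (h.smooth_projWeight i), fun i b l hl θ hθ =>
      h.abs_partials_coefA_le hL.total_pos ψ i b hl hθ, fun i l hl θ hθ => ?_,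
      fun θ hθ x => (h.coercive hL hθ x).trans ?_⟩
  · rw [h.partials_fluct ψ u i hl (h.pos hθ)]
    refine (abs_quadFunctional_le h.size_le hL.total_pos ψ u _).trans ?_
    have h1 : ‖matPartials l (projWeight X L W i) θ‖ ≤ C + corrConst C :=
      h.norm_projWeight i l hl θ hθ
    have h2 : ‖matPartials l (projWeight X L W i) θ‖
        * (|quadFunctional ψ u 1| + 2 * sigConst ψ nmax)
        ≤ (C + corrConst C) * (1 + 2 * sigConst ψ nmax) := by gcongr
    have h3 : 0 ≤ (nmax + 1) * (C + corrConst C) + 4 * C := by positivity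
    unfold sysConst
    linarith
  · refine mul_le_mul_of_nonneg_right ?_ (norm_nonneg _)
    have h3 : 0 ≤ (nmax + 1) * (C + corrConst C) + (C + corrConst C) * (1 + 2 * sigConst ψ nmax) :=
      by positivity
    unfold sysConst
    linarith

lemma coef_inv (hL : LargeDesign Θ nmax C W) (ψ : Fin 2 → ℝ) {θ : Fin 2 → ℝ} (hθ : θ ∈ Θ) :
    (Matrix.of fun i b => coefA X L W i b θ)⁻¹ * (Matrix.of fun i b => coefA X L W i b θ) = 1 ∧
    ∀ i j, |(Matrix.of fun i b => coefA X L W i b θ)⁻¹ i j| ≤ sysConst ψ nmax C := by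
  have hC := h.const_nonneg
  set a : Matrix (Fin 2) (Fin 2) ℝ := Matrix.of fun i b => coefA X L W i b θ with ha
  have hco : ∀ x, ‖x‖ ≤ 4 * C * ‖a *ᵥ x‖ := fun x => h.coercive hL hθ x
  have hinj : Function.Injective a.mulVec := by
    intro x y hxy
    have := hco (x - y)
    rw [Matrix.mulVec_sub, show a *ᵥ x = a *ᵥ y from hxy, sub_self, norm_zero, mul_zero] at this
    exact sub_eq_zero.1 (norm_le_zero_iff.1 this)
  have hu : IsUnit a := Matrix.mulVec_injective_iff_isUnit.1 hinj
  have hdet : IsUnit a.det := (Matrix.isUnit_iff_isUnit_det a).1 hu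
  refine ⟨Matrix.nonsing_inv_mul _ hdet, fun i j => ?_⟩
  have h1 := hco (a⁻¹ *ᵥ Pi.single j 1)
  rw [Matrix.mulVec_mulVec, Matrix.mul_nonsing_inv _ hdet, Matrix.one_mulVec] at h1
  have h2 : ‖(Pi.single j 1 : Fin 2 → ℝ)‖ ≤ 1 := by
    rw [pi_norm_le_iff_of_nonneg zero_le_one]
    intro k
    rcases eq_or_ne k j with rfl | hk
    · simp
    · simp [hk]
  have h3 : |a⁻¹ i j| ≤ ‖a⁻¹ *ᵥ (Pi.single j 1 : Fin 2 → ℝ)‖ := by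
    have := abs_apply_le_norm (a⁻¹ *ᵥ (Pi.single j 1 : Fin 2 → ℝ)) i
    simpa using this
  have hk := corrConst_nonneg hC
  have hs := sigConst_nonneg ψ nmax
  have h4 : 4 * C * ‖(Pi.single j 1 : Fin 2 → ℝ)‖ ≤ 4 * C * 1 := by gcongr
  have h5 : 0 ≤ (nmax + 1) * (C + corrConst C) + (C + corrConst C) * (1 + 2 * sigConst ψ nmax) := by
    positivity
  unfold sysConst
  linarith

end RegularDesign

end Design

end NER

namespace NER

open scoped Matrix.Norms.L2Operator

/-! ### Expectations, and the `N^{-3/2}` estimate of cubic errors. -/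

section HasMean

variable {Ω : Type*} [MeasurableSpace Ω] {P : Measure Ω}

/-- `f` is integrable with expectation `e`. -/
def HasMean (P : Measure Ω) (f : Ω → ℝ) (e : ℝ) : Prop := Integrable f P ∧ ∫ ω, f ω ∂P = e

lemma HasMean.const_mul {f : Ω → ℝ} {e : ℝ} (h : HasMean P f e) (r : ℝ) :
    HasMean P (fun ω => r * f ω) (r * e) :=
  ⟨h.1.const_mul r, by rw [integral_const_mul, h.2]⟩

lemma HasMean.sub {f f' : Ω → ℝ} {e e' : ℝ} (h : HasMean P f e) (h' : HasMean P f' e') :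
    HasMean P (fun ω => f ω - f' ω) (e - e') :=
  ⟨h.1.sub h'.1, by rw [integral_sub h.1 h'.1, h.2, h'.2]⟩

lemma HasMean.add {f f' : Ω → ℝ} {e e' : ℝ} (h : HasMean P f e) (h' : HasMean P f' e') :
    HasMean P (fun ω => f ω + f' ω) (e + e') :=
  ⟨h.1.add h'.1, by rw [integral_add h.1 h'.1, h.2, h'.2]⟩

lemma HasMean.sum {ι : Type*} {s : Finset ι} {f : ι → Ω → ℝ} {e : ι → ℝ}
    (h : ∀ i ∈ s, HasMean P (f i) (e i)) : HasMean P (fun ω => ∑ i ∈ s, f i ω) (∑ i ∈ s, e i) :=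
  ⟨integrable_finsetSum s fun i hi => (h i hi).1, by
    rw [integral_finsetSum s fun i hi => (h i hi).1]
    exact Finset.sum_congr rfl fun i hi => (h i hi).2⟩

lemma memLp_four_sum_abs {ι : Type*} {s : Finset ι} {f : ι → Ω → ℝ}
    (h : ∀ i ∈ s, MemLp (f i) 4 P) : MemLp (fun ω => ∑ i ∈ s, |f i ω|) 4 P :=
  memLp_finsetSum s fun i hi => (h i hi).abs

lemma integral_sum_abs_pow_four_le {ι : Type*} {s : Finset ι} {f : ι → Ω → ℝ}
    (h : ∀ i ∈ s, MemLp (f i) 4 P) {b : ℝ} (hb : ∀ i ∈ s, ∫ ω, f i ω ^ 4 ∂P ≤ b) :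
    ∫ ω, (∑ i ∈ s, |f i ω|) ^ 4 ∂P ≤ (s.card : ℝ) ^ 4 * b := by
  rcases s.eq_empty_or_nonempty with rfl | hs
  · simp
  have hcard : (0 : ℝ) < s.card := by exact_mod_cast hs.card_pos
  have h1 : ∀ ω, (∑ i ∈ s, |f i ω|) ^ 4 ≤ (s.card : ℝ) ^ 3 * ∑ i ∈ s, f i ω ^ 4 := by
    intro ω
    have := pow_sum_div_card_le_sum_pow (s := s) (f := fun i => |f i ω|)
      (fun i _ => abs_nonneg _) 3
    rw [div_le_iff₀ (by positivity)] at this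
    have e4 : Even 4 := by decide
    simp only [Nat.reduceAdd, e4.pow_abs] at this
    linarith
  have hint : Integrable (fun ω => ∑ i ∈ s, f i ω ^ 4) P :=
    integrable_finsetSum s fun i hi => (h i hi).integrable_pow_four
  calc ∫ ω, (∑ i ∈ s, |f i ω|) ^ 4 ∂P ≤ ∫ ω, (s.card : ℝ) ^ 3 * ∑ i ∈ s, f i ω ^ 4 ∂P :=
        integral_mono (memLp_four_sum_abs h).integrable_pow_four (hint.const_mul _) h1
    _ = (s.card : ℝ) ^ 3 * ∑ i ∈ s, ∫ ω, f i ω ^ 4 ∂P := by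
        rw [integral_const_mul, integral_finsetSum s fun i hi => (h i hi).integrable_pow_four]
    _ ≤ (s.card : ℝ) ^ 3 * ∑ _i ∈ s, b := by
        gcongr with i hi
        exact hb i hi
    _ = _ := by
        rw [Finset.sum_const, nsmul_eq_mul]
        ring

lemma abs_integral_sub_le {f F : Ω → ℝ} {e K b : ℝ} (hf : Integrable f P) (hF : HasMean P F e)
    {S D : Ω → ℝ} (hS : MemLp S 4 P) (hD : MemLp D 4 P)
    (hK : 0 ≤ K) (h : ∀ᵐ ω ∂P, |f ω - F ω| ≤ K * (S ω ^ 3 * D ω))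
    (hb : ∫ ω, S ω ^ 3 * D ω ∂P ≤ b) : |∫ ω, f ω ∂P - e| ≤ K * b := by
  have hSD : Integrable (fun ω => S ω ^ 3 * D ω) P := by
    simpa using integrable_pow_mul_pow hS hD (i := 3) (j := 1) rfl
  rw [← hF.2, ← integral_sub hf hF.1]
  refine (abs_integral_le_integral_abs).trans ?_
  refine (integral_mono_ae (hf.sub hF.1).abs (hSD.const_mul K) h).trans ?_
  rw [integral_const_mul]
  gcongr

lemma rpow_neg_three_halves {N : ℝ} (hN : 0 < N) : N ^ (-(3 / 2) : ℝ) = ((√N)⁻¹) ^ 3 := by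
  rw [Real.sqrt_eq_rpow, ← Real.rpow_neg hN.le, ← Real.rpow_natCast, ← Real.rpow_mul hN.le]
  norm_num

/-- Hölder's inequality with exponents `4/3` and `4` gives this rate; here it takes the form `x³ y ≤
x⁴ + y⁴` with `x = √N S` and `y = D`. -/
lemma integral_cube_mul_le {S D : Ω → ℝ} (hS : MemLp S 4 P) (hD : MemLp D 4 P) {N kS kD : ℝ}
    (hN : 0 < N) (hkS : ∫ ω, S ω ^ 4 ∂P ≤ kS / N ^ 2) (hkD : ∫ ω, D ω ^ 4 ∂P ≤ kD) :
    ∫ ω, S ω ^ 3 * D ω ∂P ≤ (kS + kD) * N ^ (-(3 / 2) : ℝ) := by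
  rw [rpow_neg_three_halves hN]
  have hs : 0 < √N := Real.sqrt_pos.2 hN
  have hs2 : √N ^ 2 = N := Real.sq_sqrt hN.le
  have hSD : Integrable (fun ω => S ω ^ 3 * D ω) P := by
    simpa using integrable_pow_mul_pow hS hD (i := 3) (j := 1) rfl
  have h1 : ∀ ω, S ω ^ 3 * D ω ≤ ((√N)⁻¹) ^ 3 * (N ^ 2 * S ω ^ 4 + D ω ^ 4) := by
    intro ω
    have h2 := (le_abs_self _).trans
      (abs_pow_mul_pow_le (√N * S ω) (D ω) (i := 3) (j := 1) rfl)
    have h3 : (√N * S ω) ^ 4 = N ^ 2 * S ω ^ 4 := by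
      rw [mul_pow, show √N ^ 4 = (√N ^ 2) ^ 2 by ring, hs2]
    rw [h3, pow_one] at h2
    calc S ω ^ 3 * D ω = ((√N)⁻¹) ^ 3 * ((√N * S ω) ^ 3 * D ω) := by
          field_simp
      _ ≤ _ := by gcongr
  have i4 := hS.integrable_pow_four
  have j4 := hD.integrable_pow_four
  have h5 := integral_mono hSD (((i4.const_mul (N ^ 2)).add j4).const_mul (((√N)⁻¹) ^ 3)) h1
  have h6 : ∫ ω, ((√N)⁻¹) ^ 3 * (N ^ 2 * S ω ^ 4 + D ω ^ 4) ∂P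
      = ((√N)⁻¹) ^ 3 * (N ^ 2 * ∫ ω, S ω ^ 4 ∂P + ∫ ω, D ω ^ 4 ∂P) := by
    rw [integral_const_mul, integral_add (i4.const_mul _) j4, integral_const_mul]
  refine h5.trans ?_
  refine h6.le.trans ?_
  rw [mul_comm (kS + kD)]
  have h7 : N ^ 2 * ∫ ω, S ω ^ 4 ∂P ≤ kS := by
    rw [le_div_iff₀ (by positivity)] at hkS
    linarith
  gcongr

end HasMean

/-! ### Moments of the estimator. -/

section Moments

variable {Ω : Type*} [MeasurableSpace Ω] {P : Measure Ω} [IsProbabilityMeasure P]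

lemma memLp_four_of_eighth {f : Ω → ℝ} (hf : Measurable f)
    (h8 : Integrable (fun ω => f ω ^ 8) P) : MemLp f 4 P := by
  rw [memLp_four_iff hf.aestronglyMeasurable]
  refine ((integrable_const (1 : ℝ)).add h8).mono' (hf.pow_const 4).aestronglyMeasurable
    (ae_of_all _ fun ω => ?_)
  have : 0 ≤ f ω ^ 4 := by positivity
  rw [Real.norm_of_nonneg this]
  simp only [Pi.add_apply]
  nlinarith [sq_nonneg (f ω ^ 4 - 1), sq_nonneg (f ω ^ 4)]

/-- The error bound contains `‖θ - ψ‖²` and is integrated in `L⁴`, which is why eighth moments of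
the estimator are needed. The constant is `1024 = 8 · 128`. -/
lemma one_add_sq_pow_four_le (x ψ : Fin 2 → ℝ) :
    (1 + ‖x - ψ‖ ^ 2) ^ 4 ≤ 8 + 1024 * ∑ a, (x a ^ 8 + ψ a ^ 8) := by
  have hxy : ∀ x y : ℝ, (x + y) ^ 4 ≤ 8 * (x ^ 4 + y ^ 4) := fun x y => by
    have h1 : (x + y) ^ 2 ≤ 2 * (x ^ 2 + y ^ 2) := by nlinarith [sq_nonneg (x - y)]
    have h2 : ((x + y) ^ 2) ^ 2 ≤ (2 * (x ^ 2 + y ^ 2)) ^ 2 :=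
      pow_le_pow_left₀ (sq_nonneg _) h1 2
    nlinarith [sq_nonneg (x ^ 2 - y ^ 2)]
  have h8 : ∀ x y : ℝ, (x - y) ^ 8 ≤ 128 * (x ^ 8 + y ^ 8) := fun x y => by
    have h1 : (x - y) ^ 2 ≤ 2 * (x ^ 2 + y ^ 2) := by nlinarith [sq_nonneg (x + y)]
    have h2 : ((x - y) ^ 2) ^ 4 ≤ (2 * (x ^ 2 + y ^ 2)) ^ 4 :=
      pow_le_pow_left₀ (sq_nonneg _) h1 4
    have h3 := hxy (x ^ 2) (y ^ 2)
    calc (x - y) ^ 8 = ((x - y) ^ 2) ^ 4 := by ring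
      _ ≤ (2 * (x ^ 2 + y ^ 2)) ^ 4 := h2
      _ = 16 * (x ^ 2 + y ^ 2) ^ 4 := by ring
      _ ≤ 16 * (8 * ((x ^ 2) ^ 4 + (y ^ 2) ^ 4)) := by gcongr
      _ = _ := by ring
  have hn : ‖x - ψ‖ ^ 8 ≤ ∑ a, (x a - ψ a) ^ 8 := by
    have h0 : 0 ≤ ∑ a, (x a - ψ a) ^ 8 := Finset.sum_nonneg fun a _ => by positivity
    obtain ⟨a, ha⟩ : ∃ a, ‖x - ψ‖ ≤ |x a - ψ a| := by
      have h1 : ‖x - ψ‖ ≤ max |x 0 - ψ 0| |x 1 - ψ 1| := by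
        rw [pi_norm_le_iff_of_nonneg (by positivity)]
        intro b
        fin_cases b
        · exact le_max_left _ _
        · exact le_max_right _ _
      rcases max_choice |x 0 - ψ 0| |x 1 - ψ 1| with h2 | h2
      · exact ⟨0, h1.trans h2.le⟩
      · exact ⟨1, h1.trans h2.le⟩
    refine (pow_le_pow_left₀ (norm_nonneg _) ha 8).trans ?_
    rw [Even.pow_abs (by decide : Even 8)]
    exact Finset.single_le_sum (f := fun a => (x a - ψ a) ^ 8) (fun a _ => by positivity)
      (Finset.mem_univ a)
  calc (1 + ‖x - ψ‖ ^ 2) ^ 4 ≤ 8 * (1 ^ 4 + (‖x - ψ‖ ^ 2) ^ 4) := hxy _ _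
    _ = 8 + 8 * ‖x - ψ‖ ^ 8 := by ring
    _ ≤ 8 + 8 * ∑ a, (x a - ψ a) ^ 8 := by gcongr
    _ ≤ 8 + 8 * ∑ a, 128 * (x a ^ 8 + ψ a ^ 8) := by
        gcongr with a
        exact h8 _ _
    _ = _ := by
        rw [← Finset.mul_sum]
        ring

/-- A bound for the fourth moment of `1 + ‖ψ̂ - ψ‖²`. -/
def estConst (ψ : Fin 2 → ℝ) (M : ℝ) : ℝ := 8 + 1024 * ∑ a : Fin 2, (M + ψ a ^ 8)

lemma estimator_moment {x : Ω → Fin 2 → ℝ} (hx : Measurable x) {M : ℝ} (ψ : Fin 2 → ℝ)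
    (h8 : ∀ a, Integrable (fun ω => x ω a ^ 8) P ∧ ∫ ω, x ω a ^ 8 ∂P ≤ M) :
    MemLp (fun ω => 1 + ‖x ω - ψ‖ ^ 2) 4 P ∧
      ∫ ω, (1 + ‖x ω - ψ‖ ^ 2) ^ 4 ∂P ≤ estConst ψ M := by
  have hm : Measurable fun ω => 1 + ‖x ω - ψ‖ ^ 2 := ((hx.sub_const ψ).norm.pow_const 2).const_add 1
  have hi : Integrable (fun ω => ∑ a, (x ω a ^ 8 + ψ a ^ 8)) P :=
    integrable_finsetSum _ fun a _ => (h8 a).1.add (integrable_const _)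
  have hi2 : Integrable (fun ω => 8 + 1024 * ∑ a, (x ω a ^ 8 + ψ a ^ 8)) P :=
    (integrable_const _).add (hi.const_mul _)
  have hD : MemLp (fun ω => 1 + ‖x ω - ψ‖ ^ 2) 4 P := by
    rw [memLp_four_iff hm.aestronglyMeasurable]
    refine hi2.mono' (hm.pow_const 4).aestronglyMeasurable (ae_of_all _ fun ω => ?_)
    rw [Real.norm_of_nonneg (by positivity)]
    exact one_add_sq_pow_four_le _ _
  refine ⟨hD, (integral_mono hD.integrable_pow_four hi2
    fun ω => one_add_sq_pow_four_le _ _).trans ?_⟩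
  have e : ∫ ω, (8 + 1024 * ∑ a, (x ω a ^ 8 + ψ a ^ 8)) ∂P
      = 8 + 1024 * ∑ a, (∫ ω, x ω a ^ 8 ∂P + ψ a ^ 8) := by
    have hsum := HasMean.sum (P := P) (s := Finset.univ) fun a (_ : a ∈ Finset.univ) =>
      HasMean.add ⟨(h8 a).1, rfl⟩
        (⟨integrable_const (ψ a ^ 8), by simp⟩ : HasMean P (fun _ => ψ a ^ 8) (ψ a ^ 8))
    exact (HasMean.add (⟨integrable_const 8, by simp⟩ : HasMean P (fun _ => (8 : ℝ)) 8)
      (hsum.const_mul 1024)).2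
  refine e.le.trans ?_
  unfold estConst
  gcongr with a
  exact (h8 a).2

end Moments

/-! ### Moments of the fluctuations and of the terms of the expansion. -/

section Design

variable {m p : ℕ} {n : Fin m → ℕ} {Θ : Set (Fin 2 → ℝ)} {nmax : ℕ} {C : ℝ}
  {X : Matrix (Obs n) (Fin p) ℝ} {L : (Fin 2 → ℝ) → Matrix (Fin p) (Obs n) ℝ}
  {W : Fin 2 → (Fin 2 → ℝ) → Matrix (Obs n) (Obs n) ℝ}

/-- The matrices whose quadratic forms control the stochastic expansion of the estimator. -/
noncomputable def testMat (X : Matrix (Obs n) (Fin p) ℝ)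
    (L : (Fin 2 → ℝ) → Matrix (Fin p) (Obs n) ℝ)
    (W : Fin 2 → (Fin 2 → ℝ) → Matrix (Obs n) (Obs n) ℝ) :
    Option ((Fin 2 → ℝ) × Fin 2 × List (Fin 2)) → Matrix (Obs n) (Obs n) ℝ
  | none => 1
  | some (τ, i, l) => matPartials l (projWeight X L W i) τ

/-- The indices of the matrices `testMat`. -/
noncomputable def testIndex (T : Finset (Fin 2 → ℝ)) :
    Finset (Option ((Fin 2 → ℝ) × Fin 2 × List (Fin 2))) :=
  Finset.insertNone (T ×ˢ (Finset.univ ×ˢ shortLists))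

/-- The size of the fluctuations. -/
noncomputable def noiseSize (X : Matrix (Obs n) (Fin p) ℝ)
    (L : (Fin 2 → ℝ) → Matrix (Fin p) (Obs n) ℝ)
    (W : Fin 2 → (Fin 2 → ℝ) → Matrix (Obs n) (Obs n) ℝ) (T : Finset (Fin 2 → ℝ))
    (ψ : Fin 2 → ℝ) (u : Obs n → ℝ) : ℝ :=
  ∑ j ∈ testIndex T, |quadFunctional ψ u (testMat X L W j)|

lemma abs_quadFunctional_le_noiseSize {T : Finset (Fin 2 → ℝ)} (ψ : Fin 2 → ℝ) (u : Obs n → ℝ)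
    {j : Option ((Fin 2 → ℝ) × Fin 2 × List (Fin 2))} (hj : j ∈ testIndex T) :
    |quadFunctional ψ u (testMat X L W j)| ≤ noiseSize X L W T ψ u :=
  Finset.single_le_sum (f := fun j => |quadFunctional ψ u (testMat X L W j)|)
    (fun _ _ => abs_nonneg _) hj

/-- The scaled covariance `(2 tr (C Σ D Σ) + κ(C, D)) / N` of two quadratic forms. -/
noncomputable def quadCov (Ke Kv : ℝ) (ψ : Fin 2 → ℝ) (C D : Matrix (Obs n) (Obs n) ℝ) : ℝ :=
  (2 * (C * Sig n ψ * D * Sig n ψ).trace + kurt Ke Kv ψ C D) / total n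

/-- The covariance matrix `g V gᵀ`. -/
def covExpr (g : Matrix (Fin 2) (Fin 2) ℝ) (V : Fin 2 → Fin 2 → ℝ) (i j : Fin 2) : ℝ :=
  ∑ k, ∑ l, g i k * g j l * V k l

/-- The expectation of the second-order term of the expansion. -/
def biasExpr (g : Matrix (Fin 2) (Fin 2) ℝ) (V : Fin 2 → Fin 2 → ℝ)
    (V' a' : Fin 2 → Fin 2 → Fin 2 → ℝ) (j : Fin 2) : ℝ :=
  ∑ i, g j i * (∑ b, ∑ k, g b k * V' i b k - ∑ b, ∑ d, a' i b d * covExpr g V d b)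

/-- The size of `testMat`. -/
def testConst (C : ℝ) : ℝ := 1 + (C + corrConst C)

lemma RegularDesign.norm_testMat_le (h : RegularDesign Θ nmax C n X L W)
    {T : Finset (Fin 2 → ℝ)} (hT : ↑T ⊆ Θ) {j : Option ((Fin 2 → ℝ) × Fin 2 × List (Fin 2))}
    (hj : j ∈ testIndex T) : ‖testMat X L W j‖ ≤ testConst C ∧ (testMat X L W j).IsSymm := by
  have hC := h.const_nonneg
  have hk := corrConst_nonneg hC
  rcases j with _ | ⟨τ, i, l⟩
  · exact ⟨norm_one_le.trans (by unfold testConst; linarith), Matrix.isSymm_one⟩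
  · rw [testIndex, Finset.some_mem_insertNone, Finset.mem_product, Finset.mem_product] at hj
    have hl := mem_shortLists.1 hj.2.2
    have h1 : ‖matPartials l (projWeight X L W i) τ‖ ≤ C + corrConst C :=
      h.norm_projWeight i l (hl.trans (by norm_num)) τ (hT hj.1)
    exact ⟨h1.trans (by unfold testConst; linarith), h.isSymm_projWeight i l (h.pos (hT hj.1))⟩

variable {Ω : Type*} [MeasurableSpace Ω] {P : Measure Ω} [IsProbabilityMeasure P]
  {ψ : Fin 2 → ℝ} {Ke Kv : ℝ} {v : Fin m → Ω → ℝ} {ε : Obs n → Ω → ℝ} {M : ℝ}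

/-- The random vector `Z v + ε`. -/
def noise (v : Fin m → Ω → ℝ) (ε : Obs n → Ω → ℝ) (ω : Ω) : Obs n → ℝ :=
  Z n *ᵥ (fun i => v i ω) + fun k => ε k ω

section Quad

variable (hmod : IsNER P n ψ Ke Kv v ε) (hψp : ψ ∈ paramSpace)
  (hv8 : ∀ i, Integrable (fun ω => v i ω ^ 8) P ∧ ∫ ω, v i ω ^ 8 ∂P ≤ M)
  (he8 : ∀ k, Integrable (fun ω => ε k ω ^ 8) P ∧ ∫ ω, ε k ω ^ 8 ∂P ≤ M)
include hmod hψp hv8 he8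

lemma memLp_quadFunctional {A : Matrix (Obs n) (Obs n) ℝ} (hA : A.IsSymm) :
    MemLp (fun ω => quadFunctional ψ (noise v ε ω) A) 4 P := by
  have := (hmod.memLp_centredQuad hψp hv8 he8 hA).mul_const ((total n : ℝ)⁻¹)
  exact this

lemma hasMean_quadFunctional {A : Matrix (Obs n) (Obs n) ℝ} (hA : A.IsSymm) :
    HasMean P (fun ω => quadFunctional ψ (noise v ε ω) A) 0 := by
  refine ⟨(memLp_quadFunctional hmod hψp hv8 he8 hA).integrable (by norm_num), ?_⟩
  have := hmod.integral_centredQuad hψp hv8 he8 hA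
  change ∫ ω, centredQuad ψ A (Z n *ᵥ (fun i => v i ω) + fun k => ε k ω) / total n ∂P = 0
  rw [integral_div, this, zero_div]

lemma hasMean_quadFunctional_mul {A B : Matrix (Obs n) (Obs n) ℝ} (hA : A.IsSymm)
    (hB : B.IsSymm) :
    HasMean P (fun ω => quadFunctional ψ (noise v ε ω) A * quadFunctional ψ (noise v ε ω) B)
      (quadCov Ke Kv ψ A B / total n) := by
  have h2 : (2 : ENNReal) ≤ 4 := by norm_num
  refine ⟨((memLp_quadFunctional hmod hψp hv8 he8 hA).mono_exponent h2).integrable_mul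
    ((memLp_quadFunctional hmod hψp hv8 he8 hB).mono_exponent h2), ?_⟩
  have := hmod.integral_centredQuad_mul hψp hv8 he8 hA hB
  have e : ∀ ω, quadFunctional ψ (noise v ε ω) A * quadFunctional ψ (noise v ε ω) B
      = (centredQuad ψ A (Z n *ᵥ (fun i => v i ω) + fun k => ε k ω)
        * centredQuad ψ B (Z n *ᵥ (fun i => v i ω) + fun k => ε k ω)) / (total n * total n) :=
    fun ω => div_mul_div_comm _ _ _ _
  simp only [e]
  rw [integral_div, this, quadCov, div_div]

lemma integral_quadFunctional_pow_four_le (hn : ∀ i, n i ≤ nmax) (hN : 0 < total n)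
    {A : Matrix (Obs n) (Obs n) ℝ} (hA : A.IsSymm) {κ : ℝ} (hκ : ‖A‖ ≤ κ) :
    ∫ ω, quadFunctional ψ (noise v ε ω) A ^ 4 ∂P
      ≤ (quadMomentConst ψ M nmax * κ ^ 2) ^ 2 / total n ^ 2 := by
  have hN' : (0 : ℝ) < total n := by exact_mod_cast hN
  have h1 := hmod.integral_centredQuad_pow_four_le hψp hv8 he8 hn hA
  have hc := (hmod.centredFamily hψp hv8 he8).nonneg
  have e : ∀ ω, quadFunctional ψ (noise v ε ω) A ^ 4
      = centredQuad ψ A (Z n *ᵥ (fun i => v i ω) + fun k => ε k ω) ^ 4 / (total n : ℝ) ^ 4 :=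
    fun ω => div_pow _ _ _
  simp only [e]
  rw [integral_div]
  have hQ : 0 ≤ quadMomentConst ψ M nmax := by
    unfold quadMomentConst
    positivity
  have hf : frob A ^ 2 ≤ total n * κ ^ 2 := by
    have h2 : frob A ≤ √(total n) * κ := (frob_le_sqrt_total_mul A).trans (by gcongr)
    calc frob A ^ 2 ≤ (√(total n) * κ) ^ 2 := pow_le_pow_left₀ (frob_nonneg A) h2 2
      _ = _ := by rw [mul_pow, Real.sq_sqrt hN'.le]
  have hf0 := frob_nonneg A
  calc _ ≤ (quadMomentConst ψ M nmax * frob A ^ 2) ^ 2 / (total n : ℝ) ^ 4 := by gcongr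
    _ ≤ (quadMomentConst ψ M nmax * (total n * κ ^ 2)) ^ 2 / (total n : ℝ) ^ 4 := by gcongr
    _ = _ := by field_simp

/-- The constant in the fourth moment bound for `noiseSize`. -/
noncomputable def noiseConst (ψ : Fin 2 → ℝ) (M : ℝ) (nmax : ℕ) (C : ℝ)
    (T : Finset (Fin 2 → ℝ)) : ℝ :=
  ((testIndex T).card : ℝ) ^ 4 * (quadMomentConst ψ M nmax * testConst C ^ 2) ^ 2

lemma noiseSize_moment (h : RegularDesign Θ nmax C n X L W) (hN : 0 < total n)
    {T : Finset (Fin 2 → ℝ)} (hT : ↑T ⊆ Θ) :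
    MemLp (fun ω => noiseSize X L W T ψ (noise v ε ω)) 4 P ∧
      ∫ ω, noiseSize X L W T ψ (noise v ε ω) ^ 4 ∂P
        ≤ noiseConst ψ M nmax C T / total n ^ 2 := by
  have h1 : ∀ j ∈ testIndex T,
      MemLp (fun ω => quadFunctional ψ (noise v ε ω) (testMat X L W j)) 4 P := fun j hj =>
    memLp_quadFunctional hmod hψp hv8 he8 (h.norm_testMat_le hT hj).2
  refine ⟨memLp_four_sum_abs h1, (integral_sum_abs_pow_four_le h1 fun j hj =>
    integral_quadFunctional_pow_four_le hmod hψp hv8 he8 h.size_le hN (h.norm_testMat_le hT hj).2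
      (h.norm_testMat_le hT hj).1).trans (le_of_eq ?_)⟩
  rw [noiseConst, mul_div_assoc]

lemma hasMean_rootLin (h : RegularDesign Θ nmax C n X L W) (g : Matrix (Fin 2) (Fin 2) ℝ)
    (j : Fin 2) : HasMean P (fun ω => rootLin g (fluct X L W ψ (noise v ε ω)) ψ j) 0 := by
  have := HasMean.sum (s := Finset.univ) fun i (_ : i ∈ Finset.univ) =>
    (hasMean_quadFunctional hmod hψp hv8 he8 (h.isSymm_projWeight i [] hψp)).const_mul (g j i)
  simp only [mul_zero, Finset.sum_const_zero] at this
  exact this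

lemma hasMean_rootLin_mul (h : RegularDesign Θ nmax C n X L W) (g : Matrix (Fin 2) (Fin 2) ℝ)
    (i j : Fin 2) :
    HasMean P (fun ω => rootLin g (fluct X L W ψ (noise v ε ω)) ψ i
        * rootLin g (fluct X L W ψ (noise v ε ω)) ψ j)
      (covExpr g (fun k l => quadCov Ke Kv ψ (projWeight X L W k ψ) (projWeight X L W l ψ)) i j
        / total n) := by
  have := HasMean.sum (s := Finset.univ) fun k (_ : k ∈ Finset.univ) =>
    HasMean.sum (s := Finset.univ) fun l (_ : l ∈ Finset.univ) =>
      (hasMean_quadFunctional_mul hmod hψp hv8 he8 (h.isSymm_projWeight k [] hψp)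
        (h.isSymm_projWeight l [] hψp)).const_mul (g i k * g j l)
  convert this using 1
  · funext ω
    simp only [rootLin, Fin.sum_univ_two, fluct, matPartials]
    ring
  · simp only [covExpr, Fin.sum_univ_two, matPartials]
    ring

/-- The second-order term is bilinear in the fluctuations and their first derivatives, which are all
centred quadratic forms in the same noise. Its mean is therefore a combination of covariances, of
the form `1/N` times scaled quantities. -/
lemma hasMean_rootQuad (h : RegularDesign Θ nmax C n X L W) (g : Matrix (Fin 2) (Fin 2) ℝ)
    (j : Fin 2) :
    HasMean P (fun ω => rootQuad g (coefA X L W) (fluct X L W ψ (noise v ε ω)) ψ j)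
      (biasExpr g
        (fun k l => quadCov Ke Kv ψ (projWeight X L W k ψ) (projWeight X L W l ψ))
        (fun i b k => quadCov Ke Kv ψ (matPartial b (projWeight X L W i) ψ)
          (projWeight X L W k ψ))
        (fun i b d => traceFunctional n b (matPartial d (projWeight X L W i) ψ)) j
        / total n) := by
  have hf : ∀ i b ω, partialDeriv b (fluct X L W ψ (noise v ε ω) i) ψ
      = quadFunctional ψ (noise v ε ω) (matPartial b (projWeight X L W i) ψ) := fun i b ω =>
    h.partials_fluct ψ (noise v ε ω) i (l := [b]) (by simp) hψp
  have ha : ∀ i b d, partialDeriv d (coefA X L W i b) ψ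
      = traceFunctional n b (matPartial d (projWeight X L W i) ψ) := fun i b d =>
    h.partials_coefA i b (l := [d]) (by simp) hψp
  have h1 := HasMean.sum (s := Finset.univ) fun i (_ : i ∈ Finset.univ) =>
    ((HasMean.sum (s := Finset.univ) fun b (_ : b ∈ Finset.univ) =>
      HasMean.sum (s := Finset.univ) fun k (_ : k ∈ Finset.univ) =>
        (hasMean_quadFunctional_mul hmod hψp hv8 he8 (h.isSymm_projWeight i [b] hψp)
          (h.isSymm_projWeight k [] hψp)).const_mul (g b k)).sub
    (HasMean.sum (s := Finset.univ) fun b (_ : b ∈ Finset.univ) =>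
      HasMean.sum (s := Finset.univ) fun d (_ : d ∈ Finset.univ) =>
        (hasMean_rootLin_mul hmod hψp hv8 he8 h g d b).const_mul
          (traceFunctional n b (matPartial d (projWeight X L W i) ψ)))).const_mul (g j i)
  convert h1 using 1
  · funext ω
    simp only [rootQuad, hf, ha]
    refine Finset.sum_congr rfl fun i _ => ?_
    congr 2
    · refine Finset.sum_congr rfl fun b _ => ?_
      rw [rootLin, Finset.mul_sum]
      refine Finset.sum_congr rfl fun k _ => ?_
      simp only [fluct, matPartials]
      ring
    · refine Finset.sum_congr rfl fun b _ => ?_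
      rw [Finset.sum_mul]
      exact Finset.sum_congr rfl fun d _ => by ring
  · rw [biasExpr, Finset.sum_div]
    refine Finset.sum_congr rfl fun i _ => ?_
    rw [mul_div_assoc, sub_div, Finset.sum_div, Finset.sum_div]
    congr 2
    · refine Finset.sum_congr rfl fun b _ => ?_
      rw [Finset.sum_div]
      exact Finset.sum_congr rfl fun k _ => mul_div_assoc _ _ _
    · refine Finset.sum_congr rfl fun b _ => ?_
      rw [Finset.sum_div]
      exact Finset.sum_congr rfl fun d _ => mul_div_assoc _ _ _

end Quad

end Design

end NER

namespace NER

open scoped Matrix.Norms.L2Operator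

/-! ### Moments of the estimator for one design, and replacement of `Qᵀ W Q` by `W`. -/

section Design

variable {m p : ℕ} {n : Fin m → ℕ} {Θ : Set (Fin 2 → ℝ)} {nmax : ℕ} {C : ℝ}
  {X : Matrix (Obs n) (Fin p) ℝ} {L : (Fin 2 → ℝ) → Matrix (Fin p) (Obs n) ℝ}
  {W : Fin 2 → (Fin 2 → ℝ) → Matrix (Obs n) (Obs n) ℝ}
  {Ω : Type*} [MeasurableSpace Ω] {P : Measure Ω} [IsProbabilityMeasure P]
  {ψ : Fin 2 → ℝ} {Ke Kv : ℝ} {v : Fin m → Ω → ℝ} {ε : Obs n → Ω → ℝ} {M : ℝ}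

/-- The inverse of the matrix of the coefficients of the estimating equations. -/
noncomputable def coefInv (X : Matrix (Obs n) (Fin p) ℝ)
    (L : (Fin 2 → ℝ) → Matrix (Fin p) (Obs n) ℝ)
    (W : Fin 2 → (Fin 2 → ℝ) → Matrix (Obs n) (Obs n) ℝ) (θ : Fin 2 → ℝ) :
    Matrix (Fin 2) (Fin 2) ℝ := (Matrix.of fun i b => coefA X L W i b θ)⁻¹

/-- The moments of the estimator on a single design. -/
lemma estimator_expansion (hmod : IsNER P n ψ Ke Kv v ε) (hψΘ : ψ ∈ Θ)
    (hv8 : ∀ i, Integrable (fun ω => v i ω ^ 8) P ∧ ∫ ω, v i ω ^ 8 ∂P ≤ M)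
    (he8 : ∀ k, Integrable (fun ω => ε k ω ^ 8) P ∧ ∫ ω, ε k ω ^ 8 ∂P ≤ M)
    (h : RegularDesign Θ nmax C n X L W) (hL : LargeDesign Θ nmax C W)
    {T : Finset (Fin 2 → ℝ)} (hT : ↑T ⊆ Θ) {K : ℝ} (hK : 0 ≤ K)
    (hexp : ExpansionBound Θ (sysConst ψ nmax C) ψ T K) (β : Fin p → ℝ)
    {x : Ω → Fin 2 → ℝ} (hx : Measurable x)
    (hsol : ∀ᵐ ω ∂P, (∃ θ ∈ Θ, Solves X L W
        (response X β (fun i => v i ω) (fun k => ε k ω)) θ) →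
      x ω ∈ Θ ∧ Solves X L W (response X β (fun i => v i ω) (fun k => ε k ω)) (x ω))
    (hx8 : ∀ a, Integrable (fun ω => x ω a ^ 8) P ∧ ∫ ω, x ω a ^ 8 ∂P ≤ M) :
    (∀ j, |∫ ω, (x ω j - ψ j) ∂P - biasExpr (coefInv X L W ψ)
        (fun k l => quadCov Ke Kv ψ (projWeight X L W k ψ) (projWeight X L W l ψ))
        (fun i b k => quadCov Ke Kv ψ (matPartial b (projWeight X L W i) ψ)
          (projWeight X L W k ψ))
        (fun i b d => traceFunctional n b (matPartial d (projWeight X L W i) ψ)) j / total n|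
      ≤ K * ((noiseConst ψ M nmax C T + estConst ψ M) * (total n : ℝ) ^ (-(3 / 2) : ℝ))) ∧
    ∀ i j, |∫ ω, (x ω i - ψ i) * (x ω j - ψ j) ∂P - covExpr (coefInv X L W ψ)
        (fun k l => quadCov Ke Kv ψ (projWeight X L W k ψ) (projWeight X L W l ψ)) i j / total n|
      ≤ K * ((noiseConst ψ M nmax C T + estConst ψ M) * (total n : ℝ) ^ (-(3 / 2) : ℝ)) := by
  have hψp := h.pos hψΘ
  have hN := hL.total_pos
  have hN' : (0 : ℝ) < total n := by exact_mod_cast hN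
  obtain ⟨hS4, hSb⟩ := noiseSize_moment hmod hψp hv8 he8 h hN hT
  obtain ⟨hD4, hDb⟩ := estimator_moment hx ψ hx8
  have hSD := integral_cube_mul_le hS4 hD4 hN' hSb hDb
  obtain ⟨hg, hgc⟩ := h.coef_inv hL ψ hψΘ
  have hae : ∀ᵐ ω ∂P, _ := hsol.mono fun ω hω =>
    hexp (coefA X L W) (fluct X L W ψ (noise v ε ω)) (noiseSize X L W T ψ (noise v ε ω)) (x ω)
      (coefInv X L W ψ)
      -- The index `none` stands for the identity matrix, so `S ≤ 1` supplies the control required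
      -- for regularity of the system.
      (fun hS => h.regularSystem hL ψ ((abs_quadFunctional_le_noiseSize (X := X) (L := L) (W := W)
        ψ (noise v ε ω) (T := T) (j := none) Finset.none_mem_insertNone).trans hS)) hg hgc
      (fun i b d => h.abs_partials_coefA_le hN ψ i b (l := [d]) (by simp) hψΘ)
      (fun i l hl τ hτ => by
        rw [h.partials_fluct ψ _ i ((mem_shortLists.1 hl).trans (by norm_num)) (h.pos (hT hτ))]
        refine abs_quadFunctional_le_noiseSize (X := X) (L := L) (W := W) ψ (noise v ε ω)
          (T := T) (j := some (τ, i, l)) ?_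
        rw [testIndex, Finset.some_mem_insertNone, Finset.mem_product, Finset.mem_product]
        exact ⟨hτ, Finset.mem_univ _, hl⟩)
      (fun ⟨η, hη, hroot⟩ => by
        have hiff := fun {θ : Fin 2 → ℝ} (hθ : θ ∈ Θ) =>
          h.solves_iff hN ψ β (fun i => v i ω) (fun k => ε k ω) (h.pos hθ)
        obtain ⟨h1, h2⟩ := hω ⟨η, hη, (hiff hη).2 hroot⟩
        exact ⟨h1, (hiff h1).1 h2⟩)
  have hx4 : ∀ a, MemLp (fun ω => x ω a - ψ a) 4 P := fun a =>
    (memLp_four_of_eighth ((measurable_pi_apply a).comp hx) (hx8 a).1).sub (memLp_const _)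
  have h2 : (2 : ENNReal) ≤ 4 := by norm_num
  constructor
  · intro j
    have hmean := (hasMean_rootLin hmod hψp hv8 he8 h (coefInv X L W ψ) j).add
      (hasMean_rootQuad hmod hψp hv8 he8 h (coefInv X L W ψ) j)
    rw [zero_add] at hmean
    exact abs_integral_sub_le ((hx4 j).integrable (by norm_num)) hmean hS4 hD4 hK
      (hae.mono fun ω hω => hω.1 j) hSD
  · intro i j
    exact abs_integral_sub_le (((hx4 i).mono_exponent h2).integrable_mul
      ((hx4 j).mono_exponent h2)) (hasMean_rootLin_mul hmod hψp hv8 he8 h (coefInv X L W ψ) i j)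
      hS4 hD4 hK (hae.mono fun ω hω => hω.2 i j) hSD

/-- The constant in the bound of `quadCov` by Frobenius norms. -/
def covConst (ψ : Fin 2 → ℝ) (Ke Kv : ℝ) (nmax : ℕ) : ℝ :=
  2 * sigConst ψ nmax ^ 2 + (ψ 1 ^ 2 * |Ke| + ψ 0 ^ 2 * |Kv| * nmax ^ 2)

lemma covConst_nonneg (ψ : Fin 2 → ℝ) (Ke Kv : ℝ) (nmax : ℕ) : 0 ≤ covConst ψ Ke Kv nmax := by
  unfold covConst
  positivity

/-- Both parts of the covariance are bilinear and bounded in Frobenius norm: the trace by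
Cauchy–Schwarz, the kurtosis part because diagonals are dominated by the full matrix. -/
lemma abs_quadCov_le (hn : ∀ i, n i ≤ nmax) (ψ : Fin 2 → ℝ) (Ke Kv : ℝ)
    (A B : Matrix (Obs n) (Obs n) ℝ) :
    |quadCov Ke Kv ψ A B| ≤ covConst ψ Ke Kv nmax * (frob A * frob B) / total n := by
  have hS : ‖Sig n ψ‖ ≤ sigConst ψ nmax := norm_Sig_le hn ψ
  have hA := frob_nonneg A
  have hB := frob_nonneg B
  have hs := sigConst_nonneg ψ nmax
  have h1 : |(A * Sig n ψ * B * Sig n ψ).trace| ≤ sigConst ψ nmax ^ 2 * (frob A * frob B) := by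
    rw [Matrix.mul_assoc (A * Sig n ψ)]
    have a1 : ∀ A : Matrix (Obs n) (Obs n) ℝ, frob (A * Sig n ψ) ≤ frob A * sigConst ψ nmax :=
      fun A => (frob_mul_le' _ _).trans (mul_le_mul_of_nonneg_left hS (frob_nonneg A))
    refine (abs_trace_mul_le _ _).trans ((mul_le_mul (a1 A) (a1 B) (frob_nonneg _)
      (by positivity)).trans (le_of_eq (by ring)))
  have hZ : ∀ A : Matrix (Obs n) (Obs n) ℝ, frob ((Z n)ᵀ * A * Z n) ≤ nmax * frob A := by
    intro A
    have z := norm_Z_le hn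
    have hA := frob_nonneg A
    have z1 := frob_mul_le' ((Z n)ᵀ * A) (Z n)
    have z2 := frob_mul_le (Z n)ᵀ A
    rw [norm_transpose] at z2
    calc _ ≤ frob ((Z n)ᵀ * A) * ‖Z n‖ := z1
      _ ≤ (‖Z n‖ * frob A) * ‖Z n‖ := by gcongr
      _ ≤ (√nmax * frob A) * √nmax := by gcongr
      _ = (√nmax * √nmax) * frob A := by ring
      _ = _ := by rw [Real.mul_self_sqrt (Nat.cast_nonneg _)]
  have h2 := sum_diag_mul_diag_le A B
  have h3 : |∑ i, ((Z n)ᵀ * A * Z n) i i * ((Z n)ᵀ * B * Z n) i i|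
      ≤ nmax ^ 2 * (frob A * frob B) :=
    (sum_diag_mul_diag_le _ _).trans ((mul_le_mul (hZ A) (hZ B) (frob_nonneg _)
      (by positivity)).trans (le_of_eq (by ring)))
  have h4 : |kurt Ke Kv ψ A B| ≤ (ψ 1 ^ 2 * |Ke| + ψ 0 ^ 2 * |Kv| * nmax ^ 2)
      * (frob A * frob B) := by
    unfold kurt
    refine (abs_add_le _ _).trans ?_
    rw [abs_mul, abs_mul, abs_mul, abs_mul, abs_of_nonneg (sq_nonneg (ψ 1)),
      abs_of_nonneg (sq_nonneg (ψ 0))]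
    have h5 := mul_le_mul_of_nonneg_left h2 (by positivity : 0 ≤ ψ 1 ^ 2 * |Ke|)
    have h6 := mul_le_mul_of_nonneg_left h3 (by positivity : 0 ≤ ψ 0 ^ 2 * |Kv|)
    linarith
  rw [quadCov, abs_div, abs_of_nonneg (Nat.cast_nonneg (total n) : (0 : ℝ) ≤ total n)]
  refine div_le_div_of_nonneg_right ?_ (Nat.cast_nonneg _)
  refine (abs_add_le _ _).trans ?_
  rw [abs_mul, abs_two]
  unfold covConst
  linarith

lemma quadCov_add_left (ψ : Fin 2 → ℝ) (Ke Kv : ℝ) (A A' B : Matrix (Obs n) (Obs n) ℝ) :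
    quadCov Ke Kv ψ (A + A') B = quadCov Ke Kv ψ A B + quadCov Ke Kv ψ A' B := by
  simp only [quadCov, kurt, Matrix.add_mul, Matrix.mul_add, Matrix.trace_add, Matrix.add_apply,
    add_mul, Finset.sum_add_distrib]
  ring

lemma quadCov_add_right (ψ : Fin 2 → ℝ) (Ke Kv : ℝ) (A B B' : Matrix (Obs n) (Obs n) ℝ) :
    quadCov Ke Kv ψ A (B + B') = quadCov Ke Kv ψ A B + quadCov Ke Kv ψ A B' := by
  simp only [quadCov, kurt, Matrix.add_mul, Matrix.mul_add, Matrix.trace_add, Matrix.add_apply,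
    mul_add, Finset.sum_add_distrib]
  ring

lemma abs_quadCov_le_norm (hn : ∀ i, n i ≤ nmax) (hN : 0 < total n) (ψ : Fin 2 → ℝ) (Ke Kv : ℝ)
    {A B : Matrix (Obs n) (Obs n) ℝ} {x : ℝ} (hA : ‖A‖ ≤ x) (hB : ‖B‖ ≤ x) :
    |quadCov Ke Kv ψ A B| ≤ covConst ψ Ke Kv nmax * x ^ 2 := by
  have hN' : (0 : ℝ) < total n := by exact_mod_cast hN
  have hc := covConst_nonneg ψ Ke Kv nmax
  have hx : 0 ≤ x := (norm_nonneg _).trans hA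
  have h1 : frob A ≤ √(total n) * x := (frob_le_sqrt_total_mul A).trans (by gcongr)
  have h2 : frob B ≤ √(total n) * x := (frob_le_sqrt_total_mul B).trans (by gcongr)
  have h3 : frob A * frob B ≤ total n * x ^ 2 := by
    refine (mul_le_mul h1 h2 (frob_nonneg _) (by positivity)).trans (le_of_eq ?_)
    calc _ = (√(total n) * √(total n)) * x ^ 2 := by ring
      _ = _ := by rw [Real.mul_self_sqrt hN'.le]
  refine (abs_quadCov_le hn ψ Ke Kv A B).trans ?_
  rw [div_le_iff₀ hN']
  nlinarith [mul_le_mul_of_nonneg_left h3 hc]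

/-- Perturbations of bounded Frobenius norm only change `quadCov` by `O(N^{-1/2})`. -/
lemma abs_quadCov_add_sub_le (hn : ∀ i, n i ≤ nmax) (hN : 0 < total n) (ψ : Fin 2 → ℝ)
    (Ke Kv : ℝ) {A B E F : Matrix (Obs n) (Obs n) ℝ} {x e : ℝ} (hA : ‖A‖ ≤ x) (hB : ‖B‖ ≤ x)
    (hE : frob E ≤ e) (hF : frob F ≤ e) :
    |quadCov Ke Kv ψ (A + E) (B + F) - quadCov Ke Kv ψ A B|
      ≤ covConst ψ Ke Kv nmax * (e * (2 * x + e)) / √(total n) := by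
  have hN' : (0 : ℝ) < total n := by exact_mod_cast hN
  have hs : 0 < √(total n) := Real.sqrt_pos.2 hN'
  -- Since `N ≥ 1`, the Frobenius bound `e` of the perturbation is also at most `√N e`, so it can be
  -- added to the bound for `B`.
  have hs1 : 1 ≤ √(total n) := Real.one_le_sqrt.2 (by exact_mod_cast hN)
  have hss : √(total n) * √(total n) = total n := Real.mul_self_sqrt hN'.le
  have hc := covConst_nonneg ψ Ke Kv nmax
  have hx : 0 ≤ x := (norm_nonneg _).trans hA
  have he : 0 ≤ e := (frob_nonneg _).trans hE
  have h1 : frob A ≤ √(total n) * x := (frob_le_sqrt_total_mul A).trans (by gcongr)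
  have h2 : frob (B + F) ≤ √(total n) * (x + e) := by
    have h3 : frob B ≤ √(total n) * x := (frob_le_sqrt_total_mul B).trans (by gcongr)
    have h4 := frob_add_le B F
    nlinarith
  have e1 : quadCov Ke Kv ψ (A + E) (B + F) - quadCov Ke Kv ψ A B
      = quadCov Ke Kv ψ E (B + F) + quadCov Ke Kv ψ A F := by
    rw [quadCov_add_left, quadCov_add_right ψ Ke Kv A]
    ring
  have b1 : frob E * frob (B + F) ≤ e * (√(total n) * (x + e)) :=
    mul_le_mul hE h2 (frob_nonneg _) he
  have b2 : frob A * frob F ≤ (√(total n) * x) * e :=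
    mul_le_mul h1 hF (frob_nonneg _) (by positivity)
  rw [e1]
  refine (abs_add_le _ _).trans ((add_le_add (abs_quadCov_le hn ψ Ke Kv _ _)
    (abs_quadCov_le hn ψ Ke Kv _ _)).trans ?_)
  rw [← add_div, div_le_div_iff₀ hN' hs]
  have b3 : covConst ψ Ke Kv nmax * (frob E * frob (B + F))
      + covConst ψ Ke Kv nmax * (frob A * frob F)
      ≤ covConst ψ Ke Kv nmax * (e * (2 * x + e)) * √(total n) := by
    have := mul_le_mul_of_nonneg_left (add_le_add b1 b2) hc
    linarith
  calc _ ≤ covConst ψ Ke Kv nmax * (e * (2 * x + e)) * √(total n) * √(total n) := by gcongr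
    _ = _ := by rw [mul_assoc, hss]

namespace RegularDesign

variable (h : RegularDesign Θ nmax C n X L W)
include h

lemma matPartials_corr_bounds (i : Fin 2) {l : List (Fin 2)} (hl : l.length ≤ 3) {θ : Fin 2 → ℝ}
    (hθ : θ ∈ Θ) :
    ‖matPartials l (W i) θ‖ ≤ C ∧ frob (matPartials l (corr X L W i) θ) ≤ corrConst C :=
  ⟨h.norm_W i l hl θ hθ, h.frob_corr i l hl θ hθ⟩

lemma abs_quadCov_sub_le (hN : 0 < total n) (ψ : Fin 2 → ℝ) (Ke Kv : ℝ) (i k : Fin 2)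
    {l l' : List (Fin 2)} (hl : l.length ≤ 3) (hl' : l'.length ≤ 3) {θ : Fin 2 → ℝ}
    (hθ : θ ∈ Θ) :
    |quadCov Ke Kv ψ (matPartials l (projWeight X L W i) θ)
        (matPartials l' (projWeight X L W k) θ)
      - quadCov Ke Kv ψ (matPartials l (W i) θ) (matPartials l' (W k) θ)|
      ≤ covConst ψ Ke Kv nmax * (corrConst C * (2 * C + corrConst C)) / √(total n) := by
  rw [h.matPartials_projWeight i hl (h.pos hθ), h.matPartials_projWeight k hl' (h.pos hθ)]
  obtain ⟨h1, h2⟩ := h.matPartials_corr_bounds i hl hθ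
  obtain ⟨h3, h4⟩ := h.matPartials_corr_bounds k hl' hθ
  exact abs_quadCov_add_sub_le h.size_le hN ψ Ke Kv h1 h3 h2 h4

lemma abs_quadCov_W_le (hN : 0 < total n) (ψ : Fin 2 → ℝ) (Ke Kv : ℝ) (i k : Fin 2)
    {l l' : List (Fin 2)} (hl : l.length ≤ 3) (hl' : l'.length ≤ 3) {θ : Fin 2 → ℝ}
    (hθ : θ ∈ Θ) :
    |quadCov Ke Kv ψ (matPartials l (W i) θ) (matPartials l' (W k) θ)|
      ≤ covConst ψ Ke Kv nmax * C ^ 2 :=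
  abs_quadCov_le_norm h.size_le hN ψ Ke Kv (h.matPartials_corr_bounds i hl hθ).1
    (h.matPartials_corr_bounds k hl' hθ).1

lemma abs_traceFunctional_sub_le (hN : 0 < total n) (i b : Fin 2) {l : List (Fin 2)}
    (hl : l.length ≤ 3) {θ : Fin 2 → ℝ} (hθ : θ ∈ Θ) :
    |traceFunctional n b (matPartials l (projWeight X L W i) θ)
      - traceFunctional n b (matPartials l (W i) θ)|
      ≤ (nmax + 1) * corrConst C / √(total n) := by
  rw [h.matPartials_projWeight i hl (h.pos hθ), map_add, add_sub_cancel_left]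
  refine (abs_traceFunctional_le_frob h.size_le hN b _).trans ?_
  have := (h.matPartials_corr_bounds i hl hθ).2
  gcongr

lemma abs_traceFunctional_W_le (hN : 0 < total n) (i b : Fin 2) {l : List (Fin 2)}
    (hl : l.length ≤ 3) {θ : Fin 2 → ℝ} (hθ : θ ∈ Θ) :
    |traceFunctional n b (matPartials l (W i) θ)| ≤ (nmax + 1) * C := by
  refine (abs_traceFunctional_le h.size_le hN b _).trans ?_
  have := (h.matPartials_corr_bounds i hl hθ).1
  gcongr

/-- The resolvent identity `g - g₀ = g (a₀ - a) g₀`: the outer factors are bounded and the middle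
one is `O(N^{-1/2})`. -/
lemma abs_coefInv_sub_le (hL : LargeDesign Θ nmax C W) (ψ : Fin 2 → ℝ) {θ : Fin 2 → ℝ}
    (hθ : θ ∈ Θ) (i j : Fin 2) :
    |coefInv X L W θ i j - total n * (A W θ)⁻¹ i j|
      ≤ 4 * sysConst ψ nmax C * C * ((nmax + 1) * corrConst C) / √(total n) := by
  have hN' : (0 : ℝ) < total n := by exact_mod_cast hL.total_pos
  have hC := h.const_nonneg
  obtain ⟨hg, hgc⟩ := h.coef_inv hL ψ hθ
  set g := coefInv X L W θ with hgd
  set a : Matrix (Fin 2) (Fin 2) ℝ := Matrix.of fun i b => coefA X L W i b θ with ha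
  set g₀ : Matrix (Fin 2) (Fin 2) ℝ := (total n : ℝ) • (A W θ)⁻¹ with hg₀
  set a₀ : Matrix (Fin 2) (Fin 2) ℝ := Matrix.of fun i b => traceFunctional n b (W i θ) with ha₀
  have hAa₀ : A W θ = (total n : ℝ) • a₀ := by
    ext i b
    rw [A_eq_traceFunctional hL.total_pos]
    rfl
  have h1 : a₀ * g₀ = 1 := by
    have := Matrix.mul_nonsing_inv (A W θ) (hL.isUnit_det θ hθ)
    rw [hg₀, Matrix.mul_smul, ← Matrix.smul_mul, ← hAa₀, this]
  have hga : g * a = 1 := hg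
  have e : g - g₀ = g * (a₀ - a) * g₀ := by
    rw [Matrix.mul_sub, Matrix.sub_mul, Matrix.mul_assoc, h1, hga, Matrix.mul_one, Matrix.one_mul]
  have hg₀c : ∀ k l, |g₀ k l| ≤ C := by
    intro k l
    rw [hg₀, Matrix.smul_apply, smul_eq_mul, abs_mul, abs_of_pos hN']
    have := mul_le_mul_of_nonneg_left (hL.inv_le θ hθ k l) hN'.le
    rwa [mul_div_cancel₀ _ hN'.ne'] at this
  have hd : ∀ k l, |(a₀ - a) k l| ≤ (nmax + 1) * corrConst C / √(total n) := by
    intro k l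
    rw [Matrix.sub_apply, abs_sub_comm]
    exact h.abs_coefA_sub_le hL.total_pos hθ k l
  have e2 : g i j - total n * (A W θ)⁻¹ i j = (g * (a₀ - a) * g₀) i j := by
    rw [← e, Matrix.sub_apply, hg₀, Matrix.smul_apply, smul_eq_mul]
  rw [e2, Matrix.mul_apply]
  have h3 : ∀ k, |(g * (a₀ - a)) i k|
      ≤ 2 * (sysConst ψ nmax C * ((nmax + 1) * corrConst C / √(total n))) := by
    intro k
    rw [Matrix.mul_apply]
    exact abs_sum_mul_le (fun l => hgc i l) (fun l => hd l k)
  exact (abs_sum_mul_le h3 fun k => hg₀c k j).trans (le_of_eq (by ring))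

lemma abs_total_mul_inv_le (hL : LargeDesign Θ nmax C W) {θ : Fin 2 → ℝ} (hθ : θ ∈ Θ)
    (i j : Fin 2) : |total n * (A W θ)⁻¹ i j| ≤ C := by
  have hN' : (0 : ℝ) < total n := by exact_mod_cast hL.total_pos
  rw [abs_mul, abs_of_pos hN']
  have := mul_le_mul_of_nonneg_left (hL.inv_le θ hθ i j) hN'.le
  rwa [mul_div_cancel₀ _ hN'.ne'] at this

end RegularDesign

lemma kurt_comm (ψ : Fin 2 → ℝ) (Ke Kv : ℝ) (A B : Matrix (Obs n) (Obs n) ℝ) :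
    kurt Ke Kv ψ A B = kurt Ke Kv ψ B A := by
  simp only [kurt, mul_comm]

lemma B_apply (ψ : Fin 2 → ℝ) (k l : Fin 2) :
    B W ψ k l = (W k ψ * Sig n ψ * W l ψ * Sig n ψ).trace := by
  have hcyc : (W 1 ψ * Sig n ψ * W 0 ψ * Sig n ψ).trace
      = (W 0 ψ * Sig n ψ * W 1 ψ * Sig n ψ).trace := by
    rw [Matrix.mul_assoc (W 1 ψ * Sig n ψ), Matrix.trace_mul_comm, ← Matrix.mul_assoc]
  fin_cases k <;> fin_cases l <;> simp [B, hcyc]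

/-- Scaling `A⁻¹` by `N` and the covariances by `1/N` leaves a single factor `1/N` in front of a
polynomial in quantities bounded for large `N`. -/
lemma asympCov_eq (hN : 0 < total n) (ψ : Fin 2 → ℝ) (Ke Kv : ℝ) (i j : Fin 2) :
    asympCov W Ke Kv ψ i j
      = covExpr (Matrix.of fun i j => total n * (A W ψ)⁻¹ i j)
        (fun k l => quadCov Ke Kv ψ (W k ψ) (W l ψ)) i j / total n := by
  have hN' : (total n : ℝ) ≠ 0 := by exact_mod_cast hN.ne'
  simp only [asympCov, covExpr, quadCov, ← B_apply, Btilde, Matrix.add_apply, two_nsmul,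
    Matrix.mul_apply, Matrix.transpose_apply, Fin.sum_univ_two, Matrix.of_apply]
  field_simp
  ring

/-- The expansion produces `∑ H_db M_db` with `M = A⁻¹ B A⁻ᵀ`, whereas `tr(H M)` is `∑ H_db M_bd`.
The two agree by the symmetry of `B`, and likewise for `B̃`. -/
lemma secondOrderBias_eq (hN : 0 < total n) (ψ : Fin 2 → ℝ) (Ke Kv : ℝ) (j : Fin 2) :
    secondOrderBias W Ke Kv ψ j
      = biasExpr (Matrix.of fun i j => total n * (A W ψ)⁻¹ i j)
        (fun k l => quadCov Ke Kv ψ (W k ψ) (W l ψ))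
        (fun i b k => quadCov Ke Kv ψ (matPartial b (W i) ψ) (W k ψ))
        (fun i b d => traceFunctional n b (matPartial d (W i) ψ)) j / total n := by
  have hN' : (total n : ℝ) ≠ 0 := by exact_mod_cast hN.ne'
  have hB : B W ψ 1 0 = B W ψ 0 1 := by simp [B]
  have hBt : kurt Ke Kv ψ (W 1 ψ) (W 0 ψ) = kurt Ke Kv ψ (W 0 ψ) (W 1 ψ) := kurt_comm _ _ _ _ _
  have ht : ∀ (b : Fin 2) (D : Matrix (Obs n) (Obs n) ℝ),
      traceFunctional n b D = (D * dSig n b).trace / total n := fun _ _ => rfl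
  have hK : ∀ i b k, (matPartial b (W i) ψ * Sig n ψ * W k ψ * Sig n ψ).trace = K W ψ i b k :=
    fun _ _ _ => rfl
  have hH : ∀ i b d, (matPartial d (W i) ψ * dSig n b).trace = H W ψ i d b := fun _ _ _ => rfl
  have hKt : ∀ i b k, kurt Ke Kv ψ (matPartial b (W i) ψ) (W k ψ) = Ktilde W Ke Kv ψ i b k :=
    fun _ _ _ => rfl
  simp only [secondOrderBias, biasExpr, covExpr, quadCov, ← B_apply, ht, hK, hH, hKt, Btilde,
    Matrix.trace_fin_two, Matrix.mulVec, dotProduct, Pi.add_apply, two_nsmul,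
    Matrix.mul_apply, Matrix.transpose_apply, Fin.sum_univ_two, Matrix.of_apply, hB, hBt]
  field_simp
  ring

end Design

end NER

namespace NER

/-! ### Algebra of bounded sequences with equal leading terms. -/

section AsympClose

/-- Two bounded real sequences that differ by `O(r)`. -/
def AsympClose (r f g : ℕ → ℝ) : Prop :=
  f =O[atTop] (fun _ => (1 : ℝ)) ∧ g =O[atTop] (fun _ => (1 : ℝ)) ∧ (fun t => f t - g t) =O[atTop] r

variable {r f g f' g' : ℕ → ℝ}

lemma AsympClose.add (h : AsympClose r f g) (h' : AsympClose r f' g') :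
    AsympClose r (fun t => f t + f' t) (fun t => g t + g' t) :=
  ⟨h.1.add h'.1, h.2.1.add h'.2.1, (h.2.2.add h'.2.2).congr_left fun t => by ring⟩

lemma AsympClose.sub (h : AsympClose r f g) (h' : AsympClose r f' g') :
    AsympClose r (fun t => f t - f' t) (fun t => g t - g' t) :=
  ⟨h.1.sub h'.1, h.2.1.sub h'.2.1, (h.2.2.sub h'.2.2).congr_left fun t => by ring⟩

/-- Boundedness is part of the relation for the sake of `f f' - g g' = f (f' - g') + (f - g) g'`. -/
lemma AsympClose.mul (h : AsympClose r f g) (h' : AsympClose r f' g') :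
    AsympClose r (fun t => f t * f' t) (fun t => g t * g' t) := by
  refine ⟨(h.1.mul h'.1).congr_right fun _ => one_mul 1,
    (h.2.1.mul h'.2.1).congr_right fun _ => one_mul 1, ?_⟩
  have h1 := (h.1.mul h'.2.2).congr_right fun t => one_mul (r t)
  have h2 := (h.2.2.mul h'.2.1).congr_right fun t => mul_one (r t)
  exact (h1.add h2).congr_left fun t => by ring

lemma AsympClose.of_eventually_le {c b : ℝ} (hr : r =O[atTop] (fun _ => (1 : ℝ)))
    (hd : ∀ᶠ t in atTop, |f t - g t| ≤ c * |r t|) (hg : ∀ᶠ t in atTop, |g t| ≤ b) :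
    AsympClose r f g := by
  have h1 : (fun t => f t - g t) =O[atTop] r := IsBigO.of_bound c hd
  have h2 : g =O[atTop] (fun _ => (1 : ℝ)) := IsBigO.of_bound b (by simpa using hg)
  exact ⟨((h1.trans hr).add h2).congr_left fun t => by ring, h2, h1⟩

lemma AsympClose.covExpr {g g' : ℕ → Matrix (Fin 2) (Fin 2) ℝ} {V V' : ℕ → Fin 2 → Fin 2 → ℝ}
    (hg : ∀ i j, AsympClose r (fun t => g t i j) (fun t => g' t i j))
    (hV : ∀ k l, AsympClose r (fun t => V t k l) (fun t => V' t k l)) (i j : Fin 2) :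
    AsympClose r (fun t => covExpr (g t) (V t) i j) (fun t => covExpr (g' t) (V' t) i j) := by
  have h : ∀ k l, AsympClose r (fun t => g t i k * g t j l * V t k l)
      (fun t => g' t i k * g' t j l * V' t k l) :=
    fun k l => ((hg i k).mul (hg j l)).mul (hV k l)
  simp only [NER.covExpr, Fin.sum_univ_two]
  exact ((h 0 0).add (h 0 1)).add ((h 1 0).add (h 1 1))

lemma AsympClose.biasExpr {g g' : ℕ → Matrix (Fin 2) (Fin 2) ℝ} {V V' : ℕ → Fin 2 → Fin 2 → ℝ}
    {D D' a a' : ℕ → Fin 2 → Fin 2 → Fin 2 → ℝ}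
    (hg : ∀ i j, AsympClose r (fun t => g t i j) (fun t => g' t i j))
    (hV : ∀ k l, AsympClose r (fun t => V t k l) (fun t => V' t k l))
    (hD : ∀ i b k, AsympClose r (fun t => D t i b k) (fun t => D' t i b k))
    (ha : ∀ i b k, AsympClose r (fun t => a t i b k) (fun t => a' t i b k)) (j : Fin 2) :
    AsympClose r (fun t => biasExpr (g t) (V t) (D t) (a t) j)
      (fun t => biasExpr (g' t) (V' t) (D' t) (a' t) j) := by
  have h1 : ∀ i b k, AsympClose r (fun t => g t b k * D t i b k) (fun t => g' t b k * D' t i b k) :=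
    fun i b k => (hg b k).mul (hD i b k)
  have h2 : ∀ i b d, AsympClose r (fun t => a t i b d * NER.covExpr (g t) (V t) d b)
      (fun t => a' t i b d * NER.covExpr (g' t) (V' t) d b) :=
    fun i b d => (ha i b d).mul (AsympClose.covExpr hg hV d b)
  simp only [NER.biasExpr, Fin.sum_univ_two]
  have h3 := fun i => (((h1 i 0 0).add (h1 i 0 1)).add ((h1 i 1 0).add (h1 i 1 1))).sub
    (((h2 i 0 0).add (h2 i 0 1)).add ((h2 i 1 0).add (h2 i 1 1)))
  exact ((hg j 0).mul (h3 0)).add ((hg j 1).mul (h3 1))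

end AsympClose

lemma covariance_eq_integral_sub {Ω : Type*} [MeasurableSpace Ω] {P : Measure Ω}
    [IsProbabilityMeasure P] {f g : Ω → ℝ} (hf : MemLp f 2 P) (hg : MemLp g 2 P) (a b : ℝ) :
    cov[f, g; P] = ∫ ω, (f ω - a) * (g ω - b) ∂P
      - (∫ ω, (f ω - a) ∂P) * ∫ ω, (g ω - b) ∂P := by
  rw [← covariance_sub_const_left (hf.integrable (by norm_num)) a,
    ← covariance_sub_const_right (hg.integrable (by norm_num)) b]
  exact covariance_eq_sub (hf.sub (memLp_const a)) (hg.sub (memLp_const b))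

end NER

/-! ### Assembly of the asymptotic expansions. -/

theorem proposition4
    -- fixed parameters: true variance components, kurtosis parameters, regression coefficients
    (ψ : Fin 2 → ℝ) (Ke Kv : ℝ) {p : ℕ} (β : Fin p → ℝ)
    -- a compact convex set of variance components with the true value in its interior
    (Θ : Set (Fin 2 → ℝ)) (hΘc : IsCompact Θ) (hΘconv : Convex ℝ Θ) (hΘpos : Θ ⊆ NER.paramSpace)
    (hψ : ψ ∈ interior Θ)
    -- a sequence of designs, cluster sizes bounded, total sample size tending to infinity
    (m : ℕ → ℕ) (n : (t : ℕ) → Fin (m t) → ℕ) (nmax : ℕ)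
    (hn : ∀ t i, 1 ≤ n t i ∧ n t i ≤ nmax)
    (hN : Tendsto (fun t => NER.total (n t)) atTop atTop)
    (X : (t : ℕ) → Matrix (NER.Obs (n t)) (Fin p) ℝ)
    -- the nested error regression model
    {Ω : ℕ → Type*} [∀ t, MeasurableSpace (Ω t)] (P : (t : ℕ) → Measure (Ω t))
    [∀ t, IsProbabilityMeasure (P t)]
    (v : (t : ℕ) → Fin (m t) → Ω t → ℝ) (ε : (t : ℕ) → NER.Obs (n t) → Ω t → ℝ)
    (hmodel : ∀ t, NER.IsNER (P t) (n t) ψ Ke Kv (v t) (ε t))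
    -- uniformly bounded eighth moments
    (M : ℝ)
    (hv8 : ∀ t i, Integrable (fun ω => v t i ω ^ 8) (P t) ∧ ∫ ω, v t i ω ^ 8 ∂(P t) ≤ M)
    (he8 : ∀ t k, Integrable (fun ω => ε t k ω ^ 8) (P t) ∧ ∫ ω, ε t k ω ^ 8 ∂(P t) ≤ M)
    -- the linear unbiased estimators `L y` of the regression coefficients
    (L : (t : ℕ) → (Fin 2 → ℝ) → Matrix (Fin p) (NER.Obs (n t)) ℝ)
    (hLX : ∀ t, ∀ θ ∈ NER.paramSpace, L t θ * X t = 1)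
    (hLsmooth : ∀ t j k, ContDiffOn ℝ 3 (fun θ => L t θ j k) NER.paramSpace)
    -- the weight matrices `W_a`
    (W : (t : ℕ) → Fin 2 → (Fin 2 → ℝ) → Matrix (NER.Obs (n t)) (NER.Obs (n t)) ℝ)
    (hWsymm : ∀ t a, ∀ θ ∈ NER.paramSpace, (W t a θ).IsSymm)
    (hWsmooth : ∀ t a j k, ContDiffOn ℝ 3 (fun θ => W t a θ j k) NER.paramSpace)
    -- `(X L)_jk = O(N⁻¹)`, the spectral norms of the `W_a` are `O(1)`, with derivatives up to
    -- order three, and `A⁻¹ = O(N⁻¹)`, all uniformly on `Θ`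
    (C : ℝ)
    (hXL : ∀ t, ∀ l : List (Fin 2), l.length ≤ 3 → ∀ θ ∈ Θ, ∀ j k,
      |NER.matPartials l (fun η => X t * L t η) θ j k| ≤ C / NER.total (n t))
    (hW : ∀ t a, ∀ l : List (Fin 2), l.length ≤ 3 → ∀ θ ∈ Θ, ∀ x : NER.Obs (n t) → ℝ,
      |x ⬝ᵥ (NER.matPartials l (W t a) θ *ᵥ x)| ≤ C * (x ⬝ᵥ x))
    (hA : ∀ᶠ t in atTop, ∀ θ ∈ Θ, IsUnit (NER.A (W t) θ).det ∧
      ∀ a b, |(NER.A (W t) θ)⁻¹ a b| ≤ C / NER.total (n t))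
    -- the estimator: a solution of the estimating equations, with bounded eighth moments
    (ψhat : (t : ℕ) → Ω t → Fin 2 → ℝ) (hmeas : ∀ t, Measurable (ψhat t))
    (hsol : ∀ t, ∀ᵐ ω ∂(P t),
      (∃ θ ∈ Θ, NER.Solves (X t) (L t) (W t)
        (NER.response (X t) β (fun i => v t i ω) (fun k => ε t k ω)) θ) →
      ψhat t ω ∈ Θ ∧ NER.Solves (X t) (L t) (W t)
        (NER.response (X t) β (fun i => v t i ω) (fun k => ε t k ω)) (ψhat t ω))
    (hψ8 : ∀ t a, Integrable (fun ω => ψhat t ω a ^ 8) (P t) ∧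
      ∫ ω, ψhat t ω a ^ 8 ∂(P t) ≤ M) :
    (∀ a b : Fin 2,
      (fun t => cov[fun ω => ψhat t ω a, fun ω => ψhat t ω b; P t]
          - NER.asympCov (W t) Ke Kv ψ a b)
        =O[atTop] fun t => (NER.total (n t) : ℝ) ^ (-(3 / 2) : ℝ)) ∧
    (∀ a : Fin 2,
      (fun t => ∫ ω, (ψhat t ω a - ψ a) ∂(P t)
          - NER.secondOrderBias (W t) Ke Kv ψ a)
        =O[atTop] fun t => (NER.total (n t) : ℝ) ^ (-(3 / 2) : ℝ)) := by
  have hψΘ : ψ ∈ Θ := interior_subset hψ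
  set r : ℕ → ℝ := fun t => (√(NER.total (n t)))⁻¹ with hr
  have hposE : ∀ᶠ t in atTop, 0 < NER.total (n t) := hN.eventually_gt_atTop 0
  have hNR : Tendsto (fun t => (NER.total (n t) : ℝ)) atTop atTop :=
    tendsto_natCast_atTop_atTop.comp hN
  have hsqrt : Tendsto (fun t => √(NER.total (n t) : ℝ)) atTop atTop :=
    Real.tendsto_sqrt_atTop.comp hNR
  have hr1 : r =O[atTop] (fun _ => (1 : ℝ)) := hsqrt.inv_tendsto_atTop.isBigO_one ℝ
  -- `|C|` replaces `C` so that the constant is nonnegative also when some of the bounds are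
  -- vacuous.
  have hreg : ∀ t, NER.RegularDesign Θ nmax |C| (n t) (X t) (L t) (W t) := fun t =>
    { pos := hΘpos
      size_le := fun i => (hn t i).2
      const_nonneg := abs_nonneg C
      unbiased := hLX t
      smooth_L := fun j k => by exact_mod_cast hLsmooth t j k
      symm := hWsymm t
      smooth_W := fun a j k => by exact_mod_cast hWsmooth t a j k
      bound_XL := fun l hl θ hθ j k => (hXL t l hl θ hθ j k).trans
        (div_le_div_of_nonneg_right (le_abs_self C) (Nat.cast_nonneg _))
      bound_W := fun a l hl θ hθ x => (hW t a l hl θ hθ x).trans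
        (mul_le_mul_of_nonneg_right (le_abs_self C)
          (Finset.sum_nonneg fun i _ => mul_self_nonneg (x i))) }
  have hlarge : ∀ᶠ t in atTop, NER.LargeDesign Θ nmax |C| (W t) := by
    filter_upwards [hposE, hA, hsqrt.eventually_ge_atTop
      (8 * |C| * ((nmax + 1) * NER.corrConst |C|))] with t h1 h2 h3
    exact
      { total_pos := h1
        isUnit_det := fun θ hθ => (h2 θ hθ).1
        inv_le := fun θ hθ a b => ((h2 θ hθ).2 a b).trans
          (div_le_div_of_nonneg_right (le_abs_self C) (Nat.cast_nonneg _))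
        large := h3 }
  obtain ⟨T, hT, -, K, hK, hexp⟩ := NER.exists_expansionBound hΘc hΘconv hΘpos hψ
    (NER.one_le_sysConst ψ nmax (abs_nonneg C))
  have hmain := hlarge.mono fun t hL => NER.estimator_expansion (hmodel t) hψΘ (hv8 t) (he8 t)
    (hreg t) hL hT hK hexp β (hmeas t) (hsol t) (hψ8 t)
  set q : ℕ → ℝ := fun t => (NER.total (n t) : ℝ) ^ (-(3 / 2) : ℝ) with hq
  -- The target rate factors as the replacement error `N^{-1/2}` times the common factor `1/N` of
  -- both moments.
  have hqr : ∀ᶠ t in atTop, q t = r t * (NER.total (n t) : ℝ)⁻¹ := hposE.mono fun t ht => by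
    have ht' : (0 : ℝ) < NER.total (n t) := by exact_mod_cast ht
    have : (NER.total (n t) : ℝ)⁻¹ = (√(NER.total (n t) : ℝ))⁻¹ ^ 2 := by
      rw [inv_pow, Real.sq_sqrt ht'.le]
    rw [hq, hr]
    simp only
    rw [NER.rpow_neg_three_halves ht', this]
    ring
  have hbound : ∀ {c : ℝ} (f : ℕ → ℝ), (∀ᶠ t in atTop, |f t| ≤ K * (c * q t)) → f =O[atTop] q :=
    fun {c} f hf => .of_bound (K * c) (hf.mono fun t ht => ht.trans_eq (by
      rw [← mul_assoc, Real.norm_of_nonneg (Real.rpow_nonneg (Nat.cast_nonneg _) _)]))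
  have hg : ∀ i j, NER.AsympClose r (fun t => NER.coefInv (X t) (L t) (W t) ψ i j)
      (fun t => NER.total (n t) * (NER.A (W t) ψ)⁻¹ i j) := fun i j =>
    .of_eventually_le hr1
      (hlarge.mono fun t hL => ((hreg t).abs_coefInv_sub_le hL ψ hψΘ i j).trans_eq
        (by rw [hr, abs_of_nonneg (inv_nonneg.2 (Real.sqrt_nonneg _)), div_eq_mul_inv]))
      (hlarge.mono fun t hL => (hreg t).abs_total_mul_inv_le hL hψΘ i j)
  -- The empty list gives the covariances of the fluctuations themselves; `[b]` gives their
  -- covariances with the first derivatives, which enter the bias.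
  have hV : ∀ (l : List (Fin 2)), l.length ≤ 3 → ∀ i k, NER.AsympClose r
      (fun t => NER.quadCov Ke Kv ψ (NER.matPartials l (NER.projWeight (X t) (L t) (W t) i) ψ)
        (NER.projWeight (X t) (L t) (W t) k ψ))
      (fun t => NER.quadCov Ke Kv ψ (NER.matPartials l (W t i) ψ) (W t k ψ)) :=
    fun l hl i k => .of_eventually_le hr1
      (hposE.mono fun t ht => ((hreg t).abs_quadCov_sub_le ht ψ Ke Kv i k hl
        (l' := []) (by simp) hψΘ).trans_eq
        (by rw [hr, abs_of_nonneg (inv_nonneg.2 (Real.sqrt_nonneg _)), div_eq_mul_inv]))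
      (hposE.mono fun t ht => (hreg t).abs_quadCov_W_le ht ψ Ke Kv i k hl
        (l' := []) (by simp) hψΘ)
  have ha : ∀ i b d, NER.AsympClose r
      (fun t => NER.traceFunctional (n t) b
        (NER.matPartial d (NER.projWeight (X t) (L t) (W t) i) ψ))
      (fun t => NER.traceFunctional (n t) b (NER.matPartial d (W t i) ψ)) :=
    fun i b d => .of_eventually_le hr1
      (hposE.mono fun t ht => ((hreg t).abs_traceFunctional_sub_le ht i b (l := [d]) (by simp)
        hψΘ).trans_eq
        (by rw [hr, abs_of_nonneg (inv_nonneg.2 (Real.sqrt_nonneg _)), div_eq_mul_inv]))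
      (hposE.mono fun t ht => (hreg t).abs_traceFunctional_W_le ht i b (l := [d]) (by simp) hψΘ)
  have hbias := fun j => NER.AsympClose.biasExpr (g' := fun t => Matrix.of fun i j =>
    NER.total (n t) * (NER.A (W t) ψ)⁻¹ i j) hg (hV [] (by simp))
    (D := fun t i b k => NER.quadCov Ke Kv ψ
      (NER.matPartial b (NER.projWeight (X t) (L t) (W t) i) ψ)
      (NER.projWeight (X t) (L t) (W t) k ψ))
    (D' := fun t i b k => NER.quadCov Ke Kv ψ (NER.matPartial b (W t i) ψ) (W t k ψ))
    (fun i b k => hV [b] (by simp) i k) ha j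
  have hcov := fun i j => NER.AsympClose.covExpr (g' := fun t => Matrix.of fun i j =>
    NER.total (n t) * (NER.A (W t) ψ)⁻¹ i j) hg (hV [] (by simp)) i j
  have hinv : (fun t => (NER.total (n t) : ℝ)⁻¹) =O[atTop] fun t => (NER.total (n t) : ℝ)⁻¹ :=
    isBigO_refl _ _
  have hrq : (fun t => r t * (NER.total (n t) : ℝ)⁻¹) =O[atTop] q :=
    (EventuallyEq.symm hqr).isBigO
  -- The error is the cubic remainder of the expansion plus the cost of replacing `Qᵀ W Q` by `W`.
  have hbias1 : ∀ j, (fun t => ∫ ω, (ψhat t ω j - ψ j) ∂(P t)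
      - NER.secondOrderBias (W t) Ke Kv ψ j) =O[atTop] q := by
    intro j
    have h1 := hbound _ (hmain.mono fun t ht => ht.1 j)
    refine (h1.add (((hbias j).2.2.mul hinv).trans hrq)).congr' ?_ .rfl
    filter_upwards [hposE] with t ht
    rw [NER.secondOrderBias_eq ht]
    simp only [NER.matPartials, div_eq_mul_inv]
    ring
  -- The bias is `O(1/N)`, so centring the covariance at `ψ` rather than at the mean changes it only
  -- by a product of two such terms.
  have hmean : ∀ j, (fun t => ∫ ω, (ψhat t ω j - ψ j) ∂(P t))
      =O[atTop] fun t => (NER.total (n t) : ℝ)⁻¹ := by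
    intro j
    have h1 : q =O[atTop] fun t => (NER.total (n t) : ℝ)⁻¹ :=
      (EventuallyEq.trans_isBigO hqr (hr1.mul hinv)).congr_right fun t => one_mul _
    have h2 := ((hbias j).2.1.mul hinv).congr_right fun t => one_mul _
    refine (((hbias1 j).trans h1).add h2).congr' ?_ .rfl
    filter_upwards [hposE] with t ht
    rw [NER.secondOrderBias_eq ht]
    simp only [NER.matPartials, div_eq_mul_inv]
    ring
  -- For one factor of that product the weaker rate `N^{-1/2}` suffices to reach `N^{-3/2}`.
  have hinvr : (fun t => (NER.total (n t) : ℝ)⁻¹) =O[atTop] r :=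
    ((hr1.mul (isBigO_refl r atTop)).congr_right fun t => one_mul _).congr_left fun t => by
      rw [hr, ← mul_inv, Real.mul_self_sqrt (Nat.cast_nonneg _)]
  refine ⟨fun a b => ?_, hbias1⟩
  have h1 := hbound _ (hmain.mono fun t ht => ht.2 a b)
  have h2 := ((hcov a b).2.2.mul hinv).trans hrq
  have h3 := (((hmean a).trans hinvr).mul (hmean b)).trans hrq
  refine ((h1.add h2).sub h3).congr' ?_ .rfl
  filter_upwards [hposE] with t ht
  have hL2 : ∀ a, MemLp (fun ω => ψhat t ω a) 2 (P t) := fun a =>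
    (NER.memLp_four_of_eighth ((measurable_pi_apply a).comp (hmeas t)) (hψ8 t a).1).mono_exponent
      (by norm_num)
  rw [NER.covariance_eq_integral_sub (hL2 a) (hL2 b) (ψ a) (ψ b), NER.asympCov_eq ht]
  simp only [NER.matPartials, div_eq_mul_inv]
  ring
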